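/- Let $W$ be a smooth (Hausdorff, second countable) manifold with boundary, of dimension $2n\ge 2$, let $Z$ be a smooth manifold of dimension $2n-1$ identified with $\partial W$ by a smooth embedding $Z\hookrightarrow W$ with image $\partial W$, and let $\alpha$ be a contact form on $Z$, with cooriented contact structure $\xi=\ker\alpha$. A symplectic form $\omega$ on $W$ makes $(W,\omega)$ a *weak (symplectic) filling* of $(Z,\ker\alpha)$ if $W$ is connected, $\partial W=Z$ as oriented manifolds ($W$ being oriented by $\omega^n$, $\partial W$ by the outward-vector-first convention, $Z$ by $\alpha\wedge(d\alpha)^{n-1}$), $\omega|_\xi$ is nondegenerate, and $\omega|_\xi+f\,d\alpha|_\xi$ is nondegenerate on $\xi$ for every smooth function $f:Z\to(0,\infty)$. The *scattering tangent bundle* ${}^{\mathrm{sc}}TW$ is the vector bundle whose sections are the vector fields locally spanned by $x^2\partial_x,\ x\partial_{y_1},\dots,x\partial_{y_{2n-1}}$, in local coordinates $(x,y)$ with $W=\{x\ge 0\}$ and $\partial W=\{x=0\}$ (away from $\partial W$ it is $TW$). A *scattering symplectic form* on $W$ is a smooth section $\tilde\omega$ of $\Lambda^2({}^{\mathrm{sc}}T^*W)$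 that is nondegenerate at every point of $W$, boundary included, and closed as an ordinary form on $W\setminus\partial W$. Writing $\tilde\omega=\alpha_x\wedge\frac{dx}{x^3}+\frac{\beta_x}{x^2}$ near a boundary point, the form $\alpha_x|_{TZ}$ at $x=0$ is well defined up to a positive factor; its kernel is the cooriented contact structure *induced* by $\tilde\omega$ on $Z=\partial W$. The pair $(W,\tilde\omega)$ is a *symplectic manifold with scattering boundary $(Z,\ker\alpha)$* if the cooriented contact structure induced on $Z=\partial W$ is $\ker\alpha$ (cooriented by $\alpha$). **Proposition.** If $(W,\omega)$ is a weak filling of $(Z,\ker\alpha)$, then there is a scattering symplectic form $\tilde\omega$ on $W$ such that $(W,\tilde\omega)$ is a symplectic manifold with scattering boundary $(Z,\ker\alpha)$. -/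

import Mathlib

open scoped Manifold ContDiff Topology

noncomputable section

namespace ScatteringFilling

section Forms

variable {E : Type*} [NormedAddCommGroup E] [NormedSpace ℝ E]
  {H : Type*} [TopologicalSpace H] (I : ModelWithCorners ℝ E H)
  (M : Type*) [TopologicalSpace M] [ChartedSpace H M]

/-- A (not necessarily smooth) differential `k`-form on `M`: an alternating `k`-linear form
on each tangent space. -/
abbrev DiffForm (k : ℕ) : Type _ := ∀ p : M, (TangentSpace I p) [⋀^Fin k]→L[ℝ] ℝ

variable {I M}

/-- The expression of a differential form in the preferred chart at `p₀`: its pullback to the model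
vector space under the inverse of the chart. It is meaningful on the target of the chart. -/
def DiffForm.inChart {k : ℕ} (Ω : DiffForm I M k) (p₀ : M) (x : E) : E [⋀^Fin k]→L[ℝ] ℝ :=
  (Ω ((extChartAt I p₀).symm x)).compContinuousLinearMap
    (mfderivWithin 𝓘(ℝ, E) I (extChartAt I p₀).symm (Set.range I) x)

/-- A differential form is smooth (up to the boundary, if there is one) if its expressions in the
charts are smooth. -/
def DiffForm.IsSmooth {k : ℕ} (Ω : DiffForm I M k) : Prop :=
  ∀ p₀ : M, ContDiffOn ℝ ∞ (Ω.inChart p₀) (extChartAt I p₀).target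

/-- The exterior derivative of a differential form, computed at `p` in the preferred chart at `p`.
(For a smooth form on a smooth manifold the result does not depend on the chart.) -/
def DiffForm.d {k : ℕ} (Ω : DiffForm I M k) : DiffForm I M (k + 1) := fun p =>
  (extDerivWithin (Ω.inChart p) (Set.range I) (extChartAt I p p)).compContinuousLinearMap
    (mfderiv I 𝓘(ℝ, E) (extChartAt I p) p)

end Forms

section LinearAlgebra

variable {V : Type*} [AddCommGroup V] [Module ℝ V] [TopologicalSpace V]

/-- The alternating bilinear form `B` restricts to a nondegenerate form on the subspace `S`. -/
def NondegenerateOn (B : V [⋀^Fin 2]→L[ℝ] ℝ) (S : Set V) : Prop :=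
  ∀ u ∈ S, (∀ v ∈ S, B ![u, v] = 0) → u = 0

/-- The hyperplane `ker a` of a linear form `a`. -/
def kernel (a : V [⋀^Fin 1]→L[ℝ] ℝ) : Set V := {u | a ![u] = 0}

/-- The value of the exterior power `B ∧ ⋯ ∧ B` (`n` factors, `n` the number of elements of `κ`)
on the `2n` vectors `v (i, false), v (i, true)`, listed pair after pair. -/
def topPower {κ : Type*} [Fintype κ] [DecidableEq κ] (B : V [⋀^Fin 2]→L[ℝ] ℝ)
    (v : κ × Bool → V) : ℝ :=
  ((2 : ℝ) ^ Fintype.card κ)⁻¹ * ∑ σ : Equiv.Perm (κ × Bool),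
    ((Equiv.Perm.sign σ : ℤ) : ℝ) * ∏ i : κ, B ![v (σ (i, false)), v (σ (i, true))]

/-- The family of vectors `ν, R, w (0, false), w (0, true), w (1, false), …`. -/
def consPair {κ : Type*} (ν R : V) (w : κ × Bool → V) : Option κ × Bool → V
  | (none, false) => ν
  | (none, true) => R
  | (some i, b) => w (i, b)

end LinearAlgebra

section Contact

/-- `α` is a contact form: a smooth `1`-form without zeros such that `dα` is nondegenerate on the
hyperplanes `ker α`. The contact structure `ker α` is cooriented by `α`. -/
structure IsContactForm {m : ℕ} {Z : Type*} [TopologicalSpace Z]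
    [ChartedSpace (EuclideanSpace ℝ (Fin (2 * m + 1))) Z]
    (α : DiffForm (𝓡 (2 * m + 1)) Z 1) : Prop where
  smooth : α.IsSmooth
  ne_zero : ∀ z, α z ≠ 0
  nondegenerate : ∀ z, NondegenerateOn (α.d z) (kernel (α z))

end Contact

section WithBoundary

variable {m : ℕ} {W : Type*} [TopologicalSpace W] [ChartedSpace (EuclideanHalfSpace (2 * m + 2)) W]
  {Z : Type*} [TopologicalSpace Z] [ChartedSpace (EuclideanSpace ℝ (Fin (2 * m + 1))) Z]

/-- `Ω` is a symplectic form on the manifold with boundary `W` (smooth, closed and nondegenerate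
up to and including the boundary). -/
structure IsSymplectic (Ω : DiffForm (𝓡∂ (2 * m + 2)) W 2) : Prop where
  smooth : Ω.IsSmooth
  closed : ∀ p, Ω.d p = 0
  nondegenerate : ∀ p, NondegenerateOn (Ω p) Set.univ

/-- `ι` identifies `Z` with the boundary of `W`. -/
structure IsBoundaryInclusion (ι : Z → W) : Prop where
  smoothEmbedding : Manifold.IsSmoothEmbedding (𝓡 (2 * m + 1)) (𝓡∂ (2 * m + 2)) ∞ ι
  range_eq : Set.range ι = (𝓡∂ (2 * m + 2)).boundary W

/-- A tangent vector at a boundary point is outward pointing. (In the charts `W` is the half-space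
where the coordinate of index `0` is nonnegative.) -/
def IsOutward (q : W) (ν : TangentSpace (𝓡∂ (2 * m + 2)) q) : Prop :=
  (show EuclideanSpace ℝ (Fin (2 * m + 2)) from
    mfderiv (𝓡∂ (2 * m + 2)) 𝓘(ℝ, EuclideanSpace ℝ (Fin (2 * m + 2)))
      (extChartAt (𝓡∂ (2 * m + 2)) q) q ν) 0 < 0

/-- The differential of `ι : Z → W` at `z`. -/
abbrev dIncl (ι : Z → W) (z : Z) :
    TangentSpace (𝓡 (2 * m + 1)) z →L[ℝ] TangentSpace (𝓡∂ (2 * m + 2)) (ι z) :=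
  mfderiv (𝓡 (2 * m + 1)) (𝓡∂ (2 * m + 2)) ι z

/-- The restriction `Ω|_{TZ}` of a `2`-form on `W`. -/
def restrictToBoundary (ι : Z → W) (Ω : DiffForm (𝓡∂ (2 * m + 2)) W 2) :
    DiffForm (𝓡 (2 * m + 1)) Z 2 :=
  fun z => (Ω (ι z)).compContinuousLinearMap (dIncl ι z)

/-- The orientation of `Z` as boundary of `W` (outward vector first, `W` oriented by the top
exterior power of `Ω`) agrees with the contact orientation `α ∧ (dα)^m > 0`. This is tested on
bases `R, w` of `T_z Z` with `w` in `ker α`, for which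
`α ∧ (dα)^m (R, w) = α (R) * (dα)^m (w)`. -/
def BoundaryOrientationsAgree (ι : Z → W) (Ω : DiffForm (𝓡∂ (2 * m + 2)) W 2)
    (α : DiffForm (𝓡 (2 * m + 1)) Z 1) : Prop :=
  ∀ (z : Z) (ν : TangentSpace (𝓡∂ (2 * m + 2)) (ι z)) (R : TangentSpace (𝓡 (2 * m + 1)) z)
    (w : Fin m × Bool → TangentSpace (𝓡 (2 * m + 1)) z),
    IsOutward (ι z) ν → 0 < α z ![R] → (∀ i, w i ∈ kernel (α z)) → 0 < topPower (α.d z) w →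
      0 < topPower (Ω (ι z)) (consPair ν (dIncl ι z R) (fun i => dIncl ι z (w i)))

/-- `(W, Ω)` is a weak symplectic filling of the cooriented contact manifold `(Z, ker α)`, with
`Z` identified with `∂W` by `ι`: `W` is connected, `∂W = Z` as oriented manifolds, `Ω|_ξ` is
symplectic on `ξ = ker α`, and so is `Ω|_ξ + η` for each representative `η = f dα|_ξ`
(`f` a positive smooth function) of the canonical conformal symplectic structure of `ξ`. -/
structure IsWeakFilling (ι : Z → W) (Ω : DiffForm (𝓡∂ (2 * m + 2)) W 2)
    (α : DiffForm (𝓡 (2 * m + 1)) Z 1) : Prop where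
  connected : ConnectedSpace W
  symplectic : IsSymplectic Ω
  contact : IsContactForm α
  boundary : IsBoundaryInclusion (m := m) ι
  oriented : BoundaryOrientationsAgree ι Ω α
  nondegenerate : ∀ z, NondegenerateOn (restrictToBoundary ι Ω z) (kernel (α z))
  weak : ∀ f : Z → ℝ, ContMDiff (𝓡 (2 * m + 1)) 𝓘(ℝ, ℝ) ∞ f → (∀ z, 0 < f z) →
    ∀ z, NondegenerateOn (restrictToBoundary ι Ω z + f z • α.d z) (kernel (α z))

/-- The coordinate vector `∂ₓ` transverse to the boundary of the half-space `x ≥ 0`. -/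
def transverseVector (m : ℕ) : EuclideanSpace ℝ (Fin (2 * m + 2)) := EuclideanSpace.single 0 1

/-- The frame `x² ∂ₓ, x ∂_{y₁}, …, x ∂_{yₙ}` of the scattering tangent bundle of the half-space, at
the point `q = (x, y₁, …, yₙ)`, as the linear map that sends the coordinate vectors
`∂ₓ, ∂_{y₁}, …, ∂_{yₙ}` to it. -/
def scFrame {m : ℕ} (q : EuclideanSpace ℝ (Fin (2 * m + 2))) :
    EuclideanSpace ℝ (Fin (2 * m + 2)) →L[ℝ] EuclideanSpace ℝ (Fin (2 * m + 2)) :=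
  q 0 • ContinuousLinearMap.id ℝ _ +
    ((q 0) ^ 2 - q 0) •
      (EuclideanSpace.proj (0 : Fin (2 * m + 2)) :
        EuclideanSpace ℝ (Fin (2 * m + 2)) →L[ℝ] ℝ).smulRight (transverseVector m)

theorem scFrame_transverse {m : ℕ} (q : EuclideanSpace ℝ (Fin (2 * m + 2))) :
    scFrame q (EuclideanSpace.single 0 1) = (q 0) ^ 2 • EuclideanSpace.single 0 1 := by
  ext i
  by_cases h : i = 0 <;> simp [scFrame, transverseVector, h]

theorem scFrame_tangential {m : ℕ} (q : EuclideanSpace ℝ (Fin (2 * m + 2)))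
    (j : Fin (2 * m + 2)) (hj : j ≠ 0) :
    scFrame q (EuclideanSpace.single j 1) = q 0 • EuclideanSpace.single j 1 := by
  ext i
  simp [scFrame, transverseVector, hj.symm]

/-- `c` is the smooth coefficient function of the `2`-form `Ω` (of which only the values on the
interior of `W` matter) in the chart at `p₀`, with respect to the scattering frame
`x² ∂ₓ, x ∂_{yᵢ}`: it is smooth on the whole chart domain, including the boundary `x = 0`, and for
`x > 0` one has `c (eᵢ, eⱼ) = Ω (fᵢ, fⱼ)` with `f` the scattering frame. So `c` is the local
expression, in the frame dual to `x² ∂ₓ, x ∂_{yᵢ}`, of a smooth section of `Λ² (ˢᶜT*W)` that is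
equal to `Ω` on the interior of `W`; it is determined by `Ω` on the chart domain, as the interior
is dense. -/
structure IsScatteringCoeff (Ω : DiffForm (𝓡∂ (2 * m + 2)) W 2) (p₀ : W)
    (c : EuclideanSpace ℝ (Fin (2 * m + 2)) →
      EuclideanSpace ℝ (Fin (2 * m + 2)) [⋀^Fin 2]→L[ℝ] ℝ) : Prop where
  smooth : ContDiffOn ℝ ∞ c (extChartAt (𝓡∂ (2 * m + 2)) p₀).target
  eq_on_interior : ∀ q ∈ (extChartAt (𝓡∂ (2 * m + 2)) p₀).target, 0 < q 0 →
    c q = (Ω.inChart p₀ q).compContinuousLinearMap (scFrame q)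

/-- `Ω` (as a form on the interior of `W`) is a scattering symplectic form: it is closed on the
interior, and it extends to a smooth section of `Λ² (ˢᶜT*W)` that is nondegenerate at every point
of `W`, boundary points included. The values of `Ω` on the boundary are irrelevant. -/
structure IsScatteringSymplectic (Ω : DiffForm (𝓡∂ (2 * m + 2)) W 2) : Prop where
  closed : ∀ p ∈ (𝓡∂ (2 * m + 2)).interior W, Ω.d p = 0
  smooth_nondegenerate : ∀ p₀ : W, ∃ c, IsScatteringCoeff Ω p₀ c ∧
    ∀ q ∈ (extChartAt (𝓡∂ (2 * m + 2)) p₀).target, NondegenerateOn (c q) Set.univ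

/-- The cooriented contact structure that the scattering form `Ω` induces on the boundary is
`ker α`. Writing `Ω = α_x ∧ dx / x³ + β_x / x²` near a boundary point, with `x` the transverse
coordinate, the induced contact form is `α₀ = α_x|_{TZ}` at `x = 0`, well defined up to a positive
factor. In terms of the coefficients of `Ω` with respect to `x² ∂ₓ, x ∂_{yᵢ}` this means
`α₀ (∂_{yᵢ}) = c (∂_{yᵢ}, ∂ₓ)` at the boundary point. -/
def InducesContactStructure (ι : Z → W) (Ω : DiffForm (𝓡∂ (2 * m + 2)) W 2)
    (α : DiffForm (𝓡 (2 * m + 1)) Z 1) : Prop :=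
  ∀ z : Z, ∃ c, IsScatteringCoeff Ω (ι z) c ∧ ∃ r : ℝ, 0 < r ∧
    ∀ u : TangentSpace (𝓡 (2 * m + 1)) z,
      α z ![u] = r * c (extChartAt (𝓡∂ (2 * m + 2)) (ι z) (ι z))
        ![mfderiv (𝓡∂ (2 * m + 2)) 𝓘(ℝ, EuclideanSpace ℝ (Fin (2 * m + 2)))
            (extChartAt (𝓡∂ (2 * m + 2)) (ι z)) (ι z) (dIncl ι z u),
          transverseVector m]

/-- `(W, Ω)` is a symplectic manifold with scattering boundary `(Z, ker α)`, with `Z` identified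
with `∂W` by `ι`. -/
structure HasScatteringBoundary (ι : Z → W) (Ω : DiffForm (𝓡∂ (2 * m + 2)) W 2)
    (α : DiffForm (𝓡 (2 * m + 1)) Z 1) : Prop where
  symplectic : IsScatteringSymplectic Ω
  boundary : IsBoundaryInclusion (m := m) ι
  contact : IsContactForm α
  induces : InducesContactStructure ι Ω α

end WithBoundary

end ScatteringFilling

end

/-!
# Scattering symplectic forms from weak fillings

Let `a` be any extension of the contact form `α` to a `1`-form on `W`, and let `ρ` be a boundary
defining function. The scattering form is `Ω' = Ω + d(F a)`, where `F` is supported near `∂W` and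
blows up like `1 / ρ²` there. No normal form near the boundary is needed: `Ω'` is closed because
`Ω` is, and it is a scattering form with induced contact form `2 x² F α` at `x = 0`, for every
transverse coordinate `x`. So the point is to choose `F` so that `Ω'` is nondegenerate.

*Shape of `F`.* Take `F = h(η ∘ φ - ρ) / ρ²` with `h(w) = exp(-1/w)` for `w > 0` and `h(w) = 0`
otherwise, `φ` a smooth exhaustion of `W`, and `η` a positive function that is
small along with its derivative. Then
`dF = -G (dρ - t dφ)` with `|t| ≤ |η'(φ)|` and `G ≥ 2 F / ρ`, so that
`Ω' = Ω + F da + G a ∧ (dρ - t dφ)`, where `F ≤ ρ G` and `G > 0` where `F ≠ 0`. The cutoff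
is not harmful, because `h` is monotone: it contributes to `G` with the favourable sign.

*Nondegeneracy near the boundary.* At a boundary point consider `Ω + s da + g a ∧ dρ` with
`s ≥ 0` and `g > 0`. The vector `R` with `Ω(R, ·) = dρ` is tangent to `∂W`, and `a(R) > 0`. Indeed
the weak filling condition joins `Ω` and `dα` on the contact hyperplane `ξ` by a path of
nondegenerate forms, so `Ω^m` and `(dα)^m` have the same sign on `ξ`, and the orientation condition
becomes a condition on the sign of `a(R)` (`contact_pos_of_dual`). For `s = 0` the form is
nondegenerate for all `g ∈ [0, ∞]` as `a(R) > 0` (`not_borderedKernel_zero`). For `g = ∞`, that is,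
on `ξ = ker a ∩ ker dρ`, it is nondegenerate for all `s ∈ [0, ∞]` by the weak filling condition
(`not_borderedKernel_top`). By compactness nondegeneracy persists if `s ≤ δ g`, also for nearby data
(`eventually_twistNondegenerate`). Since `F ≤ ρ G`, this applies to `Ω'` where `ρ` and `t` are
small (`addExact_nondegenerate`). The admissible size `δ` can be chosen uniformly on each sublevel
set of `φ`, which tells how small `η` and `η'` have to be (`exists_twistRadius_compact`,
`exists_small_function`).

*At the boundary.* In a chart with transverse coordinate `x` one has `F = f / x²` with `f` smooth
up to `x = 0` and positive there; this uses Hadamard's lemma on the half-space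
(`exists_contDiffOn_eq_mul`, `exists_isBoundaryDefining`). In the frame `x² ∂ₓ, x ∂_y` the
coefficients of `Ω + d(B / x²)` with `B = f a` are `x² Ω + dB - 2 dx ∧ B`, evaluated on the frame
`x ∂ₓ, ∂_y` (`scCoeff`). They are smooth up to the boundary, and at `x = 0` they are nondegenerate
by the contact condition (`scCoeff_nondegenerate_boundary`).
-/

open scoped Manifold ContDiff Topology

noncomputable section

set_option linter.unusedSectionVars false

namespace ScatteringFilling

/-! ### The top exterior power of a `2`-form -/

section TopPower

variable {V : Type*} [AddCommGroup V] [Module ℝ V] [TopologicalSpace V]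

theorem alternating_swap (B : V [⋀^Fin 2]→L[ℝ] ℝ) (u v : V) : B ![u, v] = -B ![v, u] := by
  have h := B.toAlternatingMap.map_swap ![v, u] (i := 0) (j := 1) (by decide)
  rw [← show B.toAlternatingMap ![u, v] = B ![u, v] from rfl,
    ← show B.toAlternatingMap ![v, u] = B ![v, u] from rfl, ← h]
  congr 1
  ext i
  fin_cases i <;> simp

theorem alternating_self (B : V [⋀^Fin 2]→L[ℝ] ℝ) (u : V) : B ![u, u] = 0 := by
  have := alternating_swap B u u
  linarith

theorem update_pair_zero (u v x : V) : Function.update ![u, v] 0 x = ![x, v] := by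
  ext i; fin_cases i <;> rfl

theorem update_pair_one (u v x : V) : Function.update ![u, v] 1 x = ![u, x] := by
  ext i; fin_cases i <;> rfl

theorem update_single_zero (u x : V) : Function.update ![u] 0 x = ![x] := by
  ext i; fin_cases i; rfl

/-- A continuous alternating `2`-form as a bilinear map. -/
def bilin (B : V [⋀^Fin 2]→L[ℝ] ℝ) : V →ₗ[ℝ] V →ₗ[ℝ] ℝ :=
  LinearMap.mk₂ ℝ (fun u v => B ![u, v])
    (fun u u' v => by simpa only [update_pair_zero] using B.map_update_add ![u, v] 0 u u')
    (fun c u v => by simpa only [update_pair_zero] using B.map_update_smul ![u, v] 0 c u)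
    (fun u v v' => by simpa only [update_pair_one] using B.map_update_add ![u, v] 1 v v')
    (fun c u v => by simpa only [update_pair_one] using B.map_update_smul ![u, v] 1 c v)

@[simp] theorem bilin_apply (B : V [⋀^Fin 2]→L[ℝ] ℝ) (u v : V) : bilin B u v = B ![u, v] := rfl

/-- A continuous alternating `1`-form as a linear form. -/
def linForm (a : V [⋀^Fin 1]→L[ℝ] ℝ) : V →ₗ[ℝ] ℝ where
  toFun u := a ![u]
  map_add' u v := by simpa only [update_single_zero] using a.map_update_add ![u] 0 u v
  map_smul' c u := by
    simpa only [update_single_zero, RingHom.id_apply] using a.map_update_smul ![u] 0 c u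

@[simp] theorem linForm_apply (a : V [⋀^Fin 1]→L[ℝ] ℝ) (u : V) : linForm a u = a ![u] := rfl

variable {κ : Type*} [Fintype κ] [DecidableEq κ]

/-- The summand of `topPower` that belongs to the permutation `σ`, without the sign. -/
def pairing (B : V [⋀^Fin 2]→L[ℝ] ℝ) (w : κ × Bool → V) : ℝ :=
  ∏ i : κ, B ![w (i, false), w (i, true)]

theorem topPower_eq_sum (B : V [⋀^Fin 2]→L[ℝ] ℝ) (v : κ × Bool → V) :
    topPower B v = ((2 : ℝ) ^ Fintype.card κ)⁻¹ *
      ∑ σ : Equiv.Perm (κ × Bool), ((Equiv.Perm.sign σ : ℤ) : ℝ) * pairing B (v ∘ σ) := rfl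

/-- Exchanging the two members of the pair `i` changes the sign of a summand. -/
theorem pairing_flip (B : V [⋀^Fin 2]→L[ℝ] ℝ) (w : κ × Bool → V) (i : κ) :
    pairing B (w ∘ Equiv.Perm.prodExtendRight i Equiv.boolNot) = -pairing B w := by
  unfold pairing
  rw [← Finset.mul_prod_erase _ _ (Finset.mem_univ i),
    ← Finset.mul_prod_erase _ _ (Finset.mem_univ i), ← neg_mul]
  congr 1
  · simp only [Function.comp_apply, Equiv.Perm.prodExtendRight_apply_eq]
    exact alternating_swap _ _ _
  · refine Finset.prod_congr rfl fun j hj => ?_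
    have hj' := Finset.ne_of_mem_erase hj
    simp only [Function.comp_apply, Equiv.Perm.prodExtendRight_apply_ne _ hj']

/-- Permuting the pairs does not change a summand. -/
theorem pairing_permute (B : V [⋀^Fin 2]→L[ℝ] ℝ) (w : κ × Bool → V) (e : Equiv.Perm κ) :
    pairing B (w ∘ Equiv.prodCongrLeft fun _ => e) = pairing B w := by
  unfold pairing
  exact Fintype.prod_equiv e _ _ fun j => rfl

theorem sign_flip (i : κ) :
    Equiv.Perm.sign (Equiv.Perm.prodExtendRight i Equiv.boolNot) = -1 := by
  rw [Equiv.Perm.sign_prodExtendRight]; decide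

theorem sign_permute (e : Equiv.Perm κ) :
    Equiv.Perm.sign ((Equiv.prodCongrLeft fun _ : Bool => e) : Equiv.Perm (κ × Bool)) = 1 := by
  rw [Equiv.Perm.sign_prodCongrLeft]; simp

/-- The product of the values of `B` on the pairs, as a multilinear map. -/
def pairingMultilinear (B : V [⋀^Fin 2]→L[ℝ] ℝ) :
    MultilinearMap ℝ (fun _ : κ × Bool => V) ℝ :=
  MultilinearMap.mk' (pairing B)
    (fun w p x y => by
      obtain ⟨i, b⟩ := p
      have hne : ∀ z, ∏ j ∈ Finset.univ.erase i, B ![Function.update w (i, b) z (j, false),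
          Function.update w (i, b) z (j, true)] =
          ∏ j ∈ Finset.univ.erase i, B ![w (j, false), w (j, true)] := fun z => by
        refine Finset.prod_congr rfl fun j hj => ?_
        have hj' := Finset.ne_of_mem_erase hj
        rw [Function.update_of_ne (by simp [hj']), Function.update_of_ne (by simp [hj'])]
      unfold pairing
      simp only [← Finset.mul_prod_erase _ _ (Finset.mem_univ i), hne]
      rw [← add_mul]
      congr 1
      cases b
      · simp only [Function.update_self, ne_eq, Prod.mk.injEq, Bool.true_eq_false, and_false,
          not_false_eq_true, Function.update_of_ne]
        exact (bilin B).map_add₂ x y (w (i, true))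
      · simp only [Function.update_self, ne_eq, Prod.mk.injEq, Bool.false_eq_true, and_false,
          not_false_eq_true, Function.update_of_ne]
        exact (bilin B (w (i, false))).map_add x y)
    (fun w p c x => by
      obtain ⟨i, b⟩ := p
      have hne : ∀ z, ∏ j ∈ Finset.univ.erase i, B ![Function.update w (i, b) z (j, false),
          Function.update w (i, b) z (j, true)] =
          ∏ j ∈ Finset.univ.erase i, B ![w (j, false), w (j, true)] := fun z => by
        refine Finset.prod_congr rfl fun j hj => ?_
        have hj' := Finset.ne_of_mem_erase hj
        rw [Function.update_of_ne (by simp [hj']), Function.update_of_ne (by simp [hj'])]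
      unfold pairing
      simp only [← Finset.mul_prod_erase _ _ (Finset.mem_univ i), hne]
      rw [smul_eq_mul, ← mul_assoc]
      congr 1
      cases b
      · simp only [Function.update_self, ne_eq, Prod.mk.injEq, Bool.true_eq_false, and_false,
          not_false_eq_true, Function.update_of_ne]
        exact (bilin B).map_smul₂ c x (w (i, true))
      · simp only [Function.update_self, ne_eq, Prod.mk.injEq, Bool.false_eq_true, and_false,
          not_false_eq_true, Function.update_of_ne]
        exact (bilin B (w (i, false))).map_smul c x)

/-- `topPower` as an alternating map in the vectors. -/
def topPowerAlt (B : V [⋀^Fin 2]→L[ℝ] ℝ) : V [⋀^κ × Bool]→ₗ[ℝ] ℝ :=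
  ((2 : ℝ) ^ Fintype.card κ)⁻¹ • MultilinearMap.alternatization (pairingMultilinear B)

theorem topPowerAlt_apply (B : V [⋀^Fin 2]→L[ℝ] ℝ) (v : κ × Bool → V) :
    topPowerAlt B v = topPower B v := by
  rw [topPower_eq_sum, topPowerAlt, AlternatingMap.smul_apply,
    MultilinearMap.alternatization_apply, smul_eq_mul]
  congr 1
  refine Finset.sum_congr rfl fun σ _ => ?_
  rw [Units.smul_def, zsmul_eq_mul]
  rfl

/-- The top power does not depend on the names of the pairs. -/
theorem topPower_relabel {κ' : Type*} [Fintype κ'] [DecidableEq κ'] (e : κ' ≃ κ)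
    (B : V [⋀^Fin 2]→L[ℝ] ℝ) (v : κ × Bool → V) :
    topPower B (fun p : κ' × Bool => v (e p.1, p.2)) = topPower B v := by
  rw [topPower_eq_sum, topPower_eq_sum, Fintype.card_congr e]
  congr 1
  refine Fintype.sum_equiv (e.prodCongr (Equiv.refl Bool)).permCongr _ _ fun σ => ?_
  rw [Equiv.Perm.sign_permCongr]
  congr 1
  exact Fintype.prod_equiv e _ _ fun j => by
    simp [Equiv.permCongr_apply, Prod.map]

/-- If `R` is `B`-orthogonal to the vectors `w`, then
`Bⁿ⁺¹ (ν, R, w) = (n + 1) B (ν, R) Bⁿ (w)`. -/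
theorem topPower_consPair (B : V [⋀^Fin 2]→L[ℝ] ℝ) (ν R : V) (w : κ × Bool → V)
    (hR : ∀ i, B ![R, w i] = 0) :
    topPower B (consPair ν R w) =
      (Fintype.card κ + 1) * B ![ν, R] * topPower B w := by
  classical
  set v : Option κ × Bool → V := consPair ν R w with hv
  set T : Equiv.Perm (Option κ × Bool) → ℝ := fun σ =>
    ((Equiv.Perm.sign σ : ℤ) : ℝ) * pairing B (v ∘ σ) with hT
  -- `R` pairs to zero with every vector of the family except `ν`.
  have hR' : ∀ p, p ≠ ((none : Option κ), false) → B ![v (none, true), v p] = 0 := by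
    rintro ⟨_ | i, _ | _⟩ hp
    · exact absurd rfl hp
    · exact alternating_self _ _
    · exact hR (i, false)
    · exact hR (i, true)
  have hTflip : ∀ (σ : Equiv.Perm (Option κ × Bool)) i,
      T (σ * Equiv.Perm.prodExtendRight i Equiv.boolNot) = T σ := fun σ i => by
    simp only [hT, Equiv.Perm.sign_mul, sign_flip, Equiv.Perm.coe_mul, ← Function.comp_assoc,
      pairing_flip]
    push_cast
    ring
  have hTperm : ∀ (σ : Equiv.Perm (Option κ × Bool)) (e : Equiv.Perm (Option κ)),
      T (σ * Equiv.prodCongrLeft fun _ => e) = T σ := fun σ e => by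
    simp only [hT, Equiv.Perm.sign_mul, sign_permute, Equiv.Perm.coe_mul, ← Function.comp_assoc,
      pairing_permute, mul_one]
  set S : Option κ × Bool → ℝ := fun p => ∑ σ with σ p = (none, true), T σ with hS
  have hSeq : ∀ p, S p = S (none, true) := by
    have step1 : ∀ i, S (i, false) = S (i, true) := fun i => by
      refine Finset.sum_equiv
        (Equiv.mulRight (Equiv.Perm.prodExtendRight i Equiv.boolNot)) ?_ ?_
      · intro σ
        simp [Equiv.Perm.prodExtendRight_apply_eq]
      · intro σ _
        exact (hTflip σ i).symm
    have step2 : ∀ i, S (i, true) = S (none, true) := fun i => by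
      refine Finset.sum_equiv
        (Equiv.mulRight (Equiv.prodCongrLeft fun _ => Equiv.swap none i)) ?_ ?_
      · intro σ
        simp
      · intro σ _
        exact (hTperm σ _).symm
    rintro ⟨i, _ | _⟩
    · rw [step1, step2]
    · rw [step2]
  have htotal : ∑ σ, T σ = (2 * (Fintype.card κ + 1)) * S (none, true) := by
    rw [← Finset.sum_fiberwise Finset.univ (fun σ : Equiv.Perm (Option κ × Bool) =>
      σ.symm (none, true)) T]
    have : ∀ p : Option κ × Bool,
        ∑ σ with (σ : Equiv.Perm (Option κ × Bool)).symm (none, true) = p, T σ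
          = S (none, true) := fun p => by
      rw [← hSeq p]
      refine Finset.sum_congr ?_ fun _ _ => rfl
      ext σ
      simp only [Finset.mem_filter, Finset.mem_univ, true_and, Equiv.symm_apply_eq]
      exact eq_comm
    simp only [this, Finset.sum_const, Finset.card_univ, Fintype.card_prod, Fintype.card_option,
      Fintype.card_bool, nsmul_eq_mul]
    push_cast
    ring
  -- The remaining permutations fix the first pair.
  let P : Option κ × Bool → Prop := fun p => p.1 ≠ none
  let f : κ × Bool ≃ Subtype P :=
    { toFun := fun p => ⟨(some p.1, p.2), by simp [P]⟩
      invFun := fun p => (p.1.1.get (Option.isSome_iff_ne_none.2 p.2), p.1.2)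
      left_inv := fun p => by simp
      right_inv := fun p => by ext <;> simp }
  have hSnone : S (none, true) = B ![ν, R] * ∑ σ : Equiv.Perm (κ × Bool),
      ((Equiv.Perm.sign σ : ℤ) : ℝ) * pairing B (w ∘ σ) := by
    have h1 : S (none, true) =
        ∑ σ with ∀ p, ¬ P p → (σ : Equiv.Perm (Option κ × Bool)) p = p, T σ := by
      symm
      refine Finset.sum_subset ?_ ?_
      · intro σ hσ
        simp only [Finset.mem_filter, Finset.mem_univ, true_and] at hσ ⊢
        exact hσ _ (by simp [P])
      · intro σ hσ hσ'
        simp only [Finset.mem_filter, Finset.mem_univ, true_and] at hσ hσ'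
        have hne : σ (none, false) ≠ (none, false) := fun h => hσ' <| by
          rintro ⟨_ | i, _ | _⟩ hp
          · exact h
          · exact hσ
          all_goals simp [P] at hp
        have : pairing B (v ∘ σ) = 0 := by
          refine Finset.prod_eq_zero (Finset.mem_univ none) ?_
          rw [alternating_swap, Function.comp_apply, Function.comp_apply, hσ, hR' _ hne, neg_zero]
        simp [hT, this]
    rw [h1, Finset.mul_sum, Finset.sum_subtype _
      (p := fun σ : Equiv.Perm (Option κ × Bool) => ∀ p, ¬ P p → σ p = p) (by simp) T]
    refine (Fintype.sum_equiv (f.permCongr.trans (Equiv.Perm.subtypeEquivSubtypePerm P)) _ _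
      fun τ => ?_).symm
    have hnone : ∀ b, Equiv.Perm.ofSubtype (f.permCongr τ) ((none : Option κ), b) = (none, b) :=
      fun b => Equiv.Perm.ofSubtype_apply_of_not_mem _ (by simp [P])
    have hsome : ∀ i b, Equiv.Perm.ofSubtype (f.permCongr τ) (some i, b) =
        (some (τ (i, b)).1, (τ (i, b)).2) := fun i b => by
      rw [Equiv.Perm.ofSubtype_apply_of_mem _ (show P (some i, b) by simp [P])]
      have : f.symm ⟨(some i, b), by simp [P]⟩ = (i, b) := rfl
      rw [Equiv.permCongr_apply, this]
      rfl
    have hval : (((f.permCongr.trans (Equiv.Perm.subtypeEquivSubtypePerm P)) τ :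
        {σ : Equiv.Perm (Option κ × Bool) // ∀ p, ¬ P p → σ p = p}) :
        Equiv.Perm (Option κ × Bool)) = Equiv.Perm.ofSubtype (f.permCongr τ) := rfl
    rw [hval]
    simp only [hT, Equiv.Perm.sign_ofSubtype, Equiv.Perm.sign_permCongr, pairing,
      Fintype.prod_option, Function.comp_apply, hnone, hsome]
    simp only [hv, consPair]
    ring
  rw [topPower_eq_sum, topPower_eq_sum, show (∑ σ, ((Equiv.Perm.sign σ : ℤ) : ℝ) *
    pairing B (v ∘ σ)) = ∑ σ, T σ from rfl, htotal, hSnone, Fintype.card_option, pow_succ]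
  field_simp

end TopPower

section TopPower

variable {V : Type*} [AddCommGroup V] [Module ℝ V] [TopologicalSpace V]

/-- A symplectic subspace contains a family of vectors on which the top power is positive. -/
theorem exists_topPower_pos (B : V [⋀^Fin 2]→L[ℝ] ℝ) (n : ℕ) :
    ∀ (S : Submodule ℝ V) [FiniteDimensional ℝ S], Module.finrank ℝ S = 2 * n →
      NondegenerateOn B (S : Set V) →
      ∃ e : Fin n × Bool → V, (∀ p, e p ∈ S) ∧ 0 < topPower B e := by
  induction n with
  | zero =>
    intro S _ _ _
    refine ⟨fun p => p.1.elim0, fun p => p.1.elim0, ?_⟩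
    simp [topPower]
  | succ n ih =>
    intro S _ hS hB
    -- a hyperbolic pair `u, v`
    obtain ⟨u, hu, hu0⟩ : ∃ u ∈ S, u ≠ 0 := by
      refine (Submodule.ne_bot_iff S).1 fun h => ?_
      subst h
      simp at hS
    obtain ⟨v₀, hv₀, huv₀⟩ : ∃ v ∈ S, B ![u, v] ≠ 0 := by
      by_contra! h
      exact hu0 (hB u hu h)
    obtain ⟨v, hv⟩ : ∃ v : V, v = (B ![u, v₀])⁻¹ • v₀ := ⟨_, rfl⟩
    have hvS : v ∈ S := hv ▸ S.smul_mem _ hv₀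
    have huv : B ![u, v] = 1 := by
      have := (bilin B u).map_smul (B ![u, v₀])⁻¹ v₀
      simp only [bilin_apply, smul_eq_mul] at this
      rw [hv, this, inv_mul_cancel₀ huv₀]
    have hvu : B ![v, u] = -1 := by rw [alternating_swap, huv]
    -- its orthogonal complement
    let g : S →ₗ[ℝ] ℝ × ℝ := ((bilin B u).prod (bilin B v)).comp S.subtype
    have hg : ∀ x : S, g x = (B ![u, x], B ![v, x]) := fun x => rfl
    have hgs : LinearMap.range g = ⊤ := by
      rw [LinearMap.range_eq_top]
      rintro ⟨a, b⟩
      refine ⟨a • ⟨v, hvS⟩ - b • ⟨u, hu⟩, ?_⟩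
      rw [map_sub, map_smul, map_smul, hg, hg]
      simp [huv, hvu, alternating_self]
    let S' : Submodule ℝ V := (LinearMap.ker g).map S.subtype
    have hmem : ∀ x, x ∈ S' ↔ x ∈ S ∧ B ![u, x] = 0 ∧ B ![v, x] = 0 := by
      intro x
      simp [S', hg, Submodule.mem_map]
      tauto
    have hS' : Module.finrank ℝ S' = 2 * n := by
      have h1 := LinearMap.finrank_range_add_finrank_ker g
      rw [hgs, finrank_top, hS, Module.finrank_prod, Module.finrank_self] at h1
      have h2 : Module.finrank ℝ S' = Module.finrank ℝ (LinearMap.ker g) :=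
        Submodule.finrank_map_subtype_eq S (LinearMap.ker g)
      omega
    have hB' : NondegenerateOn B (S' : Set V) := by
      intro x hx hxy
      obtain ⟨hxS, hux, hvx⟩ := (hmem x).1 hx
      refine hB x hxS fun y hy => ?_
      set y' : V := y - B ![u, y] • v + B ![v, y] • u with hy'
      have hexp : ∀ z, B ![z, y'] = B ![z, y] - B ![u, y] * B ![z, v] + B ![v, y] * B ![z, u] := by
        intro z
        have : bilin B z y' = bilin B z y - B ![u, y] * bilin B z v + B ![v, y] * bilin B z u := by
          simp only [y', map_add, map_sub, LinearMap.map_smul, smul_eq_mul]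
        exact this
      have hy'S : y' ∈ S' := by
        refine (hmem _).2 ⟨S.add_mem (S.sub_mem hy (S.smul_mem _ hvS)) (S.smul_mem _ hu), ?_, ?_⟩
        · rw [hexp, huv, alternating_self]; ring
        · rw [hexp, hvu, alternating_self]; ring
      have h0 := hexp x
      rw [hxy y' hy'S, alternating_swap B x v, alternating_swap B x u, hux, hvx] at h0
      linarith
    obtain ⟨e, heS, he⟩ := ih S' hS' hB'
    have hpos : 0 < topPower B (consPair u v e) := by
      rw [topPower_consPair B u v e fun i => ((hmem _).1 (heS i)).2.2, huv]
      positivity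
    refine ⟨fun p => consPair u v e (finSuccEquiv n p.1, p.2), fun p => ?_, ?_⟩
    · have : ∀ q : Option (Fin n) × Bool, consPair u v e q ∈ S := by
        rintro ⟨_ | i, _ | _⟩
        · exact hu
        · exact hvS
        · exact ((hmem _).1 (heS (i, false))).1
        · exact ((hmem _).1 (heS (i, true))).1
      exact this _
    · rw [topPower_relabel (finSuccEquiv n)]
      exact hpos

/-- The top power of a nondegenerate form does not vanish on a family on which some top power does
not vanish: such a family is a basis, and the space of top forms is one-dimensional. -/
theorem topPower_ne_zero (S : Submodule ℝ V) [FiniteDimensional ℝ S] {n : ℕ}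
    (hS : Module.finrank ℝ S = 2 * n) {B B' : V [⋀^Fin 2]→L[ℝ] ℝ}
    (hB : NondegenerateOn B (S : Set V)) {w : Fin n × Bool → V} (hw : ∀ p, w p ∈ S)
    (hne : topPower B' w ≠ 0) : topPower B w ≠ 0 := by
  have hli : LinearIndependent ℝ w := by
    by_contra h
    exact hne (by rw [← topPowerAlt_apply]; exact AlternatingMap.map_linearDependent _ _ h)
  let w' : Fin n × Bool → S := fun p => ⟨w p, hw p⟩
  have hli' : LinearIndependent ℝ w' := LinearIndependent.of_comp S.subtype hli
  let b : Module.Basis (Fin n × Bool) ℝ S :=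
    basisOfLinearIndependentOfCardEqFinrank' w' hli' (by simp [hS, mul_comm])
  have hb : (b : Fin n × Bool → S) = w' := by simp [b]
  obtain ⟨e, heS, he⟩ := exists_topPower_pos B n S hS hB
  have hf : (topPowerAlt (κ := Fin n) B).compLinearMap S.subtype ≠ 0 := by
    intro h
    have := congrArg (fun f => f fun p => (⟨e p, heS p⟩ : S)) h
    simp only [AlternatingMap.compLinearMap_apply, AlternatingMap.zero_apply] at this
    rw [show (fun i => S.subtype ⟨e i, heS i⟩) = e from rfl, topPowerAlt_apply] at this
    exact he.ne' this
  have := (AlternatingMap.map_basis_ne_zero_iff b _).2 hf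
  rw [hb, AlternatingMap.compLinearMap_apply] at this
  rw [← topPowerAlt_apply]
  exact this

/-- If all forms `B₀ + s B₁`, `s ≥ 0`, and `B₁` are nondegenerate on a subspace, then `B₀` and `B₁`
induce the same orientation of it. -/
theorem topPower_pos_of_path (S : Submodule ℝ V) [FiniteDimensional ℝ S] {n : ℕ}
    (hS : Module.finrank ℝ S = 2 * n) {B₀ B₁ : V [⋀^Fin 2]→L[ℝ] ℝ}
    (h : ∀ s : ℝ, 0 ≤ s → NondegenerateOn (B₀ + s • B₁) (S : Set V))
    (h₁ : NondegenerateOn B₁ (S : Set V)) {w : Fin n × Bool → V} (hw : ∀ p, w p ∈ S)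
    (hpos : 0 < topPower B₁ w) : 0 < topPower B₀ w := by
  let f : ℝ → ℝ := fun t => topPower ((1 - t) • B₀ + t • B₁) w
  have hf : Continuous f := by
    simp only [f, topPower, ContinuousAlternatingMap.add_apply, ContinuousAlternatingMap.smul_apply]
    fun_prop
  have hnd : ∀ t ∈ Set.Icc (0 : ℝ) 1, f t ≠ 0 := by
    intro t ht
    refine topPower_ne_zero S hS ?_ hw hpos.ne'
    rcases ht.2.eq_or_lt with rfl | h1
    · simpa using h₁
    · intro u hu huv
      have h1' : 0 < 1 - t := by linarith
      refine h (t / (1 - t)) (div_nonneg ht.1 h1'.le) u hu fun v hv => ?_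
      have := huv v hv
      simp only [ContinuousAlternatingMap.add_apply, ContinuousAlternatingMap.smul_apply,
        smul_eq_mul] at this ⊢
      field_simp
      linarith
  have hf1 : f 1 = topPower B₁ w := by simp [f]
  have hf0 : f 0 = topPower B₀ w := by simp [f]
  by_contra hle
  rw [← hf0, not_lt] at hle
  obtain ⟨t, ht, h0⟩ := intermediate_value_Icc zero_le_one hf.continuousOn
    (show (0 : ℝ) ∈ Set.Icc (f 0) (f 1) from ⟨hle, by rw [hf1]; exact hpos.le⟩)
  exact hnd t ht h0

end TopPower

section Boundary

variable {U V : Type*} [AddCommGroup U] [Module ℝ U] [TopologicalSpace U]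
  [AddCommGroup V] [Module ℝ V] [TopologicalSpace V]

theorem finrank_kernel [FiniteDimensional ℝ U] {m : ℕ} (hU : Module.finrank ℝ U = 2 * m + 1)
    {a : U [⋀^Fin 1]→L[ℝ] ℝ} {r : U} (ha : a ![r] ≠ 0) :
    Module.finrank ℝ (LinearMap.ker (linForm a)) = 2 * m := by
  have h1 := LinearMap.finrank_range_add_finrank_ker (linForm a)
  have h2 : LinearMap.range (linForm a) = ⊤ :=
    LinearMap.range_eq_top.2 (LinearMap.surjective_of_ne_zero fun h => ha (by
      rw [← linForm_apply, h]; rfl))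
  rw [h2, finrank_top, Module.finrank_self, hU] at h1
  omega

/-- The vector `D r` that is `Ω`-dual to the inward conormal `τ` of the boundary is tangent to the
boundary and positively transverse to the contact hyperplane `ker a`. This is where the orientation
hypothesis on a weak filling enters. -/
theorem contact_pos_of_dual [FiniteDimensional ℝ U] {m : ℕ} (hU : Module.finrank ℝ U = 2 * m + 1)
    (D : U →L[ℝ] V) (τ : V → ℝ) (hτ : ∀ u, τ (D u) = 0) (ν : V) (hν : τ ν < 0)
    (Ω : V [⋀^Fin 2]→L[ℝ] ℝ) (a : U [⋀^Fin 1]→L[ℝ] ℝ) (A : U [⋀^Fin 2]→L[ℝ] ℝ)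
    (h : ∀ s : ℝ, 0 ≤ s → NondegenerateOn (Ω.compContinuousLinearMap D + s • A) (kernel a))
    (hA : NondegenerateOn A (kernel a))
    (horient : ∀ (R : U) (w : Fin m × Bool → U), 0 < a ![R] → (∀ i, w i ∈ kernel a) →
      0 < topPower A w → 0 < topPower Ω (consPair ν (D R) fun i => D (w i)))
    (r : U) (hr : ∀ v, Ω ![D r, v] = τ v) : 0 < a ![r] := by
  have hker : (LinearMap.ker (linForm a) : Set U) = kernel a := by
    ext u; simp [kernel]
  have hDr : ∀ u, Ω.compContinuousLinearMap D ![r, u] = 0 := fun u => by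
    rw [← hτ u, ← hr (D u)]
    simp [ContinuousAlternatingMap.compContinuousLinearMap_apply]
    congr 1
    ext i
    fin_cases i <;> rfl
  have hne : a ![r] ≠ 0 := by
    intro h0
    have h00 := h 0 le_rfl r h0 fun u _ => by simpa using hDr u
    have := hr ν
    rw [h00, map_zero] at this
    have h3 := (bilin Ω).map_zero₂ ν
    rw [bilin_apply] at h3
    linarith
  by_contra hle
  have hlt : a ![r] < 0 := lt_of_le_of_ne (not_lt.1 hle) hne
  obtain ⟨w, hw, hwA⟩ := exists_topPower_pos A m (LinearMap.ker (linForm a))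
    (finrank_kernel hU hne) (by rwa [hker])
  have hw' : ∀ i, w i ∈ kernel a := fun i => by rw [← hker]; exact hw i
  have hpos : 0 < topPower (Ω.compContinuousLinearMap D) w :=
    topPower_pos_of_path (LinearMap.ker (linForm a)) (finrank_kernel hU hne)
      (fun s hs => by rw [hker]; exact h s hs) (by rwa [hker]) hw hwA
  have hDw : topPower Ω (fun i => D (w i)) = topPower (Ω.compContinuousLinearMap D) w := by
    unfold topPower
    congr 1
    refine Finset.sum_congr rfl fun σ _ => ?_
    congr 1
    refine Finset.prod_congr rfl fun i _ => ?_
    rw [ContinuousAlternatingMap.compContinuousLinearMap_apply]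
    congr 1
    ext i
    fin_cases i <;> rfl
  have hm : a ![-r] = -a ![r] := (linForm a).map_neg r
  have key := horient (-r) w (by rw [hm]; linarith) hw' hwA
  have hD : D (-r) = -D r := map_neg D r
  have hneg : ∀ v, Ω ![-D r, v] = -Ω ![D r, v] := fun v => (bilin Ω).map_neg₂ (D r) v
  rw [hD, topPower_consPair Ω ν (-D r) (fun i => D (w i)) fun i => by
    rw [hneg, hr, hτ, neg_zero], alternating_swap Ω ν, hneg, hr, hDw, neg_neg] at key
  have : (0 : ℝ) < (Fintype.card (Fin m) : ℝ) + 1 := by positivity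
  nlinarith [mul_pos this hpos]

end Boundary

/-! ### Nondegeneracy of twisted forms at a boundary point -/

/-- Nondegeneracy of the `2`-form `Ω + s A + g a ∧ τ`. -/
def TwistNondegenerate {V : Type*} [AddCommGroup V] [Module ℝ V] [TopologicalSpace V]
    (Ω A : V [⋀^Fin 2]→L[ℝ] ℝ) (a : V [⋀^Fin 1]→L[ℝ] ℝ) (τ : V →L[ℝ] ℝ) (s g : ℝ) : Prop :=
  ∀ u, (∀ v, Ω ![u, v] + s * A ![u, v] + g * (a ![u] * τ v - τ u * a ![v]) = 0) → u = 0

section Bordered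

variable {E : Type*} [NormedAddCommGroup E] [NormedSpace ℝ E]

/-- The homogeneous system for a kernel vector `u` of `Ω + s A + g a ∧ τ` with the two additional
unknowns `l = g τ u` and `k = g a u`, in the projective parameters `b = s / (1 + s)` and
`e = (1 + s) / (1 + s + g)`. Unlike the original system it makes sense in the limits `s → ∞`
(`b = 1`) and `g → ∞` (`e = 0`). -/
def BorderedKernel
    (d : (E [⋀^Fin 2]→L[ℝ] ℝ) × (E [⋀^Fin 2]→L[ℝ] ℝ) × (E [⋀^Fin 1]→L[ℝ] ℝ) × (E →L[ℝ] ℝ))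
    (b e : ℝ) (w : E × ℝ × ℝ) : Prop :=
  (∀ v, (1 - b) * d.1 ![w.1, v] + b * d.2.1 ![w.1, v] =
    w.2.1 * d.2.2.1 ![v] - w.2.2 * d.2.2.2 v) ∧
  (1 - e) * d.2.2.2 w.1 = e * w.2.1 ∧ (1 - e) * d.2.2.1 ![w.1] = e * w.2.2

theorem isClosed_borderedKernel :
    IsClosed {p : ((E [⋀^Fin 2]→L[ℝ] ℝ) × (E [⋀^Fin 2]→L[ℝ] ℝ) × (E [⋀^Fin 1]→L[ℝ] ℝ) ×
      (E →L[ℝ] ℝ)) × ℝ × ℝ × E × ℝ × ℝ | BorderedKernel p.1 p.2.1 p.2.2.1 p.2.2.2} := by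
  have e2 : ∀ (f : ((E [⋀^Fin 2]→L[ℝ] ℝ) × (E [⋀^Fin 2]→L[ℝ] ℝ) × (E [⋀^Fin 1]→L[ℝ] ℝ) ×
      (E →L[ℝ] ℝ)) × ℝ × ℝ × E × ℝ × ℝ → E [⋀^Fin 2]→L[ℝ] ℝ) (v : E), Continuous f →
      Continuous fun p => f p ![p.2.2.2.1, v] := fun f v hf =>
    hf.eval (by fun_prop)
  simp only [BorderedKernel, Set.ofPred_and, Set.ofPred_forall]
  refine IsClosed.inter ?_ (IsClosed.inter ?_ ?_)
  · refine isClosed_iInter fun v => isClosed_eq ?_ ?_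
    · exact (((continuous_const.sub (by fun_prop)).mul (e2 _ v (by fun_prop)))).add
        (Continuous.mul (by fun_prop) (e2 _ v (by fun_prop)))
    · fun_prop
  · exact isClosed_eq (by fun_prop) (by fun_prop)
  · refine isClosed_eq ?_ ?_
    · exact Continuous.mul (by fun_prop) (Continuous.eval (by fun_prop) (by fun_prop))
    · fun_prop

theorem BorderedKernel.smul {d : (E [⋀^Fin 2]→L[ℝ] ℝ) × (E [⋀^Fin 2]→L[ℝ] ℝ) ×
    (E [⋀^Fin 1]→L[ℝ] ℝ) × (E →L[ℝ] ℝ)} {b e : ℝ} {w : E × ℝ × ℝ}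
    (h : BorderedKernel d b e w) (c : ℝ) : BorderedKernel d b e (c • w) := by
  obtain ⟨h1, h2, h3⟩ := h
  have e2 : ∀ (B : E [⋀^Fin 2]→L[ℝ] ℝ) v, B ![c • w.1, v] = c * B ![w.1, v] := fun B v =>
    (bilin B).map_smul₂ c w.1 v
  have e1 : d.2.2.1 ![c • w.1] = c * d.2.2.1 ![w.1] := (linForm d.2.2.1).map_smul c w.1
  refine ⟨fun v => ?_, ?_, ?_⟩
  · simp only [Prod.smul_fst, Prod.smul_snd, e2, smul_eq_mul]
    linear_combination c * h1 v
  · simp only [Prod.smul_fst, Prod.smul_snd, map_smul, smul_eq_mul]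
    linear_combination c * h2
  · simp only [Prod.smul_fst, Prod.smul_snd, e1, smul_eq_mul]
    linear_combination c * h3

variable {Ω A : E [⋀^Fin 2]→L[ℝ] ℝ} {a : E [⋀^Fin 1]→L[ℝ] ℝ} {τ : E →L[ℝ] ℝ}

/-- For `s = 0` there is no kernel, whatever `g ∈ [0, ∞]`. This uses the sign of `a R`, where `R` is
dual to `τ`. -/
theorem not_borderedKernel_zero (hΩ : NondegenerateOn Ω Set.univ) {R : E}
    (hR : ∀ v, Ω ![R, v] = τ v) (haR : 0 < a ![R]) {e : ℝ} (he : e ∈ Set.Icc (0 : ℝ) 1)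
    {w : E × ℝ × ℝ} (hw : BorderedKernel (Ω, A, a, τ) 0 e w) : w = 0 := by
  obtain ⟨u, l, k⟩ := w
  obtain ⟨h1, h2, h3⟩ := hw
  simp only [sub_zero, one_mul, zero_mul, add_zero] at h1 h2 h3
  have hτR : τ R = 0 := by rw [← hR, alternating_self]
  have h4 : -τ u = l * a ![R] := by
    rw [← hR, ← alternating_swap, h1, hτR, mul_zero, sub_zero]
  have hl : l = 0 := by
    by_contra hl
    have h5 : (1 - e) * (l * a ![R]) = -(e * l) := by rw [← h4, ← h2]; ring
    have h6 : (1 - e) * a ![R] + e = 0 := by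
      have : l * ((1 - e) * a ![R] + e) = 0 := by linear_combination h5
      exact (mul_eq_zero.1 this).resolve_left hl
    have h7 := mul_nonneg (sub_nonneg.2 he.2) haR.le
    have h8 : e = 0 := by linarith [he.1]
    rw [h8] at h6
    linarith
  have huR : u = -(k • R) := by
    have : u + k • R = 0 := hΩ _ trivial fun v _ => by
      have : bilin Ω (u + k • R) v = bilin Ω u v + k * bilin Ω R v := by
        rw [map_add, map_smul]; rfl
      rw [bilin_apply, bilin_apply, bilin_apply, h1, hR, hl] at this
      linarith
    exact eq_neg_of_add_eq_zero_left this
  have hau : a ![u] = -(k * a ![R]) := by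
    rw [huR]
    have : linForm a (-(k • R)) = -(k * linForm a R) := by rw [map_neg, map_smul]; rfl
    exact this
  have hk : k = 0 := by
    by_contra hk
    have h6 : (1 - e) * a ![R] + e = 0 := by
      have : k * ((1 - e) * a ![R] + e) = 0 := by rw [hau] at h3; linear_combination -h3
      exact (mul_eq_zero.1 this).resolve_left hk
    have h7 := mul_nonneg (sub_nonneg.2 he.2) haR.le
    have h8 : e = 0 := by linarith [he.1]
    rw [h8] at h6
    linarith
  rw [hk, zero_smul, neg_zero] at huR
  rw [huR, hl, hk]
  rfl

/-- For `g = ∞` there is no kernel, whatever `s ∈ [0, ∞]`. -/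
theorem not_borderedKernel_top {R ν : E} (hτR : τ R = 0) (haR : 0 < a ![R]) (hν : τ ν ≠ 0)
    (hξ : ∀ s : ℝ, 0 ≤ s → NondegenerateOn (Ω + s • A) {u | a ![u] = 0 ∧ τ u = 0})
    (hA : NondegenerateOn A {u | a ![u] = 0 ∧ τ u = 0}) {b : ℝ} (hb : b ∈ Set.Icc (0 : ℝ) 1)
    {w : E × ℝ × ℝ} (hw : BorderedKernel (Ω, A, a, τ) b 0 w) : w = 0 := by
  obtain ⟨u, l, k⟩ := w
  obtain ⟨h1, h2, h3⟩ := hw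
  simp only [sub_zero, one_mul, zero_mul] at h1 h2 h3
  have hu : u = 0 := by
    rcases hb.2.eq_or_lt with rfl | hb1
    · refine hA u ⟨h3, h2⟩ fun v hv => ?_
      have := h1 v
      rw [hv.1, hv.2] at this
      linarith
    · have hb1' : 0 < 1 - b := by linarith
      refine hξ (b / (1 - b)) (div_nonneg hb.1 hb1'.le) u ⟨h3, h2⟩ fun v hv => ?_
      have := h1 v
      rw [hv.1, hv.2] at this
      simp only [ContinuousAlternatingMap.add_apply, ContinuousAlternatingMap.smul_apply,
        smul_eq_mul]
      field_simp
      linarith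
  have h0 : ∀ (B : E [⋀^Fin 2]→L[ℝ] ℝ) v, B ![(0 : E), v] = 0 := fun B v => (bilin B).map_zero₂ v
  have h4 : ∀ v, l * a ![v] = k * τ v := fun v => by
    have := h1 v
    rw [hu, h0, h0] at this
    linarith
  have hl : l = 0 := by
    have := h4 R
    rw [hτR, mul_zero] at this
    exact (mul_eq_zero.1 this).resolve_right haR.ne'
  have hk : k = 0 := by
    have := h4 ν
    rw [hl, zero_mul] at this
    exact (mul_eq_zero.1 this.symm).resolve_right hν
  rw [hu, hl, hk]
  rfl

/-- The pointwise heart of the construction: at a boundary point, and for all data near the data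
there, `Ω + s A + g a ∧ τ` is nondegenerate as soon as `g` dominates a large multiple of `s`. -/
theorem eventually_twistNondegenerate [FiniteDimensional ℝ E] (hΩ : NondegenerateOn Ω Set.univ)
    {R ν : E} (hR : ∀ v, Ω ![R, v] = τ v) (haR : 0 < a ![R]) (hν : τ ν ≠ 0)
    (hξ : ∀ s : ℝ, 0 ≤ s → NondegenerateOn (Ω + s • A) {u | a ![u] = 0 ∧ τ u = 0})
    (hA : NondegenerateOn A {u | a ![u] = 0 ∧ τ u = 0}) :
    ∃ δ > 0, ∀ᶠ d in 𝓝 (Ω, A, a, τ), ∀ s g : ℝ, 0 ≤ s → 0 < g → s ≤ δ * g →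
      TwistNondegenerate d.1 d.2.1 d.2.2.1 d.2.2.2 s g := by
  have hτR : τ R = 0 := by rw [← hR, alternating_self]
  have hK : IsCompact (Set.Icc (0 : ℝ) 1 ×ˢ Metric.sphere (0 : E × ℝ × ℝ) 1) :=
    isCompact_Icc.prod (isCompact_sphere _ _)
  have hsph : ∀ w : E × ℝ × ℝ, w ∈ Metric.sphere (0 : E × ℝ × ℝ) 1 → w ≠ 0 := by
    rintro w hw rfl
    simp at hw
  have T1 : ∀ᶠ x in 𝓝 ((Ω, A, a, τ), (0 : ℝ)), ∀ y ∈ Set.Icc (0 : ℝ) 1 ×ˢ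
      Metric.sphere (0 : E × ℝ × ℝ) 1, ¬ BorderedKernel x.1 x.2 y.1 y.2 := by
    refine hK.eventually_forall_of_forall_eventually fun y hy => ?_
    have hcont : ContinuousAt (fun z : (((E [⋀^Fin 2]→L[ℝ] ℝ) × (E [⋀^Fin 2]→L[ℝ] ℝ) ×
        (E [⋀^Fin 1]→L[ℝ] ℝ) × (E →L[ℝ] ℝ)) × ℝ) × ℝ × E × ℝ × ℝ =>
        (z.1.1, z.1.2, z.2.1, z.2.2)) (((Ω, A, a, τ), 0), y) := by fun_prop
    exact hcont.eventually (isClosed_borderedKernel.isOpen_compl.mem_nhds fun h =>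
      hsph _ hy.2 (not_borderedKernel_zero hΩ hR haR hy.1 h))
  have T2 : ∀ᶠ x in 𝓝 ((Ω, A, a, τ), (0 : ℝ)), ∀ y ∈ Set.Icc (0 : ℝ) 1 ×ˢ
      Metric.sphere (0 : E × ℝ × ℝ) 1, ¬ BorderedKernel x.1 y.1 x.2 y.2 := by
    refine hK.eventually_forall_of_forall_eventually fun y hy => ?_
    have hcont : ContinuousAt (fun z : (((E [⋀^Fin 2]→L[ℝ] ℝ) × (E [⋀^Fin 2]→L[ℝ] ℝ) ×
        (E [⋀^Fin 1]→L[ℝ] ℝ) × (E →L[ℝ] ℝ)) × ℝ) × ℝ × E × ℝ × ℝ =>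
        (z.1.1, z.2.1, z.1.2, z.2.2)) (((Ω, A, a, τ), 0), y) := by fun_prop
    exact hcont.eventually (isClosed_borderedKernel.isOpen_compl.mem_nhds fun h =>
      hsph _ hy.2 (not_borderedKernel_top hτR haR hν hξ hA hy.1 h))
  have T := T1.and T2
  rw [nhds_prod_eq, Filter.eventually_prod_iff] at T
  obtain ⟨p, hp, q, hq, hpq⟩ := T
  obtain ⟨ε, hε, hεq⟩ := Metric.eventually_nhds_iff.1 hq
  refine ⟨ε ^ 2 / 2, by positivity, ?_⟩
  filter_upwards [hp] with d hd s g hs hg hsg u hu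
  set b := s / (1 + s) with hb
  set e := (1 + s) / (1 + s + g) with he
  have hs1 : 0 < 1 + s := by linarith
  have hsg1 : 0 < 1 + s + g := by linarith
  have hb01 : b ∈ Set.Icc (0 : ℝ) 1 := ⟨by positivity, by rw [hb, div_le_one hs1]; linarith⟩
  have he01 : e ∈ Set.Icc (0 : ℝ) 1 := ⟨by positivity, by rw [he, div_le_one hsg1]; linarith⟩
  have hker : BorderedKernel d b e
      (u, g / (1 + s) * d.2.2.2 u, g / (1 + s) * d.2.2.1 ![u]) := by
    refine ⟨fun v => ?_, ?_, ?_⟩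
    · have := hu v
      simp only [hb]
      field_simp
      linear_combination this
    · simp only [he]
      field_simp
      ring
    · simp only [he]
      field_simp
      ring
  set w : E × ℝ × ℝ := (u, g / (1 + s) * d.2.2.2 u, g / (1 + s) * d.2.2.1 ![u]) with hw
  by_contra hu0
  have hw0 : w ≠ 0 := fun h => hu0 (congrArg Prod.fst h)
  have hwn : ‖w‖⁻¹ • w ∈ Metric.sphere (0 : E × ℝ × ℝ) 1 := by
    simp [norm_smul, norm_ne_zero_iff.2 hw0]
  -- One of the two parameters `b`, `e` is small, as `b * e ≤ s / g`.
  have hbe : b < ε ∨ e < ε := by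
    by_contra! h
    have h1 : ε ^ 2 ≤ b * e := by nlinarith [h.1, h.2]
    have h2 : b * e < ε ^ 2 := by
      have : b * e = s / (1 + s + g) := by rw [hb, he]; field_simp
      rw [this, div_lt_iff₀ hsg1]
      nlinarith [pow_pos hε 2]
    linarith
  rcases hbe with h | h
  · refine (hpq hd (hεq (y := b) ?_)).1 (e, ‖w‖⁻¹ • w) ⟨he01, hwn⟩ (hker.smul _)
    rw [Real.dist_eq, sub_zero, abs_of_nonneg hb01.1]; exact h
  · refine (hpq hd (hεq (y := e) ?_)).2 (b, ‖w‖⁻¹ • w) ⟨hb01, hwn⟩ (hker.smul _)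
    rw [Real.dist_eq, sub_zero, abs_of_nonneg he01.1]; exact h

end Bordered

/-! ### Division by a boundary defining function -/

section Hadamard

variable {E : Type} [NormedAddCommGroup E] [NormedSpace ℝ E]

theorem intervalIntegrable_section {G : Type*} [NormedAddCommGroup G] {S : Set E} {k : E × ℝ → G}
    (hk : ContinuousOn k (S ×ˢ Set.Icc (0 : ℝ) 1)) {q : E} (hq : q ∈ S) :
    IntervalIntegrable (fun t => k (q, t)) MeasureTheory.volume 0 1 := by
  refine ContinuousOn.intervalIntegrable ?_
  rw [Set.uIcc_of_le zero_le_one]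
  exact hk.comp (by fun_prop) fun t ht => ⟨hq, ht⟩

/-- Differentiation under the integral sign, up to the boundary of a convex set. -/
theorem hasFDerivWithinAt_parametric_integral {F : Type*} [NormedAddCommGroup F] [NormedSpace ℝ F]
    [CompleteSpace F] {S : Set E} (hS : Convex ℝ S) {h : E × ℝ → F} {h' : E × ℝ → E →L[ℝ] F}
    (hc : ContinuousOn h (S ×ˢ Set.Icc (0 : ℝ) 1)) (hc' : ContinuousOn h' (S ×ˢ Set.Icc (0 : ℝ) 1))
    (hd : ∀ q ∈ S, ∀ t ∈ Set.Icc (0 : ℝ) 1, HasFDerivWithinAt (fun q => h (q, t)) (h' (q, t)) S q)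
    {q : E} (hq : q ∈ S) :
    HasFDerivWithinAt (fun q => ∫ t in (0 : ℝ)..1, h (q, t)) (∫ t in (0 : ℝ)..1, h' (q, t)) S q := by
  refine hasFDerivWithinAt_iff_isLittleO.2 (Asymptotics.isLittleO_iff.2 fun ε hε => ?_)
  obtain ⟨v, hv, hvε⟩ := isCompact_Icc.mem_uniformity_of_prod (s := S) (k := Set.Icc (0 : ℝ) 1)
    (f := fun q t => h' (q, t)) hc' hq (Metric.dist_mem_uniformity hε)
  obtain ⟨r, hr, hrv⟩ := Metric.mem_nhdsWithin_iff.1 hv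
  have hmem : Metric.ball q r ∩ S ∈ 𝓝[S] q :=
    Filter.inter_mem (mem_nhdsWithin_of_mem_nhds (Metric.ball_mem_nhds q hr)) self_mem_nhdsWithin
  have hconv : Convex ℝ (Metric.ball q r ∩ S) := (convex_ball q r).inter hS
  filter_upwards [hmem] with q' hq'
  have hqq : q ∈ Metric.ball q r ∩ S := ⟨Metric.mem_ball_self hr, hq⟩
  have hpt : ∀ t ∈ Set.Icc (0 : ℝ) 1, ‖h (q', t) - h (q, t) - h' (q, t) (q' - q)‖ ≤
      ε * ‖q' - q‖ := fun t ht =>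
    hconv.norm_image_sub_le_of_norm_hasFDerivWithin_le' (f' := fun x => h' (x, t))
      (fun x hx => (hd x hx.2 t ht).mono Set.inter_subset_right)
      (fun x hx => by
        have := hvε x (hrv hx) t ht
        rw [← dist_eq_norm]
        exact this.le) hqq hq'
  have hint : (∫ t in (0 : ℝ)..1, h (q', t)) - (∫ t in (0 : ℝ)..1, h (q, t)) -
      (∫ t in (0 : ℝ)..1, h' (q, t)) (q' - q) =
      ∫ t in (0 : ℝ)..1, (h (q', t) - h (q, t) - h' (q, t) (q' - q)) := by
    rw [ContinuousLinearMap.intervalIntegral_apply (intervalIntegrable_section hc' hq),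
      intervalIntegral.integral_sub ((intervalIntegrable_section hc hq'.2).sub (intervalIntegrable_section hc hq)),
      intervalIntegral.integral_sub (intervalIntegrable_section hc hq'.2) (intervalIntegrable_section hc hq)]
    refine intervalIntegrable_section (k := fun p => h' p (q' - q)) ?_ hq
    exact hc'.clm_apply continuousOn_const
  rw [hint]
  refine (intervalIntegral.norm_integral_le_of_norm_le_const (C := ε * ‖q' - q‖)
    fun t ht => ?_).trans_eq ?_
  · rw [Set.uIoc_of_le zero_le_one] at ht
    exact hpt t ⟨ht.1.le, ht.2⟩
  · simp

theorem contDiffOn_parametric_integral_nat (n : ℕ) :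
    ∀ {F : Type} [NormedAddCommGroup F] [NormedSpace ℝ F] [CompleteSpace F] {S : Set E}
      {h : E × ℝ → F}, Convex ℝ S → UniqueDiffOn ℝ S →
      ContDiffOn ℝ ∞ h (S ×ˢ Set.Icc (0 : ℝ) 1) →
      ContDiffOn ℝ n (fun q => ∫ t in (0 : ℝ)..1, h (q, t)) S := by
  have key : ∀ {F : Type} [NormedAddCommGroup F] [NormedSpace ℝ F] [CompleteSpace F] {S : Set E}
      {h : E × ℝ → F}, Convex ℝ S → UniqueDiffOn ℝ S →
      ContDiffOn ℝ ∞ h (S ×ˢ Set.Icc (0 : ℝ) 1) →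
      ∃ h' : E × ℝ → E →L[ℝ] F, ContDiffOn ℝ ∞ h' (S ×ˢ Set.Icc (0 : ℝ) 1) ∧
        ∀ q ∈ S, HasFDerivWithinAt (fun q => ∫ t in (0 : ℝ)..1, h (q, t))
          (∫ t in (0 : ℝ)..1, h' (q, t)) S q := by
    intro F _ _ _ S h hS hU hh
    have hU' : UniqueDiffOn ℝ (S ×ˢ Set.Icc (0 : ℝ) 1) := hU.prod (uniqueDiffOn_Icc zero_lt_one)
    have hh' : ContDiffOn ℝ ∞ (fun p => (fderivWithin ℝ h (S ×ˢ Set.Icc (0 : ℝ) 1) p).comp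
        (ContinuousLinearMap.inl ℝ E ℝ)) (S ×ˢ Set.Icc (0 : ℝ) 1) :=
      (hh.fderivWithin hU' le_rfl).clm_comp contDiffOn_const
    refine ⟨_, hh', fun q hq => hasFDerivWithinAt_parametric_integral hS hh.continuousOn
      hh'.continuousOn (fun q hq t ht => ?_) hq⟩
    have h1 : HasFDerivWithinAt h _ (S ×ˢ Set.Icc (0 : ℝ) 1) (q, t) :=
      (hh.differentiableOn (by simp) (q, t) ⟨hq, ht⟩).hasFDerivWithinAt
    have h2 : HasFDerivWithinAt (fun q : E => (q, t)) (ContinuousLinearMap.inl ℝ E ℝ) S q :=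
      (hasFDerivAt_prodMk_left q t).hasFDerivWithinAt
    have h3 : Set.MapsTo (fun q : E => (q, t)) S (S ×ˢ Set.Icc (0 : ℝ) 1) := fun x hx => ⟨hx, ht⟩
    exact h1.comp q h2 h3
  induction n with
  | zero =>
    intro F _ _ _ S h hS hU hh
    obtain ⟨h', -, hd⟩ := key hS hU hh
    have : ContDiffOn ℝ 0 (fun q => ∫ t in (0 : ℝ)..1, h (q, t)) S :=
      contDiffOn_zero.2 fun q hq => (hd q hq).continuousWithinAt
    exact_mod_cast this
  | succ n ih =>
    intro F _ _ _ S h hS hU hh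
    obtain ⟨h', hh', hd⟩ := key hS hU hh
    have : ContDiffOn ℝ (n + 1) (fun q => ∫ t in (0 : ℝ)..1, h (q, t)) S :=
      (contDiffOn_succ_iff_hasFDerivWithinAt_of_uniqueDiffOn hU).2
        ⟨by simp, _, ih hS hU hh', fun q hq => hd q hq⟩
    exact_mod_cast this

theorem contDiffOn_parametric_integral {F : Type} [NormedAddCommGroup F] [NormedSpace ℝ F]
    [CompleteSpace F] {S : Set E} {h : E × ℝ → F} (hS : Convex ℝ S) (hU : UniqueDiffOn ℝ S)
    (hh : ContDiffOn ℝ ∞ h (S ×ˢ Set.Icc (0 : ℝ) 1)) :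
    ContDiffOn ℝ ∞ (fun q => ∫ t in (0 : ℝ)..1, h (q, t)) S :=
  contDiffOn_infty.2 fun n => contDiffOn_parametric_integral_nat n hS hU hh

variable [FiniteDimensional ℝ E]

/-- **Hadamard's lemma** on a half-space: a smooth function on a relatively open subset of the
half-space `0 ≤ l` that vanishes on the hyperplane `l = 0` is `l` times a smooth function. -/
theorem exists_contDiffOn_eq_mul {F : E → ℝ} {O : Set E} (hO : IsOpen O) (l : E →L[ℝ] ℝ) {e : E}
    (he : l e = 1) (hF : ContDiffOn ℝ ∞ F (O ∩ {q | 0 ≤ l q}))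
    (h0 : ∀ q ∈ O, l q = 0 → F q = 0) :
    ∃ g : E → ℝ, ContDiffOn ℝ ∞ g (O ∩ {q | 0 ≤ l q}) ∧
      ∀ q ∈ O ∩ {q | 0 ≤ l q}, F q = l q * g q := by
  set T := O ∩ {q | 0 ≤ l q} with hT
  have hHconv : Convex ℝ {q | 0 ≤ l q} := convex_halfSpace_ge l.isLinear 0
  have hHint : ∀ {q} {U : Set E}, IsOpen U → q ∈ U → 0 ≤ l q →
      (interior (U ∩ {q | 0 ≤ l q})).Nonempty := by
    intro q U hU hq hlq
    have hcont : Continuous fun t : ℝ => q + t • e := by fun_prop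
    have hev : ∀ᶠ t in 𝓝[>] (0 : ℝ), q + t • e ∈ U :=
      nhdsWithin_le_nhds (hcont.continuousAt.eventually (hU.mem_nhds (by simpa using hq)))
    obtain ⟨t, htU, ht⟩ := (hev.and self_mem_nhdsWithin).exists
    have hsub : U ∩ {q | 0 < l q} ⊆ U ∩ {q | 0 ≤ l q} :=
      Set.inter_subset_inter_right _ fun q (hq : 0 < l q) => (le_of_lt hq : 0 ≤ l q)
    refine ⟨q + t • e, interior_maximal hsub
      (hU.inter (isOpen_lt continuous_const l.continuous)) ⟨htU, ?_⟩⟩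
    change 0 < l (q + t • e)
    rw [map_add, map_smul, he, smul_eq_mul, mul_one]
    exact add_pos_of_nonneg_of_pos hlq ht
  have hHU : UniqueDiffOn ℝ {q | 0 ≤ l q} := by
    refine uniqueDiffOn_convex hHconv ?_
    simpa using hHint isOpen_univ (Set.mem_univ (0 : E)) (by simp)
  have hTU : UniqueDiffOn ℝ T := by
    rw [hT, Set.inter_comm]; exact hHU.inter hO
  let g : E → ℝ := fun q => if l q = 0 then fderivWithin ℝ F T q e else F q / l q
  refine ⟨g, fun q hq => ?_, fun q hq => ?_⟩
  swap
  · by_cases hq0 : l q = 0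
    · rw [h0 q hq.1 hq0, hq0, zero_mul]
    · simp only [g, if_neg hq0]; field_simp
  rcases (show 0 ≤ l q from hq.2).eq_or_lt with hq0 | hq0
  swap
  · -- off the hyperplane, the quotient is smooth
    have h1 : ContDiffWithinAt ℝ ∞ (fun q => F q / l q) T q :=
      (hF q hq).div l.contDiff.contDiffWithinAt hq0.ne'
    refine h1.congr_of_eventuallyEq ?_ (by simp [g, hq0.ne'])
    have : ∀ᶠ q' in 𝓝[T] q, 0 < l q' :=
      nhdsWithin_le_nhds (l.continuous.continuousAt.eventually (lt_mem_nhds hq0))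
    filter_upwards [this] with q' hq'
    simp [g, hq'.ne']
  -- near the hyperplane, the quotient is the mean of `∂F` over a segment
  obtain ⟨r, hr, hrO⟩ := Metric.isOpen_iff.1 hO q hq.1
  set C := 1 + ‖l‖ * ‖e‖ with hC
  have hC1 : 1 ≤ C := by rw [hC]; nlinarith [norm_nonneg l, norm_nonneg e]
  set r' := r / C with hr'
  have hr'0 : 0 < r' := by positivity
  set S := Metric.ball q r' ∩ {q | 0 ≤ l q} with hS
  have hSconv : Convex ℝ S := (convex_ball q r').inter hHconv
  have hSU : UniqueDiffOn ℝ S := by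
    rw [hS, Set.inter_comm]; exact hHU.inter Metric.isOpen_ball
  set γ : E × ℝ → E := fun p => p.1 - ((1 - p.2) * l p.1) • e with hγ
  have hγC : ContDiff ℝ ∞ γ := by fun_prop
  have hlγ : ∀ p, l (γ p) = p.2 * l p.1 := fun p => by
    simp only [hγ, map_sub, map_smul, he, smul_eq_mul]; ring
  have hγT : Set.MapsTo γ (S ×ˢ Set.Icc (0 : ℝ) 1) T := by
    rintro ⟨x, t⟩ ⟨hx, ht⟩
    refine ⟨hrO ?_, ?_⟩
    · -- as `l q = 0`, the segment from `x` to the hyperplane has length at most `‖l‖ ‖e‖ ‖x - q‖`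
      have h1 : |l x| ≤ ‖l‖ * ‖x - q‖ := by
        have := l.le_opNorm (x - q)
        rwa [map_sub, ← hq0, sub_zero, Real.norm_eq_abs] at this
      have hxq : ‖x - q‖ < r' := by rw [← dist_eq_norm]; exact hx.1
      have h2 : γ (x, t) - q = (x - q) - ((1 - t) * l x) • e := by simp only [hγ]; abel
      have h3 : |1 - t| ≤ 1 := abs_le.2 ⟨by linarith [ht.2], by linarith [ht.1]⟩
      rw [Metric.mem_ball, dist_eq_norm, h2]
      calc ‖(x - q) - ((1 - t) * l x) • e‖ ≤ ‖x - q‖ + |1 - t| * |l x| * ‖e‖ := by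
            refine (norm_sub_le _ _).trans_eq ?_
            rw [norm_smul, Real.norm_eq_abs, abs_mul]
        _ ≤ ‖x - q‖ + 1 * (‖l‖ * ‖x - q‖) * ‖e‖ := by gcongr
        _ = C * ‖x - q‖ := by rw [hC]; ring
        _ < C * r' := by gcongr
        _ = r := by rw [hr']; field_simp
    · change 0 ≤ l (γ (x, t))
      rw [hlγ]
      exact mul_nonneg ht.1 hx.2
  have hDF : ContDiffOn ℝ ∞ (fun q => fderivWithin ℝ F T q e) T :=
    (hF.fderivWithin hTU le_rfl).clm_apply contDiffOn_const
  have hG := contDiffOn_parametric_integral hSconv hSU (hDF.comp hγC.contDiffOn hγT)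
  have hgG : ∀ x ∈ S, g x = ∫ t in (0 : ℝ)..1, fderivWithin ℝ F T (γ (x, t)) e := by
    intro x hx
    by_cases hx0 : l x = 0
    · have : ∀ t, γ (x, t) = x := fun t => by simp [hγ, hx0]
      simp [g, hx0, this]
    · simp only [g, if_neg hx0]
      have hγd : ∀ t : ℝ, HasDerivAt (fun t => γ (x, t)) (l x • e) t := fun t => by
        have h1 : HasDerivAt (fun t : ℝ => (1 - t) * l x) (-1 * l x) t :=
          ((hasDerivAt_id t).const_sub 1).mul_const _
        simpa using (h1.smul_const e).const_sub x
      have hd : ∀ t ∈ Set.Icc (0 : ℝ) 1, HasDerivWithinAt (fun t => F (γ (x, t)))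
          (l x * fderivWithin ℝ F T (γ (x, t)) e) (Set.Icc 0 1) t := fun t ht => by
        have h1 := (hF.differentiableOn (by simp) _ (hγT (x := (x, t)) ⟨hx, ht⟩)).hasFDerivWithinAt
        have hm : Set.MapsTo (fun t => γ (x, t)) (Set.Icc (0 : ℝ) 1) T := fun t ht =>
          hγT (x := (x, t)) ⟨hx, ht⟩
        have h2 := h1.comp_hasDerivWithinAt t (hγd t).hasDerivWithinAt hm
        simpa using! h2
      have hcont : ContinuousOn (fun t : ℝ => fderivWithin ℝ F T (γ (x, t)) e) (Set.Icc 0 1) :=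
        hDF.continuousOn.comp (by fun_prop) fun t ht => hγT (x := (x, t)) ⟨hx, ht⟩
      have hftc := intervalIntegral.integral_eq_sub_of_hasDerivAt_of_le zero_le_one
        (fun t ht => (hd t ht).continuousWithinAt)
        (fun t ht => (hd t ⟨ht.1.le, ht.2.le⟩).hasDerivAt (Icc_mem_nhds ht.1 ht.2))
        (by
          refine ContinuousOn.intervalIntegrable ?_
          rw [Set.uIcc_of_le zero_le_one]
          exact continuousOn_const.mul hcont)
      have hγ0 : F (γ (x, 0)) = 0 := by
        refine h0 _ (hγT (x := (x, 0)) ⟨hx, by simp⟩).1 ?_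
        rw [hlγ, zero_mul]
      have hγ1 : γ (x, 1) = x := by simp [hγ]
      rw [hγ0, hγ1, sub_zero, intervalIntegral.integral_const_mul] at hftc
      rw [← hftc]
      field_simp
  have hqS : q ∈ S := ⟨Metric.mem_ball_self hr'0, hq.2⟩
  have h1 : ContDiffWithinAt ℝ ∞ g S q := (hG q hqS).congr (fun x hx => hgG x hx) (hgG q hqS)
  refine h1.mono_of_mem_nhdsWithin ?_
  filter_upwards [nhdsWithin_le_nhds (Metric.ball_mem_nhds q hr'0), self_mem_nhdsWithin]
    with x hx hxT
  exact ⟨hx, hxT.2⟩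

end Hadamard

/-! ### Smooth families of alternating maps -/

section AlternatingSmooth

variable {X : Type*} [NormedAddCommGroup X] [NormedSpace ℝ X]
  {E : Type*} [NormedAddCommGroup E] [NormedSpace ℝ E] [FiniteDimensional ℝ E]
  {F : Type*} [NormedAddCommGroup F] [NormedSpace ℝ F] [FiniteDimensional ℝ F]
  {k : ℕ} {n : ℕ∞ω} {s : Set X} {x : X}

/-- In finite dimensions, a family of alternating maps is smooth if its values on fixed vectors
are. -/
theorem contDiffWithinAt_of_apply {f : X → E [⋀^Fin k]→L[ℝ] ℝ}
    (h : ∀ v, ContDiffWithinAt ℝ n (fun x => f x v) s x) : ContDiffWithinAt ℝ n f s x := by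
  let b := Module.finBasis ℝ E
  -- an alternating map is determined, through a linear left inverse, by its values on basis vectors
  let J : (E [⋀^Fin k]→L[ℝ] ℝ) →ₗ[ℝ] ((Fin k → Fin (Module.finrank ℝ E)) → ℝ) :=
    { toFun := fun f i => f fun j => b (i j)
      map_add' := fun f g => rfl
      map_smul' := fun c f => rfl }
  have hJ : LinearMap.ker J = ⊥ := by
    rw [LinearMap.ker_eq_bot']
    intro f hf
    have : f.toContinuousMultilinearMap.toMultilinearMap = 0 :=
      Module.Basis.ext_multilinear (fun _ => b) fun i => congrFun hf i
    ext v
    exact congrArg (fun f : MultilinearMap ℝ (fun _ : Fin k => E) ℝ => f v) this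
  obtain ⟨L, hL⟩ := J.exists_leftInverse_of_injective hJ
  have hf : f = fun x => L.toContinuousLinearMap (J (f x)) := by
    funext x
    exact (congrArg (fun l => l (f x)) hL).symm
  rw [hf]
  refine L.toContinuousLinearMap.contDiff.contDiffAt.comp_contDiffWithinAt x ?_
  exact contDiffWithinAt_pi.2 fun i => h _

theorem contDiffWithinAt_apply {f : X → F [⋀^Fin k]→L[ℝ] ℝ} {w : X → Fin k → F}
    (hf : ContDiffWithinAt ℝ n f s x) (hw : ∀ i, ContDiffWithinAt ℝ n (fun x => w x i) s x) :
    ContDiffWithinAt ℝ n (fun x => f x (w x)) s x := by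
  let b := Module.finBasis ℝ F
  have hexp : (fun x => f x (w x)) = fun x =>
      ∑ r : Fin k → Fin (Module.finrank ℝ F), (∏ i, b.equivFunL (w x i) (r i)) *
        f x fun i => b (r i) := by
    funext y
    have h1 : w y = fun i => ∑ j, b.equivFunL (w y i) j • b j := by
      funext i
      exact (b.sum_equivFun (w y i)).symm
    have h2 := (f y).toContinuousMultilinearMap.toMultilinearMap.map_sum
      (fun i j => b.equivFunL (w y i) j • b j)
    rw [← h1] at h2
    refine h2.trans (Finset.sum_congr rfl fun r _ => ?_)
    exact (f y).toContinuousMultilinearMap.toMultilinearMap.map_smul_univ _ _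
  rw [hexp]
  refine ContDiffWithinAt.sum fun r _ => ContDiffWithinAt.mul ?_ ?_
  · refine contDiffWithinAt_prod fun i _ => ?_
    have : ContDiff ℝ n fun v : F => b.equivFunL v (r i) := by fun_prop
    exact this.contDiffAt.comp_contDiffWithinAt x (hw i)
  · exact (ContinuousAlternatingMap.apply ℝ F ℝ (fun i => b (r i))).contDiff.contDiffAt
      |>.comp_contDiffWithinAt x hf

theorem contDiffWithinAt_compContinuousLinearMap {f : X → F [⋀^Fin k]→L[ℝ] ℝ} {g : X → E →L[ℝ] F}
    (hf : ContDiffWithinAt ℝ n f s x) (hg : ContDiffWithinAt ℝ n g s x) :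
    ContDiffWithinAt ℝ n (fun x => (f x).compContinuousLinearMap (g x)) s x :=
  contDiffWithinAt_of_apply fun v => contDiffWithinAt_apply (w := fun x i => g x (v i)) hf fun _ =>
    hg.clm_apply contDiffWithinAt_const

end AlternatingSmooth

/-! ### Pullback and exterior derivative of forms on manifolds -/

section Forms

variable {E : Type*} [NormedAddCommGroup E] [NormedSpace ℝ E]
  {H : Type*} [TopologicalSpace H] {I : ModelWithCorners ℝ E H}
  {M : Type*} [TopologicalSpace M] [ChartedSpace H M]
  {E' : Type*} [NormedAddCommGroup E'] [NormedSpace ℝ E']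
  {H' : Type*} [TopologicalSpace H'] {J : ModelWithCorners ℝ E' H'}
  {N : Type*} [TopologicalSpace N] [ChartedSpace H' N] {k : ℕ}

/-- The form `Ω` is smooth at `p`, in each chart around `p`. -/
def DiffForm.SmoothAt (Ω : DiffForm I M k) (p : M) : Prop :=
  ∀ p₀, p ∈ (extChartAt I p₀).source →
    ContDiffWithinAt ℝ ∞ (Ω.inChart p₀) (Set.range I) (extChartAt I p₀ p)

theorem DiffForm.IsSmooth.smoothAt {Ω : DiffForm I M k} (h : Ω.IsSmooth) (p : M) :
    Ω.SmoothAt p := fun p₀ hp =>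
  (h p₀ _ ((extChartAt I p₀).map_source hp)).mono_of_mem_nhdsWithin
    (extChartAt_target_mem_nhdsWithin' hp)

theorem DiffForm.SmoothAt.inChart {Ω : DiffForm I M k} {p₀ : M} {x : E}
    (hx : x ∈ (extChartAt I p₀).target) (h : Ω.SmoothAt ((extChartAt I p₀).symm x)) :
    ContDiffWithinAt ℝ ∞ (Ω.inChart p₀) (Set.range I) x := by
  have := h p₀ ((extChartAt I p₀).map_target hx)
  rwa [(extChartAt I p₀).right_inv hx] at this

/-- The pullback of a form under a map. -/
def DiffForm.pullback (f : M → N) (Ω : DiffForm J N k) : DiffForm I M k :=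
  fun p => (Ω (f p)).compContinuousLinearMap (mfderiv I J f p)

/-- The value of a form at a point, as an alternating map on the model space to which the tangent
space is definitionally equal. -/
def DiffForm.val (Ω : DiffForm I M k) (p : M) : E [⋀^Fin k]→L[ℝ] ℝ := Ω p

/-- The differential of the inverse of the chart at `p₀`, on the model space. -/
def chartFrame (I : ModelWithCorners ℝ E H) (p₀ : M) (x : E) : E →L[ℝ] E :=
  mfderivWithin 𝓘(ℝ, E) I (extChartAt I p₀).symm (Set.range I) x

variable (I J) in
/-- The differential of a map between manifolds, on the model spaces to which the tangent spaces are
definitionally equal. -/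
def modelDeriv (f : M → N) (p : M) : E →L[ℝ] E' := mfderiv I J f p

theorem DiffForm.inChart_eq (Ω : DiffForm I M k) (p₀ : M) (x : E) :
    Ω.inChart p₀ x = (Ω.val ((extChartAt I p₀).symm x)).compContinuousLinearMap
      (chartFrame I p₀ x) := rfl

section

variable [IsManifold I ∞ M] [IsManifold J ∞ N]

theorem fderivWithin_writtenInCharts (f : M → N) {p₀ : M} {n₀ : N} {x : E}
    (hx : x ∈ (extChartAt I p₀).target)
    (hf : MDifferentiableAt I J f ((extChartAt I p₀).symm x))
    (hfx : f ((extChartAt I p₀).symm x) ∈ (extChartAt J n₀).source) (v : E) :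
    fderivWithin ℝ (extChartAt J n₀ ∘ f ∘ (extChartAt I p₀).symm) (Set.range I) x v =
      modelDeriv J 𝓘(ℝ, E') (extChartAt J n₀) (f ((extChartAt I p₀).symm x))
        (modelDeriv I J f ((extChartAt I p₀).symm x) (chartFrame I p₀ x v)) := by
  have : IsManifold I 1 M := IsManifold.of_le (m := 1) (n := ∞) (by simp)
  have : IsManifold J 1 N := IsManifold.of_le (m := 1) (n := ∞) (by simp)
  have h1 := (mdifferentiableWithinAt_extChartAt_symm (I := I) hx).hasMFDerivWithinAt
  have h2 := hf.hasMFDerivAt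
  have h3 := (mdifferentiableAt_extChartAt (I := J) (x := n₀)
    (by rwa [← extChartAt_source (I := J)])).hasMFDerivAt
  have h4 := (HasMFDerivAt.comp _ h3 h2).comp_hasMFDerivWithinAt x h1
  have h5 : HasFDerivWithinAt (extChartAt J n₀ ∘ f ∘ (extChartAt I p₀).symm)
      (modelDeriv J 𝓘(ℝ, E') (extChartAt J n₀) (f ((extChartAt I p₀).symm x)) ∘L
        (modelDeriv I J f ((extChartAt I p₀).symm x) ∘L chartFrame I p₀ x))
      (Set.range I) x := hasMFDerivWithinAt_iff_hasFDerivWithinAt.1 h4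
  have h5 := h5.fderivWithin (I.uniqueDiffOn x (extChartAt_target_subset_range p₀ hx))
  rw [h5]
  rfl

theorem chartFrame_comp (f : M → N) {p₀ : M} {n₀ : N} {x : E}
    (hx : x ∈ (extChartAt I p₀).target)
    (hf : MDifferentiableAt I J f ((extChartAt I p₀).symm x))
    (hfx : f ((extChartAt I p₀).symm x) ∈ (extChartAt J n₀).source) (v : E) :
    chartFrame J n₀ ((extChartAt J n₀ ∘ f ∘ (extChartAt I p₀).symm) x)
      (fderivWithin ℝ (extChartAt J n₀ ∘ f ∘ (extChartAt I p₀).symm) (Set.range I) x v) =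
    modelDeriv I J f ((extChartAt I p₀).symm x) (chartFrame I p₀ x v) := by
  have : IsManifold J 1 N := IsManifold.of_le (m := 1) (n := ∞) (by simp)
  rw [fderivWithin_writtenInCharts f hx hf hfx]
  exact congrArg (fun L : E' →L[ℝ] E' =>
    L (modelDeriv I J f ((extChartAt I p₀).symm x) (chartFrame I p₀ x v)))
    (mfderivWithin_extChartAt_symm_comp_mfderiv_extChartAt' (I := J) hfx)

theorem DiffForm.inChart_pullback (f : M → N) (Ω : DiffForm J N k) {p₀ : M} {n₀ : N} {x : E}
    (hx : x ∈ (extChartAt I p₀).target)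
    (hf : MDifferentiableAt I J f ((extChartAt I p₀).symm x))
    (hfx : f ((extChartAt I p₀).symm x) ∈ (extChartAt J n₀).source) :
    (DiffForm.pullback f Ω : DiffForm I M k).inChart p₀ x =
      (Ω.inChart n₀ ((extChartAt J n₀ ∘ f ∘ (extChartAt I p₀).symm) x)).compContinuousLinearMap
        (fderivWithin ℝ (extChartAt J n₀ ∘ f ∘ (extChartAt I p₀).symm) (Set.range I) x) := by
  ext v
  rw [DiffForm.inChart_eq, DiffForm.inChart_eq]
  simp only [ContinuousAlternatingMap.compContinuousLinearMap_apply, Function.comp_def]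
  have hpt : (extChartAt J n₀).symm ((extChartAt J n₀) (f ((extChartAt I p₀).symm x))) =
    f ((extChartAt I p₀).symm x) := (extChartAt J n₀).left_inv hfx
  rw [hpt]
  have := fun i => chartFrame_comp f hx hf hfx (v i)
  simp only [Function.comp_def] at this
  simp only [this]
  rfl

theorem contDiffWithinAt_written_in_charts {f : M → N} {p₀ : M} {n₀ : N} {p : M}
    (hp : p ∈ (extChartAt I p₀).source) (hf : ContMDiffAt I J ∞ f p)
    (hfp : f p ∈ (extChartAt J n₀).source) :
    ContDiffWithinAt ℝ ∞ (extChartAt J n₀ ∘ f ∘ (extChartAt I p₀).symm) (Set.range I)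
      (extChartAt I p₀ p) := by
  rw [extChartAt_source] at hp hfp
  exact ((contMDiffAt_iff_of_mem_source hp hfp).1 hf).2

theorem DiffForm.eventually_inChart_pullback {f : M → N} (Ω : DiffForm J N k) {p₀ : M} {n₀ : N}
    {p : M} (hp : p ∈ (extChartAt I p₀).source) (hf : ContMDiffAt I J ∞ f p)
    (hfp : f p ∈ (extChartAt J n₀).source) :
    (DiffForm.pullback f Ω : DiffForm I M k).inChart p₀ =ᶠ[𝓝[Set.range I] (extChartAt I p₀ p)]
      fun x => (Ω.inChart n₀ ((extChartAt J n₀ ∘ f ∘ (extChartAt I p₀).symm) x)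
        ).compContinuousLinearMap
        (fderivWithin ℝ (extChartAt J n₀ ∘ f ∘ (extChartAt I p₀).symm) (Set.range I) x) := by
  have h1 : ∀ᶠ q in 𝓝 p, MDifferentiableAt I J f q ∧ f q ∈ (extChartAt J n₀).source := by
    refine Filter.Eventually.and ?_ (hf.continuousAt.eventually
      ((isOpen_extChartAt_source n₀).mem_nhds hfp))
    have := (contMDiffAt_iff_contMDiffAt_nhds (by simp)).1 (hf.of_le (m := 1) (by simp))
    exact this.mono fun q hq => hq.mdifferentiableAt (by simp)
  have h2 : Filter.Tendsto (extChartAt I p₀).symm (𝓝[Set.range I] (extChartAt I p₀ p)) (𝓝 p) := by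
    have := (continuousAt_extChartAt_symm' hp).tendsto.mono_left
      (nhdsWithin_le_nhds (s := Set.range I))
    rwa [(extChartAt I p₀).left_inv hp] at this
  filter_upwards [h2.eventually h1, extChartAt_target_mem_nhdsWithin' hp] with x hx hxt
  exact DiffForm.inChart_pullback f Ω hxt hx.1 hx.2

theorem mapsTo_writtenInCharts (f : M → N) (p₀ : M) (n₀ : N) :
    Set.MapsTo (extChartAt J n₀ ∘ f ∘ (extChartAt I p₀).symm) (Set.range I) (Set.range J) :=
  fun x _ => by simp [extChartAt]

theorem DiffForm.contDiffWithinAt_inChart_pullback [FiniteDimensional ℝ E] [FiniteDimensional ℝ E']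
    {f : M → N} {Ω : DiffForm J N k} {p₀ : M} {n₀ : N} {p : M}
    (hp : p ∈ (extChartAt I p₀).source) (hf : ContMDiffAt I J ∞ f p)
    (hfp : f p ∈ (extChartAt J n₀).source)
    (h : ContDiffWithinAt ℝ ∞ (Ω.inChart n₀) (Set.range J) (extChartAt J n₀ (f p))) :
    ContDiffWithinAt ℝ ∞ ((DiffForm.pullback f Ω : DiffForm I M k).inChart p₀) (Set.range I)
      (extChartAt I p₀ p) := by
  have hx : extChartAt I p₀ p ∈ Set.range I := by simp [extChartAt]
  have hfs := contDiffWithinAt_written_in_charts hp hf hfp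
  refine ContDiffWithinAt.congr_of_eventuallyEq_of_mem ?_
    (DiffForm.eventually_inChart_pullback Ω hp hf hfp) hx
  refine contDiffWithinAt_compContinuousLinearMap ?_
    (hfs.fderivWithin_right I.uniqueDiffOn (by simp) hx)
  have hval : (extChartAt J n₀ ∘ f ∘ (extChartAt I p₀).symm) (extChartAt I p₀ p) =
    extChartAt J n₀ (f p) := by simp only [Function.comp_apply, (extChartAt I p₀).left_inv hp]
  rw [← hval] at h
  exact ContDiffWithinAt.comp (g := Ω.inChart n₀) (t := Set.range J) _ h hfs
    (mapsTo_writtenInCharts f p₀ n₀)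

theorem DiffForm.extDerivWithin_inChart_pullback
    {f : M → N} {Ω : DiffForm J N k} {p₀ : M} {n₀ : N} {p : M}
    (hp : p ∈ (extChartAt I p₀).source) (hf : ContMDiffAt I J ∞ f p)
    (hfp : f p ∈ (extChartAt J n₀).source)
    (h : ContDiffWithinAt ℝ ∞ (Ω.inChart n₀) (Set.range J) (extChartAt J n₀ (f p))) :
    extDerivWithin ((DiffForm.pullback f Ω : DiffForm I M k).inChart p₀) (Set.range I)
        (extChartAt I p₀ p) =
      (extDerivWithin (Ω.inChart n₀) (Set.range J) (extChartAt J n₀ (f p))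
        ).compContinuousLinearMap
        (fderivWithin ℝ (extChartAt J n₀ ∘ f ∘ (extChartAt I p₀).symm) (Set.range I)
          (extChartAt I p₀ p)) := by
  have hx : extChartAt I p₀ p ∈ Set.range I := by simp [extChartAt]
  have hfs := contDiffWithinAt_written_in_charts hp hf hfp
  have hval : (extChartAt J n₀ ∘ f ∘ (extChartAt I p₀).symm) (extChartAt I p₀ p) =
    extChartAt J n₀ (f p) := by simp only [Function.comp_apply, (extChartAt I p₀).left_inv hp]
  rw [(DiffForm.eventually_inChart_pullback Ω hp hf hfp).extDerivWithin_eq_of_mem hx]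
  rw [extDerivWithin_pullback (r := ∞) (t := Set.range J) ?_ hfs
    (by rw [minSmoothness_of_isRCLikeNormedField]; exact WithTop.coe_le_coe.2 le_top) I.uniqueDiffOn
    (I.range_subset_closure_interior hx) hx (mapsTo_writtenInCharts f p₀ n₀), hval]
  rw [hval]
  exact h.differentiableWithinAt (by simp)

end

variable [IsManifold I ∞ M] [IsManifold J ∞ N]

theorem DiffForm.pullback_id (Ω : DiffForm I M k) : DiffForm.pullback id Ω = Ω := by
  funext p
  ext v
  simp [DiffForm.pullback]

theorem DiffForm.SmoothAt.of_chart [FiniteDimensional ℝ E] {Ω : DiffForm I M k} {p₀ p : M}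
    (hp : p ∈ (extChartAt I p₀).source)
    (h : ContDiffWithinAt ℝ ∞ (Ω.inChart p₀) (Set.range I) (extChartAt I p₀ p)) :
    Ω.SmoothAt p := by
  intro p₁ hp₁
  have := DiffForm.contDiffWithinAt_inChart_pullback (Ω := Ω) (f := id) hp₁ contMDiffAt_id hp h
  rwa [DiffForm.pullback_id] at this

theorem DiffForm.SmoothAt.pullback [FiniteDimensional ℝ E] [FiniteDimensional ℝ E']
    {f : M → N} {Ω : DiffForm J N k} {p : M}
    (hf : ContMDiffAt I J ∞ f p) (h : Ω.SmoothAt (f p)) :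
    (DiffForm.pullback f Ω : DiffForm I M k).SmoothAt p :=
  fun _ hp => DiffForm.contDiffWithinAt_inChart_pullback hp hf (mem_extChartAt_source (f p))
    (h _ (mem_extChartAt_source (f p)))

theorem DiffForm.d_val (Ω : DiffForm I M k) (p : M) :
    Ω.d.val p = extDerivWithin (Ω.inChart p) (Set.range I) (extChartAt I p p) := by
  have : IsManifold I 1 M := IsManifold.of_le (m := 1) (n := ∞) (by simp)
  have h := mfderiv_extChartAt_self (I := I) (x := p)
  ext v
  exact congrArg (fun L : E →L[ℝ] E => extDerivWithin (Ω.inChart p) (Set.range I)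
    (extChartAt I p p) (fun i => L (v i))) h

/-- The expression of `dΩ` in any chart is the exterior derivative of the expression of `Ω`. -/
theorem DiffForm.inChart_d {Ω : DiffForm I M k} {p₀ : M} {x : E}
    (hx : x ∈ (extChartAt I p₀).target) (h : Ω.SmoothAt ((extChartAt I p₀).symm x)) :
    Ω.d.inChart p₀ x = extDerivWithin (Ω.inChart p₀) (Set.range I) x := by
  set p := (extChartAt I p₀).symm x with hp
  have hps : p ∈ (extChartAt I p₀).source := (extChartAt I p₀).map_target hx
  have h1 := DiffForm.extDerivWithin_inChart_pullback (Ω := Ω) (f := id) hps contMDiffAt_id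
    (mem_extChartAt_source p) (h _ (mem_extChartAt_source p))
  have hxp : extChartAt I p₀ p = x := (extChartAt I p₀).right_inv hx
  rw [DiffForm.pullback_id, hxp] at h1
  rw [h1, DiffForm.inChart_eq, ← hp]
  have h2 : ∀ v, fderivWithin ℝ (extChartAt I p ∘ id ∘ (extChartAt I p₀).symm) (Set.range I) x v =
      modelDeriv I 𝓘(ℝ, E) (extChartAt I p) p (chartFrame I p₀ x v) := fun v => by
    refine (fderivWithin_writtenInCharts (I := I) (J := I) id (p₀ := p₀) (n₀ := p) hx
      mdifferentiableAt_id (mem_extChartAt_source p) v).trans ?_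
    have : modelDeriv I I id ((extChartAt I p₀).symm x) = ContinuousLinearMap.id ℝ E := mfderiv_id
    rw [this]
    rfl
  ext v
  simp only [ContinuousAlternatingMap.compContinuousLinearMap_apply, Function.comp_def] at h2 ⊢
  simp only [h2]
  rfl

/-- The exterior derivative commutes with pullback. -/
theorem DiffForm.d_pullback {f : M → N} {Ω : DiffForm J N k} {p : M}
    (hf : ContMDiffAt I J ∞ f p) (h : Ω.SmoothAt (f p)) :
    (DiffForm.pullback f Ω : DiffForm I M k).d.val p =
      (Ω.d.val (f p)).compContinuousLinearMap (modelDeriv I J f p) := by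
  have : IsManifold I 1 M := IsManifold.of_le (m := 1) (n := ∞) (by simp)
  rw [DiffForm.d_val, DiffForm.extDerivWithin_inChart_pullback (mem_extChartAt_source p) hf
    (mem_extChartAt_source (f p)) (h _ (mem_extChartAt_source _)), ← DiffForm.d_val]
  have hpp : (extChartAt I p).symm (extChartAt I p p) = p := extChartAt_to_inv p
  have h1 := fun v => fderivWithin_writtenInCharts (I := I) (J := J) f (p₀ := p) (n₀ := f p)
    (mem_extChartAt_target p) (by rw [hpp]; exact hf.mdifferentiableAt (by simp))
    (by rw [hpp]; exact mem_extChartAt_source _) v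
  rw [hpp] at h1
  have : IsManifold J 1 N := IsManifold.of_le (m := 1) (n := ∞) (by simp)
  have h2 : modelDeriv J 𝓘(ℝ, E') (extChartAt J (f p)) (f p) = ContinuousLinearMap.id ℝ E' :=
    mfderiv_extChartAt_self
  have h3 : chartFrame I p (extChartAt I p p) = ContinuousLinearMap.id ℝ E :=
    mfderivWithin_range_extChartAt_symm
  rw [h2, h3] at h1
  ext v
  simp only [ContinuousAlternatingMap.compContinuousLinearMap_apply, Function.comp_def] at h1 ⊢
  simp only [h1]
  rfl

theorem contDiffWithinAt_extDerivWithin {f : E → E [⋀^Fin k]→L[ℝ] ℝ} {s : Set E} {x : E}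
    (hf : ContDiffWithinAt ℝ ∞ f s x) (hs : UniqueDiffOn ℝ s) (hx : x ∈ s) :
    ContDiffWithinAt ℝ ∞ (extDerivWithin f s) s x :=
  (ContinuousAlternatingMap.alternatizeUncurryFinCLM ℝ E ℝ).contDiff.contDiffAt
    |>.comp_contDiffWithinAt x (hf.fderivWithin_right hs (by simp) hx)

theorem DiffForm.SmoothAt.d [FiniteDimensional ℝ E] {Ω : DiffForm I M k} {p : M}
    (h : ∀ᶠ q in 𝓝 p, Ω.SmoothAt q) : Ω.d.SmoothAt p := by
  refine DiffForm.SmoothAt.of_chart (mem_extChartAt_source p) ?_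
  have hx : extChartAt I p p ∈ Set.range I := by simp [extChartAt]
  have h2 : Filter.Tendsto (extChartAt I p).symm (𝓝[Set.range I] (extChartAt I p p)) (𝓝 p) := by
    have := (continuousAt_extChartAt_symm (I := I) p).tendsto.mono_left
      (nhdsWithin_le_nhds (s := Set.range I))
    rwa [extChartAt_to_inv] at this
  refine (contDiffWithinAt_extDerivWithin (h.self_of_nhds p (mem_extChartAt_source p))
    I.uniqueDiffOn hx).congr_of_eventuallyEq_of_mem ?_ hx
  filter_upwards [h2.eventually h, extChartAt_target_mem_nhdsWithin p] with y hy hyt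
  exact DiffForm.inChart_d hyt hy

/-- The Leibniz rule for the product of a function and a `1`-form. -/
theorem extDerivWithin_fun_smul_oneForm {f : E → ℝ} {a : E → E [⋀^Fin 1]→L[ℝ] ℝ} {s : Set E} {x : E}
    (hf : DifferentiableWithinAt ℝ f s x) (ha : DifferentiableWithinAt ℝ a s x)
    (hs : UniqueDiffWithinAt ℝ s x) (u v : E) :
    extDerivWithin (fun x => f x • a x) s x ![u, v] = f x * extDerivWithin a s x ![u, v] +
      (fderivWithin ℝ f s x u * a x ![v] - fderivWithin ℝ f s x v * a x ![u]) := by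
  have e0 : (0 : Fin 2).removeNth ![u, v] = ![v] := by
    ext i; fin_cases i; rfl
  have e1 : ∀ f : E [⋀^Fin 1]→L[ℝ] ℝ, f ((1 : Fin 2).removeNth ![u, v]) = f ![u] := fun f => by
    congr 1; ext i; fin_cases i; rfl
  rw [extDerivWithin, extDerivWithin, fderivWithin_fun_smul hs hf ha]
  simp only [ContinuousAlternatingMap.alternatizeUncurryFin_apply]
  rw [Fin.sum_univ_two, Fin.sum_univ_two]
  -- `erw` because the index type is `Fin (1 + 1)`
  erw [e1, e1]
  simp
  ring

end Forms

/-! ### Extending forms from an embedded submanifold -/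

section Sums

variable {E : Type*} [NormedAddCommGroup E] [NormedSpace ℝ E] [FiniteDimensional ℝ E]
  {H : Type*} [TopologicalSpace H] {I : ModelWithCorners ℝ E H}
  {M : Type*} [TopologicalSpace M] [ChartedSpace H M] [IsManifold I ∞ M] {k : ℕ}

/-- The product of a function and a form. -/
def DiffForm.mulFun (f : M → ℝ) (Ω : DiffForm I M k) : DiffForm I M k := fun p => f p • Ω p

theorem DiffForm.inChart_mulFun (f : M → ℝ) (Ω : DiffForm I M k) (p₀ : M) (x : E) :
    (DiffForm.mulFun f Ω).inChart p₀ x = f ((extChartAt I p₀).symm x) • Ω.inChart p₀ x := rfl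

theorem DiffForm.SmoothAt.congr {Ω Ω' : DiffForm I M k} {p : M} (h : Ω.SmoothAt p)
    (he : ∀ᶠ q in 𝓝 p, Ω' q = Ω q) : Ω'.SmoothAt p := by
  intro p₀ hp
  have h2 : Filter.Tendsto (extChartAt I p₀).symm (𝓝[Set.range I] (extChartAt I p₀ p)) (𝓝 p) := by
    have := (continuousAt_extChartAt_symm' hp).tendsto.mono_left
      (nhdsWithin_le_nhds (s := Set.range I))
    rwa [(extChartAt I p₀).left_inv hp] at this
  refine (h p₀ hp).congr_of_eventuallyEq_of_mem ?_ (by simp [extChartAt])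
  filter_upwards [h2.eventually he] with x hx
  rw [DiffForm.inChart, hx]
  rfl

theorem contDiffWithinAt_comp_extChartAt_symm {f : M → ℝ} {p₀ p : M}
    (hp : p ∈ (extChartAt I p₀).source) (hf : ContMDiffAt I 𝓘(ℝ, ℝ) ∞ f p) :
    ContDiffWithinAt ℝ ∞ (fun x => f ((extChartAt I p₀).symm x)) (Set.range I)
      (extChartAt I p₀ p) := by
  have := contDiffWithinAt_written_in_charts (n₀ := f p) hp hf (mem_extChartAt_source _)
  simpa using! this

theorem DiffForm.SmoothAt.mulFun {f : M → ℝ} {Ω : DiffForm I M k} {p : M}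
    (hf : ContMDiffAt I 𝓘(ℝ, ℝ) ∞ f p) (h : p ∈ tsupport f → Ω.SmoothAt p) :
    (DiffForm.mulFun f Ω).SmoothAt p := by
  by_cases hp : p ∈ tsupport f
  · exact fun p₀ hp₀ => (contDiffWithinAt_comp_extChartAt_symm hp₀ hf).smul (h hp p₀ hp₀)
  · have h0 : DiffForm.SmoothAt (fun p => 0 : DiffForm I M k) p := fun p₀ _ =>
      contDiffWithinAt_const (c := 0)
    refine h0.congr ?_
    filter_upwards [notMem_tsupport_iff_eventuallyEq.1 hp] with q hq
    rw [DiffForm.mulFun, hq]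
    exact zero_smul ℝ _

theorem DiffForm.SmoothAt.finsum {κ : Type*} {Ω : κ → DiffForm I M k} {p : M}
    (hfin : LocallyFinite fun i => {q | Ω i q ≠ 0}) (h : ∀ i, (Ω i).SmoothAt p) :
    DiffForm.SmoothAt (fun q => ∑ᶠ i, Ω i q : DiffForm I M k) p := by
  obtain ⟨t, ht, hft⟩ := hfin p
  have hs : DiffForm.SmoothAt (fun q => ∑ i ∈ hft.toFinset, Ω i q : DiffForm I M k) p := by
    intro p₀ hp
    refine contDiffWithinAt_of_apply fun v => ?_
    have : (fun x => DiffForm.inChart (fun q => ∑ i ∈ hft.toFinset, Ω i q : DiffForm I M k) p₀ x v)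
        = fun x => ∑ i ∈ hft.toFinset, (Ω i).inChart p₀ x v := by
      funext x
      let L : (E [⋀^Fin k]→L[ℝ] ℝ) →+ ℝ :=
        { toFun := fun B => B fun j => chartFrame I p₀ x (v j)
          map_zero' := rfl
          map_add' := fun _ _ => rfl }
      exact map_sum L (fun i => (Ω i).val ((extChartAt I p₀).symm x)) hft.toFinset
    rw [this]
    exact ContDiffWithinAt.sum fun i _ => contDiffWithinAt_apply (h i p₀ hp)
      fun _ => contDiffWithinAt_const
  refine hs.congr ?_
  filter_upwards [ht] with q hq
  refine finsum_eq_sum_of_support_subset _ fun i hi => ?_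
  simp only [Set.Finite.coe_toFinset, Set.mem_ofPred_eq]
  exact ⟨q, hi, hq⟩

end Sums

section Extension

variable {E : Type*} [NormedAddCommGroup E] [NormedSpace ℝ E] [FiniteDimensional ℝ E]
  {H : Type*} [TopologicalSpace H] {I : ModelWithCorners ℝ E H} [I.Boundaryless]
  {Z : Type*} [TopologicalSpace Z] [ChartedSpace H Z] [IsManifold I ∞ Z]
  {E' : Type*} [NormedAddCommGroup E'] [NormedSpace ℝ E'] [FiniteDimensional ℝ E']
  {H' : Type*} [TopologicalSpace H'] {J : ModelWithCorners ℝ E' H'}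
  {W : Type*} [TopologicalSpace W] [ChartedSpace H' W] [IsManifold J ∞ W] {k : ℕ}

/-- A smooth embedding has smooth local left inverses, defined on open subsets of the ambient
manifold. -/
theorem exists_local_leftInverse {ι : Z → W} (hι : Manifold.IsSmoothEmbedding I J ∞ ι) (z : Z) :
    ∃ (U : Set W) (π : W → Z), IsOpen U ∧ ι z ∈ U ∧ (∀ q ∈ U, ContMDiffAt J I ∞ π q) ∧
      ∀ z', ι z' ∈ U → π (ι z') = z' := by
  have h := hι.isImmersion.isImmersionAt z
  let dom := h.domChart.extend I
  let cod := h.codChart.extend J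
  let g : W → E := fun q => (h.equiv.symm (cod q)).1
  obtain ⟨O, hO, hOs⟩ := hι.isEmbedding.isInducing.isOpen_iff.1 h.domChart.open_source
  have htar : IsOpen dom.target := h.domChart.isOpen_extend_target
  have hg : ∀ z' ∈ h.domChart.source, g (ι z') = dom z' := by
    intro z' hz'
    have h1 : dom z' ∈ dom.target := dom.map_source (by simpa [dom] using hz')
    have h2 := h.writtenInCharts h1
    have h3 : dom.symm (dom z') = z' := dom.left_inv (by simpa [dom] using hz')
    simp only [Function.comp_apply] at h2
    change cod (ι (dom.symm (dom z'))) = _ at h2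
    rw [h3] at h2
    simp [g, h2]
  have hgs : ContMDiffOn J 𝓘(ℝ, E) ∞ g h.codChart.source := by
    have h1 : ContMDiffOn J 𝓘(ℝ, E') ∞ cod h.codChart.source :=
      h.codChart.contMDiffOn_extend h.codChart_mem_maximalAtlas
    have h2 : ContDiff ℝ ∞ fun v : E' => (h.equiv.symm v).1 :=
      contDiff_fst.comp h.equiv.symm.contDiff
    exact h2.contMDiff.comp_contMDiffOn h1
  refine ⟨O ∩ (h.codChart.source ∩ g ⁻¹' dom.target), fun q => dom.symm (g q),
    hO.inter (hgs.continuousOn.isOpen_inter_preimage h.codChart.open_source htar), ?_, ?_, ?_⟩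
  · refine ⟨?_, h.mem_codChart_source, ?_⟩
    · have : z ∈ ι ⁻¹' O := hOs ▸ h.mem_domChart_source
      exact this
    · rw [Set.mem_preimage, hg z h.mem_domChart_source]
      exact dom.map_source (by simpa [dom] using h.mem_domChart_source)
  · rintro q ⟨-, hq, hqt⟩
    have h1 : ContMDiffAt J 𝓘(ℝ, E) ∞ g q := (hgs q hq).contMDiffAt
      (h.codChart.open_source.mem_nhds hq)
    have h2 : ContMDiffOn 𝓘(ℝ, E) I ∞ dom.symm dom.target := by
      have := contMDiffOn_extend_symm (I := I) h.domChart_mem_maximalAtlas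
      refine this.mono ?_
      rw [← h.domChart.extend_target']
    exact ((h2 _ hqt).contMDiffAt (htar.mem_nhds hqt)).comp q h1
  · rintro z' ⟨hz', -⟩
    have hz : z' ∈ h.domChart.source := by rw [← hOs]; exact hz'
    change dom.symm (g (ι z')) = z'
    rw [hg z' hz]
    exact dom.left_inv (by simpa [dom] using hz)

/-- A form on a closed embedded submanifold extends to the ambient manifold. -/
theorem exists_extension [T2Space W] [SigmaCompactSpace W] {ι : Z → W}
    (hι : Manifold.IsSmoothEmbedding I J ∞ ι) (hcl : IsClosed (Set.range ι))
    {α : DiffForm I Z k} (hα : α.IsSmooth) :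
    ∃ α' : DiffForm J W k, (∀ p, α'.SmoothAt p) ∧ DiffForm.pullback ι α' = α := by
  choose U π hU hzU hπ hπι using exists_local_leftInverse hι
  obtain ⟨ψ, hψ⟩ := SmoothPartitionOfUnity.exists_isSubordinate J hcl U hU (by
    rintro _ ⟨z, rfl⟩
    exact Set.mem_iUnion.2 ⟨z, hzU z⟩)
  refine ⟨fun q => ∑ᶠ i, DiffForm.mulFun (ψ i) (DiffForm.pullback (π i) α : DiffForm J W k) q, fun p => ?_, ?_⟩
  · refine DiffForm.SmoothAt.finsum (ψ.locallyFinite.subset fun i q hq h0 => hq ?_) fun i => ?_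
    · rw [DiffForm.mulFun, h0]
      exact zero_smul ℝ _
    · refine DiffForm.SmoothAt.mulFun (ψ i).contMDiff.contMDiffAt fun hp => ?_
      exact DiffForm.SmoothAt.pullback (I := J) (J := I) (hπ i p (hψ i hp)) (hα.smoothAt _)
  · funext z
    have hιz : ContMDiffAt I J ∞ ι z := hι.contMDiff.contMDiffAt
    have key : ∀ i, ψ i (ι z) ≠ 0 →
        DiffForm.pullback ι (DiffForm.pullback (π i) α : DiffForm J W k) z = α z := by
      intro i hi
      have hmem : ι z ∈ U i := hψ i (subset_tsupport _ hi)
      have h1 := mfderiv_comp z ((hπ i _ hmem).mdifferentiableAt (by simp))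
        (hιz.mdifferentiableAt (by simp))
      have h2 : π i ∘ ι =ᶠ[𝓝 z] id := by
        filter_upwards [hιz.continuousAt.eventually ((hU i).mem_nhds hmem)] with z' hz'
        exact hπι i z' hz'
      rw [h2.mfderiv_eq, mfderiv_id] at h1
      ext v
      have h3 : ∀ j, mfderiv J I (π i) (ι z) (mfderiv I J ι z (v j)) = v j := fun j =>
        (congrArg (fun L : E →L[ℝ] E => L (v j)) h1).symm
      have h4 : π i (ι z) = z := hπι i z hmem
      have h5 : ∀ z' : Z, z' = z → ∀ w : Fin k → E, α.val z' w = α.val z w := by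
        rintro _ rfl w; rfl
      refine (h5 _ h4 fun j => mfderiv J I (π i) (ι z) (mfderiv I J ι z (v j))).trans ?_
      exact congrArg (α.val z) (funext h3)
    ext v
    let w : Fin k → E' := fun j => mfderiv I J ι z (v j)
    let L : (E' [⋀^Fin k]→L[ℝ] ℝ) →+ ℝ :=
      { toFun := fun B => B w, map_zero' := rfl, map_add' := fun _ _ => rfl }
    have hfin : (Function.support fun i =>
        (DiffForm.mulFun (ψ i) (DiffForm.pullback (π i) α : DiffForm J W k)).val (ι z)).Finite := by
      refine (ψ.locallyFinite.point_finite (ι z)).subset fun i hi h0 => hi ?_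
      change (ψ i (ι z)) • (DiffForm.pullback (π i) α : DiffForm J W k).val (ι z) = 0
      rw [h0, zero_smul]
    have h1 := L.map_finsum hfin
    refine h1.trans ?_
    have h2 : ∀ i, L ((DiffForm.mulFun (ψ i) (DiffForm.pullback (π i) α : DiffForm J W k)).val (ι z)) =
        ψ i (ι z) • α z v := by
      intro i
      change ψ i (ι z) * (DiffForm.pullback ι (DiffForm.pullback (π i) α : DiffForm J W k) z v) = _
      by_cases hi : ψ i (ι z) = 0
      · rw [hi]; simp
      · rw [key i hi]; rfl
    simp only [h2]
    rw [← finsum_smul' , ψ.sum_eq_one ⟨z, rfl⟩, one_smul]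
    exact ψ.locallyFinite.point_finite (ι z)

end Extension

/-! ### Boundary charts and boundary defining functions -/

section BoundaryDefining

variable {n : ℕ} [NeZero n] {W : Type*} [TopologicalSpace W]
  [ChartedSpace (EuclideanHalfSpace n) W]

/-- The part of the model vector space, open and not only relatively open in the half-space, over
which the chart at `p₀` is defined. -/
def chartDomain (n : ℕ) [NeZero n] {W : Type*} [TopologicalSpace W]
    [ChartedSpace (EuclideanHalfSpace n) W] (p₀ : W) : Set (EuclideanSpace ℝ (Fin n)) :=
  (𝓡∂ n).symm ⁻¹' (chartAt (EuclideanHalfSpace n) p₀).target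

theorem isOpen_chartDomain (p₀ : W) : IsOpen (chartDomain n p₀) :=
  (chartAt (EuclideanHalfSpace n) p₀).open_target.preimage (𝓡∂ n).continuous_symm

theorem target_eq_inter (p₀ : W) :
    (extChartAt (𝓡∂ n) p₀).target = chartDomain n p₀ ∩ {q | 0 ≤ q 0} := by
  rw [extChartAt, OpenPartialHomeomorph.extend_target, range_modelWithCornersEuclideanHalfSpace]
  rfl

theorem nonneg_of_mem_target {p₀ : W} {y : EuclideanSpace ℝ (Fin n)}
    (hy : y ∈ (extChartAt (𝓡∂ n) p₀).target) : 0 ≤ y 0 := by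
  rw [target_eq_inter] at hy
  exact hy.2

theorem extChartAt_nonneg (p₀ p : W) : 0 ≤ (extChartAt (𝓡∂ n) p₀ p) 0 := by
  have : extChartAt (𝓡∂ n) p₀ p ∈ Set.range (𝓡∂ n) := by simp [extChartAt]
  rwa [range_modelWithCornersEuclideanHalfSpace] at this

variable [IsManifold (𝓡∂ n) ∞ W]

theorem mem_interior_iff {p₀ p : W} (hp : p ∈ (extChartAt (𝓡∂ n) p₀).source) :
    p ∈ (𝓡∂ n).interior W ↔ 0 < (extChartAt (𝓡∂ n) p₀ p) 0 := by
  have h1 : (𝓡∂ n).IsInteriorPoint p ↔ _ :=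
    ModelWithCorners.isInteriorPoint_iff_of_mem_atlas (n := ∞) (by simp)
      (chart_mem_atlas (EuclideanHalfSpace n) p₀) (by rwa [← extChartAt_source (𝓡∂ n)])
  refine h1.trans ?_
  have h2 : interior ((chartAt (EuclideanHalfSpace n) p₀).extend (𝓡∂ n)).target =
      chartDomain n p₀ ∩ {y | 0 < y 0} := by
    rw [OpenPartialHomeomorph.extend_target, interior_inter,
      interior_range_modelWithCornersEuclideanHalfSpace]
    exact congrArg (· ∩ _) (isOpen_chartDomain p₀).interior_eq
  rw [h2]
  have h3 := (extChartAt (𝓡∂ n) p₀).map_source hp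
  rw [target_eq_inter] at h3
  exact ⟨fun h => h.2, fun h => ⟨h3.1, h⟩⟩

theorem mem_boundary_iff {p₀ p : W} (hp : p ∈ (extChartAt (𝓡∂ n) p₀).source) :
    p ∈ (𝓡∂ n).boundary W ↔ (extChartAt (𝓡∂ n) p₀ p) 0 = 0 := by
  rw [← ModelWithCorners.compl_interior, Set.mem_compl_iff, mem_interior_iff hp, not_lt]
  exact ⟨fun h => le_antisymm h (extChartAt_nonneg p₀ p), fun h => h.le⟩

/-- A smooth function on a chart domain that vanishes on the boundary is a smooth multiple of the
transverse coordinate. -/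
theorem exists_eq_transverse_mul {F : EuclideanSpace ℝ (Fin n) → ℝ}
    {O : Set (EuclideanSpace ℝ (Fin n))} (hO : IsOpen O)
    (hF : ContDiffOn ℝ ∞ F (O ∩ {q | 0 ≤ q 0})) (h0 : ∀ q ∈ O, q 0 = 0 → F q = 0) :
    ∃ g : EuclideanSpace ℝ (Fin n) → ℝ, ContDiffOn ℝ ∞ g (O ∩ {q | 0 ≤ q 0}) ∧
      ∀ q ∈ O ∩ {q | 0 ≤ q 0}, F q = q 0 * g q :=
  exists_contDiffOn_eq_mul hO (EuclideanSpace.proj (0 : Fin n) : EuclideanSpace ℝ (Fin n) →L[ℝ] ℝ)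
    (e := EuclideanSpace.single 0 1) (by simp) hF h0

/-- The transverse coordinates of two boundary charts are comparable. -/
theorem exists_transverse_le {p₀ c p : W} (hp₀ : p ∈ (extChartAt (𝓡∂ n) p₀).source)
    (hc : p ∈ (extChartAt (𝓡∂ n) c).source) :
    ∃ M : ℝ, 0 < M ∧ ∀ᶠ q in 𝓝 p,
      (extChartAt (𝓡∂ n) p₀ q) 0 ≤ M * (extChartAt (𝓡∂ n) c q) 0 := by
  let O : Set (EuclideanSpace ℝ (Fin n)) := (𝓡∂ n).symm ⁻¹'
    ((chartAt (EuclideanHalfSpace n) c).target ∩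
      (chartAt (EuclideanHalfSpace n) c).symm ⁻¹' (chartAt (EuclideanHalfSpace n) p₀).source)
  have hO : IsOpen O := ((chartAt (EuclideanHalfSpace n) c).isOpen_inter_preimage_symm
    (chartAt (EuclideanHalfSpace n) p₀).open_source).preimage (𝓡∂ n).continuous_symm
  have hmem : ∀ y ∈ O ∩ {q | 0 ≤ q 0}, y ∈ (extChartAt (𝓡∂ n) c).target ∧
      (extChartAt (𝓡∂ n) c).symm y ∈ (extChartAt (𝓡∂ n) p₀).source := by
    rintro y ⟨hy, hy0⟩
    refine ⟨?_, ?_⟩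
    · rw [target_eq_inter]
      exact ⟨hy.1, hy0⟩
    · rw [extChartAt_source]
      exact hy.2
  let F : EuclideanSpace ℝ (Fin n) → ℝ := fun y =>
    (extChartAt (𝓡∂ n) p₀ ((extChartAt (𝓡∂ n) c).symm y)) 0
  have hF : ContDiffOn ℝ ∞ F (O ∩ {q | 0 ≤ q 0}) := by
    intro y hy
    obtain ⟨h1, h2⟩ := hmem y hy
    have h3 := contDiffWithinAt_written_in_charts (I := 𝓡∂ n) (J := 𝓡∂ n) (f := id) (p₀ := c)
      (n₀ := p₀) ((extChartAt (𝓡∂ n) c).map_target h1) contMDiffAt_id h2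
    rw [(extChartAt (𝓡∂ n) c).right_inv h1] at h3
    have h4 : ContDiff ℝ ∞ fun y : EuclideanSpace ℝ (Fin n) => y 0 :=
      (EuclideanSpace.proj (0 : Fin n) : EuclideanSpace ℝ (Fin n) →L[ℝ] ℝ).contDiff
    refine (h4.contDiffAt.comp_contDiffWithinAt y h3).mono ?_
    rw [range_modelWithCornersEuclideanHalfSpace]
    exact Set.inter_subset_right
  obtain ⟨g, hg, hFg⟩ := exists_eq_transverse_mul hO hF (by
    intro y hy hy0
    obtain ⟨h1, h2⟩ := hmem y ⟨hy, hy0.ge⟩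
    rw [← mem_boundary_iff h2, mem_boundary_iff ((extChartAt (𝓡∂ n) c).map_target h1),
      (extChartAt (𝓡∂ n) c).right_inv h1]
    exact hy0)
  -- near `p` the quotient of the two coordinates is bounded, by continuity
  have hev : ∀ᶠ q in 𝓝 p, q ∈ (extChartAt (𝓡∂ n) c).source ∧
      q ∈ (extChartAt (𝓡∂ n) p₀).source :=
    Filter.Eventually.and (extChartAt_source_mem_nhds' hc) (extChartAt_source_mem_nhds' hp₀)
  have hin : ∀ q, q ∈ (extChartAt (𝓡∂ n) c).source ∧ q ∈ (extChartAt (𝓡∂ n) p₀).source →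
      extChartAt (𝓡∂ n) c q ∈ O ∩ {q | 0 ≤ q 0} := by
    rintro q ⟨h1, h2⟩
    have h3 := (extChartAt (𝓡∂ n) c).map_source h1
    have h3' := h3
    rw [target_eq_inter] at h3
    refine ⟨⟨h3.1, ?_⟩, h3.2⟩
    have h4 : (extChartAt (𝓡∂ n) c).symm (extChartAt (𝓡∂ n) c q) = q :=
      (extChartAt (𝓡∂ n) c).left_inv h1
    rw [extChartAt_source] at h2
    have h5 : (chartAt (EuclideanHalfSpace n) c).symm ((𝓡∂ n).symm (extChartAt (𝓡∂ n) c q)) = q := h4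
    rw [Set.mem_preimage, h5]
    exact h2
  have hcont : Filter.Tendsto (fun q => g (extChartAt (𝓡∂ n) c q)) (𝓝 p)
      (𝓝 (g (extChartAt (𝓡∂ n) c p))) := by
    refine (hg.continuousOn _ (hin p ⟨hc, hp₀⟩)).tendsto.comp ?_
    refine tendsto_nhdsWithin_iff.2 ⟨(continuousAt_extChartAt' hc).tendsto, ?_⟩
    exact hev.mono fun q hq => hin q hq
  refine ⟨|g (extChartAt (𝓡∂ n) c p)| + 1, by positivity, ?_⟩
  filter_upwards [hev, hcont.eventually (gt_mem_nhds (show g (extChartAt (𝓡∂ n) c p) <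
    |g (extChartAt (𝓡∂ n) c p)| + 1 from (le_abs_self _).trans_lt (lt_add_one _)))] with q hq hgq
  have h1 := hFg _ (hin q hq)
  have h2 : F (extChartAt (𝓡∂ n) c q) = (extChartAt (𝓡∂ n) p₀ q) 0 := by
    simp only [F, (extChartAt (𝓡∂ n) c).left_inv hq.1]
  rw [← h2, h1, mul_comm]
  exact mul_le_mul_of_nonneg_right hgq.le (extChartAt_nonneg c q)

/-- A boundary defining function: a smooth function that is, in each chart, the product of the
transverse coordinate and a positive smooth function. -/
structure IsBoundaryDefining (ρ : W → ℝ) : Prop where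
  smooth : ContMDiff (𝓡∂ n) 𝓘(ℝ, ℝ) ∞ ρ
  in_chart : ∀ p₀ : W, ∃ l : EuclideanSpace ℝ (Fin n) → ℝ,
    ContDiffOn ℝ ∞ l (extChartAt (𝓡∂ n) p₀).target ∧
    ∀ y ∈ (extChartAt (𝓡∂ n) p₀).target, 0 < l y ∧
      ρ ((extChartAt (𝓡∂ n) p₀).symm y) = y 0 * l y

theorem IsBoundaryDefining.eq_zero_iff {ρ : W → ℝ} (h : IsBoundaryDefining (n := n) ρ) (p : W) :
    ρ p = 0 ↔ p ∈ (𝓡∂ n).boundary W := by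
  obtain ⟨l, -, hl⟩ := h.in_chart p
  have h1 := hl _ (mem_extChartAt_target (I := 𝓡∂ n) p)
  rw [extChartAt_to_inv] at h1
  rw [mem_boundary_iff (mem_extChartAt_source p), h1.2, mul_eq_zero, or_iff_left h1.1.ne']

theorem IsBoundaryDefining.pos_iff {ρ : W → ℝ} (h : IsBoundaryDefining (n := n) ρ) (p : W) :
    0 < ρ p ↔ p ∈ (𝓡∂ n).interior W := by
  obtain ⟨l, -, hl⟩ := h.in_chart p
  have h1 := hl _ (mem_extChartAt_target (I := 𝓡∂ n) p)
  rw [extChartAt_to_inv] at h1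
  rw [mem_interior_iff (mem_extChartAt_source p), h1.2, mul_pos_iff_of_pos_right h1.1]

theorem exists_isBoundaryDefining [T2Space W] [SigmaCompactSpace W] :
    ∃ ρ : W → ℝ, IsBoundaryDefining (n := n) ρ := by
  obtain ⟨f, hf⟩ := SmoothPartitionOfUnity.exists_isSubordinate_chartAt_source (𝓡∂ n) W
  let X : W → W → ℝ := fun c p => (extChartAt (𝓡∂ n) c p) 0
  let ρ : W → ℝ := fun p => ∑ᶠ c, f c p • X c p
  have hfs : ∀ {c p : W}, f c p ≠ 0 → p ∈ (extChartAt (𝓡∂ n) c).source := by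
    intro c p h
    rw [extChartAt_source]
    exact hf c (subset_tsupport _ h)
  have hρ : ContMDiff (𝓡∂ n) 𝓘(ℝ, ℝ) ∞ ρ := by
    refine f.contMDiff_finsum_smul (n := ⊤) fun c p hp => ?_
    have h1 : ContMDiffAt (𝓡∂ n) 𝓘(ℝ, EuclideanSpace ℝ (Fin n)) ∞ (extChartAt (𝓡∂ n) c) p :=
      contMDiffAt_extChartAt' (hf c hp)
    have h4 : ContDiff ℝ ∞ fun y : EuclideanSpace ℝ (Fin n) => y 0 :=
      (EuclideanSpace.proj (0 : Fin n) : EuclideanSpace ℝ (Fin n) →L[ℝ] ℝ).contDiff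
    exact h4.contMDiff.contMDiffAt.comp p h1
  have hfin : ∀ p, (Function.support fun c => f c p • X c p).Finite := fun p =>
    (f.locallyFinite.point_finite p).subset fun c hc h0 => hc (by
      simp only [show f c p = 0 from h0, zero_smul])
  have hle : ∀ c p, f c p * X c p ≤ ρ p := fun c p =>
    single_le_finsum c (hfin p) fun c => mul_nonneg (f.nonneg c p) (extChartAt_nonneg c p)
  refine ⟨ρ, hρ, fun p₀ => ?_⟩
  have hF : ContDiffOn ℝ ∞ (fun y => ρ ((extChartAt (𝓡∂ n) p₀).symm y))
      (extChartAt (𝓡∂ n) p₀).target := by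
    intro y hy
    have := contDiffWithinAt_comp_extChartAt_symm ((extChartAt (𝓡∂ n) p₀).map_target hy)
      hρ.contMDiffAt
    rw [(extChartAt (𝓡∂ n) p₀).right_inv hy] at this
    exact this.mono (extChartAt_target_subset_range p₀)
  rw [target_eq_inter] at hF
  obtain ⟨l, hl, hlF⟩ := exists_eq_transverse_mul (isOpen_chartDomain p₀) hF (by
    intro y hy hy0
    have hyt : y ∈ (extChartAt (𝓡∂ n) p₀).target := by
      rw [target_eq_inter]; exact ⟨hy, hy0.ge⟩
    have hs := (extChartAt (𝓡∂ n) p₀).map_target hyt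
    refine finsum_eq_zero_of_forall_eq_zero fun c => ?_
    by_cases hc : f c ((extChartAt (𝓡∂ n) p₀).symm y) = 0
    · rw [hc, zero_smul]
    · have : X c ((extChartAt (𝓡∂ n) p₀).symm y) = 0 := by
        rw [← mem_boundary_iff (hfs hc), mem_boundary_iff hs,
          (extChartAt (𝓡∂ n) p₀).right_inv hyt]
        exact hy0
      rw [this, smul_zero])
  rw [← target_eq_inter] at hl hlF
  refine ⟨l, hl, fun y hy => ⟨?_, hlF y hy⟩⟩
  -- near the point over `y`, `ρ` is bounded below by a multiple of the transverse coordinate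
  set p := (extChartAt (𝓡∂ n) p₀).symm y with hp
  have hps : p ∈ (extChartAt (𝓡∂ n) p₀).source := (extChartAt (𝓡∂ n) p₀).map_target hy
  obtain ⟨c, hc⟩ : ∃ c, 0 < f c p := f.exists_pos_of_mem (Set.mem_univ p)
  obtain ⟨M, hM, hev⟩ := exists_transverse_le hps (hfs hc.ne')
  have hev2 : ∀ᶠ q in 𝓝 p, f c p / 2 < f c q :=
    (f c).contMDiff.continuous.continuousAt.eventually (lt_mem_nhds (half_lt_self hc))
  have hev3 : ∀ᶠ q in 𝓝 p, f c p / 2 / M * (extChartAt (𝓡∂ n) p₀ q) 0 ≤ ρ q := by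
    filter_upwards [hev, hev2] with q h1 h2
    refine le_trans ?_ (hle c q)
    have h3 : (extChartAt (𝓡∂ n) p₀ q) 0 / M ≤ X c q := by
      rw [div_le_iff₀ hM, mul_comm]; exact h1
    calc f c p / 2 / M * (extChartAt (𝓡∂ n) p₀ q) 0
        = f c p / 2 * ((extChartAt (𝓡∂ n) p₀ q) 0 / M) := by ring
      _ ≤ f c q * X c q := mul_le_mul h2.le h3
          (div_nonneg (extChartAt_nonneg p₀ q) hM.le) (f.nonneg c q)
  have htend : Filter.Tendsto (extChartAt (𝓡∂ n) p₀).symm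
      (𝓝[(extChartAt (𝓡∂ n) p₀).target] y) (𝓝 p) :=
    (continuousOn_extChartAt_symm p₀ y hy).tendsto
  have hev4 : ∀ᶠ y' in 𝓝[(extChartAt (𝓡∂ n) p₀).target] y, 0 < y' 0 → f c p / 2 / M ≤ l y' := by
    filter_upwards [htend.eventually hev3, self_mem_nhdsWithin] with y' h1 h2 h3
    rw [hlF y' h2, (extChartAt (𝓡∂ n) p₀).right_inv h2, mul_comm] at h1
    exact le_of_mul_le_mul_left h1 h3
  have hpos : 0 < f c p / 2 / M := by positivity
  refine hpos.trans_le ?_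
  -- the points with positive transverse coordinate accumulate at `y`
  let γ : ℝ → EuclideanSpace ℝ (Fin n) := fun t => y + t • EuclideanSpace.single 0 1
  have hγ0 : γ 0 = y := by simp [γ]
  have hγc : Continuous γ := by fun_prop
  have hγ : Filter.Tendsto γ (𝓝[>] 0) (𝓝[(extChartAt (𝓡∂ n) p₀).target] y) := by
    rw [target_eq_inter] at hy ⊢
    refine tendsto_nhdsWithin_iff.2 ⟨?_, ?_⟩
    · have := hγc.tendsto 0
      rw [hγ0] at this
      exact this.mono_left nhdsWithin_le_nhds
    · have h1 : ∀ᶠ t in 𝓝 (0 : ℝ), γ t ∈ chartDomain n p₀ :=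
        hγc.continuousAt.eventually ((isOpen_chartDomain p₀).mem_nhds (by rw [hγ0]; exact hy.1))
      filter_upwards [h1.filter_mono nhdsWithin_le_nhds, self_mem_nhdsWithin] with t ht ht0
      refine ⟨ht, ?_⟩
      have h2 : (0 : ℝ) ≤ y 0 := hy.2
      have h3 : (0 : ℝ) < t := ht0
      simp only [γ, Set.mem_ofPred_eq, PiLp.add_apply, PiLp.smul_apply, smul_eq_mul]
      simp
      positivity
  have hlim := ((hl.continuousOn y hy).tendsto).comp hγ
  refine ge_of_tendsto hlim ?_
  filter_upwards [hγ.eventually hev4, self_mem_nhdsWithin] with t ht ht0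
  refine ht ?_
  have h2 : (0 : ℝ) ≤ y 0 := nonneg_of_mem_target hy
  have h3 : (0 : ℝ) < t := ht0
  simp only [γ, PiLp.add_apply, PiLp.smul_apply, smul_eq_mul]
  simp
  positivity

end BoundaryDefining

/-! ### Exhaustions and small functions -/

section Exhaustion

theorem exists_smooth_exhaustion {E : Type*} [NormedAddCommGroup E] [NormedSpace ℝ E]
    [FiniteDimensional ℝ E] {H : Type*} [TopologicalSpace H] (I : ModelWithCorners ℝ E H)
    (M : Type*) [TopologicalSpace M] [ChartedSpace H M] [IsManifold I ∞ M] [T2Space M]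
    [SigmaCompactSpace M] :
    ∃ φ : M → ℝ, ContMDiff I 𝓘(ℝ, ℝ) ∞ φ ∧
      ∀ n : ℕ, ∃ K : Set M, IsCompact K ∧ {p | φ p ≤ n} ⊆ K := by
  have : LocallyCompactSpace M := Manifold.locallyCompact_of_finiteDimensional I
  let K := CompactExhaustion.choice M
  obtain ⟨φ, hφ⟩ := exists_contMDiffMap_forall_mem_convex_of_local_const (n := ⊤) I (M := M)
    (t := fun q => Set.Ici (K.find q : ℝ)) (fun q => convex_Ici _) fun q => by
      refine ⟨(K.find q + 1 : ℕ), ?_⟩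
      have h1 : q ∈ interior (K (K.find q + 1)) :=
        K.subset_interior_succ _ (K.mem_iff_find_le.2 le_rfl)
      filter_upwards [mem_interior_iff_mem_nhds.1 h1] with y hy
      exact Nat.cast_le (α := ℝ).2 (K.mem_iff_find_le.1 hy)
  refine ⟨φ, φ.contMDiff, fun n => ⟨K n, K.isCompact n, fun p hp => K.mem_iff_find_le.2 ?_⟩⟩
  have h1 : (K.find p : ℝ) ≤ φ p := hφ p
  exact_mod_cast h1.trans hp

/-- There are positive smooth functions on the line that decay, along with their derivative, as
fast as one wants. -/
theorem exists_small_function (δ : ℕ → ℝ) (hδ : ∀ n, 0 < δ n) :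
    ∃ η : ℝ → ℝ, ContDiff ℝ ∞ η ∧ (∀ r, 0 < η r) ∧ (∀ r, η r ≤ δ ⌊r⌋₊) ∧
      ∀ r, |deriv η r| ≤ δ ⌊r⌋₊ := by
  let δ' : ℕ → ℝ := fun n => (Finset.range (n + 1)).inf' ⟨0, by simp⟩ δ
  have hδ' : ∀ n, 0 < δ' n := fun n => (Finset.lt_inf'_iff _).2 fun i _ => hδ i
  have hle : ∀ n, δ' n ≤ δ n := fun n => Finset.inf'_le _ (by simp)
  have hanti : Antitone δ' := fun a b hab => Finset.inf'_mono _ (by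
    intro i hi; simp at hi ⊢; omega) _
  obtain ⟨e, he⟩ := exists_contMDiffMap_forall_mem_convex_of_local_const (n := ⊤) 𝓘(ℝ, ℝ) (M := ℝ)
    (t := fun u => Set.Ioc 0 (δ' ⌊u⌋₊)) (fun q => convex_Ioc _ _) fun u => by
      refine ⟨δ' (⌊u⌋₊ + 1), ?_⟩
      filter_upwards [gt_mem_nhds (lt_add_one u)] with y hy
      refine ⟨hδ' _, hanti ?_⟩
      have := Nat.floor_mono hy.le
      rcases le_or_gt 0 u with hu | hu
      · rwa [Nat.floor_add_one hu] at this
      · rw [Nat.floor_of_nonpos hu.le]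
        refine this.trans ?_
        have : ⌊u + 1⌋₊ < 1 := (Nat.floor_lt' one_ne_zero).2 (by push_cast; linarith)
        omega
  have hec : ContDiff ℝ ∞ e := e.contMDiff.contDiff
  have hecont := hec.continuous
  let P : ℝ → ℝ := fun r => ∫ t in (0 : ℝ)..r, e t
  have hP : ∀ r, HasDerivAt P (e r) r := fun r =>
    intervalIntegral.integral_hasDerivAt_right (hecont.intervalIntegrable _ _)
      (hecont.stronglyMeasurableAtFilter _ _) hecont.continuousAt
  have hPs : ContDiff ℝ ∞ P := contDiff_infty_iff_deriv.2
    ⟨fun r => (hP r).differentiableAt, by rwa [show deriv P = e from funext fun r => (hP r).deriv]⟩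
  have hη : ∀ r, P (r + 1) - P r = ∫ t in r..(r + 1), e t := fun r =>
    intervalIntegral.integral_interval_sub_left (hecont.intervalIntegrable _ _)
      (hecont.intervalIntegrable _ _)
  have hmono : ∀ {r u : ℝ}, r ≤ u → e u ≤ δ' ⌊r⌋₊ := fun {r u} h =>
    (he u).2.trans (hanti (Nat.floor_mono h))
  refine ⟨fun r => P (r + 1) - P r, ?_, fun r => ?_, fun r => ?_, fun r => ?_⟩
  · exact (hPs.comp (contDiff_id.add contDiff_const)).sub hPs
  · change 0 < P (r + 1) - P r
    rw [hη]
    exact intervalIntegral.intervalIntegral_pos_of_pos (hecont.intervalIntegrable _ _)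
      (fun u => (he u).1) (lt_add_one r)
  · change P (r + 1) - P r ≤ _
    rw [hη]
    have := intervalIntegral.integral_mono_on (lt_add_one r).le (hecont.intervalIntegrable _ _)
      (continuous_const.intervalIntegrable _ _) (μ := MeasureTheory.volume)
      (fun u hu => hmono hu.1 : ∀ u ∈ Set.Icc r (r + 1), e u ≤ δ' ⌊r⌋₊)
    refine this.trans ?_
    simpa using hle _
  · have h1 : HasDerivAt (fun r => P (r + 1) - P r) (e (r + 1) - e r) r :=
      ((hP (r + 1)).comp_add_const r 1).sub (hP r)
    rw [h1.deriv, abs_le]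
    have h2 := hmono (le_refl r)
    have h3 := hmono (lt_add_one r).le
    have h4 := (he r).1
    have h5 := (he (r + 1)).1
    have h6 := hle ⌊r⌋₊
    constructor <;> linarith

end Exhaustion

/-! ### The linear algebra at a boundary point -/

section Comp

variable {V : Type*} [NormedAddCommGroup V] [NormedSpace ℝ V]
  {U : Type*} [NormedAddCommGroup U] [NormedSpace ℝ U]

theorem comp_eval {k : ℕ} (B : V [⋀^Fin k]→L[ℝ] ℝ) (D : U →L[ℝ] V) (w : Fin k → U) :
    B.compContinuousLinearMap D w = B fun i => D (w i) := rfl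

theorem comp_two (B : V [⋀^Fin 2]→L[ℝ] ℝ) (D : U →L[ℝ] V) (u v : U) :
    B.compContinuousLinearMap D ![u, v] = B ![D u, D v] := by
  rw [comp_eval]
  congr 1
  ext i
  fin_cases i <;> rfl

theorem comp_one (a : V [⋀^Fin 1]→L[ℝ] ℝ) (D : U →L[ℝ] V) (u : U) :
    a.compContinuousLinearMap D ![u] = a ![D u] := by
  rw [comp_eval]
  congr 1
  ext i
  fin_cases i
  rfl

end Comp

section BoundaryLinear

variable {V : Type*} [NormedAddCommGroup V] [NormedSpace ℝ V] [FiniteDimensional ℝ V]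
  {U : Type*} [NormedAddCommGroup U] [NormedSpace ℝ U] [FiniteDimensional ℝ U]

theorem exists_dual_vector {Ω : V [⋀^Fin 2]→L[ℝ] ℝ} (hΩ : NondegenerateOn Ω Set.univ)
    (τ : V →L[ℝ] ℝ) : ∃ R, ∀ v, Ω ![R, v] = τ v := by
  have hinj : Function.Injective (bilin Ω) := by
    refine (injective_iff_map_eq_zero _).2 fun u hu => hΩ u trivial fun v _ => ?_
    rw [← bilin_apply, hu, LinearMap.zero_apply]
  have hsurj : Function.Surjective (bilin Ω) :=
    (LinearMap.injective_iff_surjective_of_finrank_eq_finrank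
      (Subspace.dual_finrank_eq (K := ℝ) (V := V)).symm).1 hinj
  obtain ⟨R, hR⟩ := hsurj τ.toLinearMap
  exact ⟨R, fun v => by rw [← bilin_apply, hR]; rfl⟩

theorem range_eq_ker_of_finrank {m : ℕ} (hV : Module.finrank ℝ V = m + 1)
    (hU : Module.finrank ℝ U = m) {D : U →L[ℝ] V} (hD : Function.Injective D) {τ : V →L[ℝ] ℝ}
    (hτ : ∀ u, τ (D u) = 0) {ν : V} (hν : τ ν ≠ 0) {v : V} (hv : τ v = 0) : ∃ u, D u = v := by
  have h1 : LinearMap.range D.toLinearMap ≤ LinearMap.ker τ.toLinearMap := by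
    rintro _ ⟨u, rfl⟩
    exact hτ u
  have h2 : Module.finrank ℝ (LinearMap.range D.toLinearMap) = m := by
    rw [LinearMap.finrank_range_of_inj hD, hU]
  have h3 : Module.finrank ℝ (LinearMap.ker τ.toLinearMap) = m := by
    have h4 := LinearMap.finrank_range_add_finrank_ker τ.toLinearMap
    have h5 : LinearMap.range τ.toLinearMap = ⊤ :=
      LinearMap.range_eq_top.2 (LinearMap.surjective fun h => hν (by
        exact congrArg (fun l : V →ₗ[ℝ] ℝ => l ν) h))
    rw [h5, finrank_top, Module.finrank_self, hV] at h4
    omega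
  have h6 := Submodule.eq_of_le_of_finrank_eq h1 (h2.trans h3.symm)
  have h7 : v ∈ LinearMap.ker τ.toLinearMap := hv
  rw [← h6] at h7
  exact h7

theorem TwistNondegenerate.of_comp {Ω A : V [⋀^Fin 2]→L[ℝ] ℝ} {a : V [⋀^Fin 1]→L[ℝ] ℝ}
    {τ : V →L[ℝ] ℝ} {s g : ℝ} {L : U →L[ℝ] V} (hL : Function.Surjective L) {τ' : U →L[ℝ] ℝ}
    (hτ' : ∀ u, τ' u = τ (L u))
    (h : TwistNondegenerate (Ω.compContinuousLinearMap L) (A.compContinuousLinearMap L)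
      (a.compContinuousLinearMap L) τ' s g) : TwistNondegenerate Ω A a τ s g := by
  intro u hu
  obtain ⟨u, rfl⟩ := hL u
  rw [h u fun v => ?_, map_zero]
  simpa only [comp_two, comp_one, hτ'] using hu (L v)

end BoundaryLinear

/-! ### Charts at a boundary point -/

section ChartFrames

variable {E : Type*} [NormedAddCommGroup E] [NormedSpace ℝ E]
  {H : Type*} [TopologicalSpace H] {I : ModelWithCorners ℝ E H}
  {M : Type*} [TopologicalSpace M] [ChartedSpace H M] [IsManifold I ∞ M] {k : ℕ}

theorem chartFrame_self (p : M) : chartFrame I p (extChartAt I p p) = ContinuousLinearMap.id ℝ E :=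
  have : IsManifold I 1 M := IsManifold.of_le (m := 1) (n := ∞) (by simp)
  mfderivWithin_range_extChartAt_symm

theorem DiffForm.inChart_self (Ω : DiffForm I M k) (p : M) :
    Ω.inChart p (extChartAt I p p) = Ω.val p := by
  rw [DiffForm.inChart_eq, chartFrame_self, extChartAt_to_inv]
  rfl

theorem chartFrame_bijective [FiniteDimensional ℝ E] {p₀ : M} {y : E}
    (hy : y ∈ (extChartAt I p₀).target) : Function.Bijective (chartFrame I p₀ y) := by
  have : IsManifold I 1 M := IsManifold.of_le (m := 1) (n := ∞) (by simp)
  have h1 : ∀ v, chartFrame I p₀ y (modelDeriv I 𝓘(ℝ, E) (extChartAt I p₀)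
      ((extChartAt I p₀).symm y) v) = v := fun v => by
    have h2 := mfderivWithin_extChartAt_symm_comp_mfderiv_extChartAt (I := I) hy
    exact congrArg (fun L : E →L[ℝ] E => L v) h2
  have hs : Function.Surjective (chartFrame I p₀ y) := fun v => ⟨_, h1 v⟩
  exact ⟨(LinearMap.injective_iff_surjective (f := (chartFrame I p₀ y).toLinearMap)).2 hs, hs⟩

theorem fderivWithin_comp_chart_symm {f : M → ℝ} {p₀ : M} {y : E}
    (hy : y ∈ (extChartAt I p₀).target)
    (hf : MDifferentiableAt I 𝓘(ℝ, ℝ) f ((extChartAt I p₀).symm y)) (v : E) :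
    fderivWithin ℝ (fun y => f ((extChartAt I p₀).symm y)) (Set.range I) y v =
      modelDeriv I 𝓘(ℝ, ℝ) f ((extChartAt I p₀).symm y) (chartFrame I p₀ y v) := by
  have h := fderivWithin_writtenInCharts f (n₀ := f ((extChartAt I p₀).symm y)) hy hf
    (mem_extChartAt_source _) v
  have h2 : modelDeriv 𝓘(ℝ, ℝ) 𝓘(ℝ, ℝ) (extChartAt 𝓘(ℝ, ℝ) (f ((extChartAt I p₀).symm y)))
      (f ((extChartAt I p₀).symm y)) = ContinuousLinearMap.id ℝ ℝ := mfderiv_extChartAt_self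
  rw [h2] at h
  exact h

end ChartFrames

section BoundaryPoint

variable {n : ℕ} [NeZero n] {W : Type*} [TopologicalSpace W]
  [ChartedSpace (EuclideanHalfSpace n) W] [IsManifold (𝓡∂ n) ∞ W]

/-- At a boundary point the differential of a boundary defining function is a positive multiple of
the differential of the transverse coordinate. -/
theorem IsBoundaryDefining.exists_deriv {ρ : W → ℝ} (h : IsBoundaryDefining (n := n) ρ) {p₀ : W}
    {y : EuclideanSpace ℝ (Fin n)} (hy : y ∈ (extChartAt (𝓡∂ n) p₀).target) (hy0 : y 0 = 0) :
    ∃ c : ℝ, 0 < c ∧ ∀ v, modelDeriv (𝓡∂ n) 𝓘(ℝ, ℝ) ρ ((extChartAt (𝓡∂ n) p₀).symm y)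
      (chartFrame (𝓡∂ n) p₀ y v) = c * v 0 := by
  obtain ⟨l, hl, hρ⟩ := h.in_chart p₀
  refine ⟨l y, (hρ y hy).1, fun v => ?_⟩
  rw [← fderivWithin_comp_chart_symm hy (h.smooth.mdifferentiable (by simp) _)]
  have hr := extChartAt_target_subset_range p₀ hy
  have hnhds : (extChartAt (𝓡∂ n) p₀).target ∈ 𝓝[Set.range (𝓡∂ n)] y :=
    extChartAt_target_mem_nhdsWithin_of_mem hy
  have h1 : (fun y => ρ ((extChartAt (𝓡∂ n) p₀).symm y)) =ᶠ[𝓝[Set.range (𝓡∂ n)] y]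
      fun y => y 0 * l y := by
    filter_upwards [hnhds] with y' hy'
    exact (hρ y' hy').2
  have h2 : HasFDerivWithinAt (fun y : EuclideanSpace ℝ (Fin n) => y 0)
      (EuclideanSpace.proj (0 : Fin n) : EuclideanSpace ℝ (Fin n) →L[ℝ] ℝ)
      (Set.range (𝓡∂ n)) y :=
    (EuclideanSpace.proj (0 : Fin n) : EuclideanSpace ℝ (Fin n) →L[ℝ] ℝ).hasFDerivWithinAt
  have h3 : DifferentiableWithinAt ℝ l (Set.range (𝓡∂ n)) y :=
    ((hl y hy).differentiableWithinAt (by simp)).mono_of_mem_nhdsWithin hnhds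
  rw [h1.fderivWithin_eq_of_mem hr, 
    show fderivWithin ℝ (fun y : EuclideanSpace ℝ (Fin n) => y 0 * l y) (Set.range (𝓡∂ n)) y = _ from
      (h2.mul h3.hasFDerivWithinAt).fderivWithin ((𝓡∂ n).uniqueDiffOn y hr)]
  simp [hy0]

end BoundaryPoint

section Filling

variable {m : ℕ} {W : Type*} [TopologicalSpace W] [ChartedSpace (EuclideanHalfSpace (2 * m + 2)) W]
  [IsManifold (𝓡∂ (2 * m + 2)) ∞ W]
  {Z : Type*} [TopologicalSpace Z] [ChartedSpace (EuclideanSpace ℝ (Fin (2 * m + 1))) Z]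
  [IsManifold (𝓡 (2 * m + 1)) ∞ Z]
  {ι : Z → W} {Ω : DiffForm (𝓡∂ (2 * m + 2)) W 2} {α : DiffForm (𝓡 (2 * m + 1)) Z 1}
  {α' : DiffForm (𝓡∂ (2 * m + 2)) W 1} {ρ : W → ℝ}

variable (m) in
/-- The differential of a function on `W`. -/
abbrev diff (ρ : W → ℝ) (p : W) : EuclideanSpace ℝ (Fin (2 * m + 2)) →L[ℝ] ℝ :=
  modelDeriv (𝓡∂ (2 * m + 2)) 𝓘(ℝ, ℝ) ρ p

theorem diff_boundary (hρ : IsBoundaryDefining (n := 2 * m + 2) ρ) {p : W}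
    (hp : p ∈ (𝓡∂ (2 * m + 2)).boundary W) : ∃ c : ℝ, 0 < c ∧ ∀ v, diff m ρ p v = c * v 0 := by
  have h := hρ.exists_deriv (mem_extChartAt_target (I := 𝓡∂ (2 * m + 2)) p)
    ((mem_boundary_iff (mem_extChartAt_source p)).1 hp)
  rw [chartFrame_self, extChartAt_to_inv] at h
  exact h

theorem diff_comp_boundary (hι : IsBoundaryInclusion (m := m) ι)
    (hρ : IsBoundaryDefining (n := 2 * m + 2) ρ) (z : Z)
    (u : EuclideanSpace ℝ (Fin (2 * m + 1))) :
    diff m ρ (ι z) (modelDeriv (𝓡 (2 * m + 1)) (𝓡∂ (2 * m + 2)) ι z u) = 0 := by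
  have h1 := mfderiv_comp z (hρ.smooth.mdifferentiable (by simp) (ι z))
    (hι.smoothEmbedding.contMDiff.mdifferentiable (by simp) z)
  have h2 : ρ ∘ ι = fun _ => 0 := by
    funext z
    exact (hρ.eq_zero_iff _).2 (hι.range_eq ▸ ⟨z, rfl⟩)
  rw [h2, mfderiv_const] at h1
  exact (congrArg (fun L : EuclideanSpace ℝ (Fin (2 * m + 1)) →L[ℝ] ℝ => L u) h1).symm

theorem injective_modelDeriv_boundary (hι : IsBoundaryInclusion (m := m) ι) (z : Z) :
    Function.Injective (modelDeriv (𝓡 (2 * m + 1)) (𝓡∂ (2 * m + 2)) ι z) := by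
  obtain ⟨U, π, hU, hzU, hπ, hπι⟩ := exists_local_leftInverse hι.smoothEmbedding z
  have hιz := hι.smoothEmbedding.contMDiff.contMDiffAt (x := z)
  have h1 := mfderiv_comp z ((hπ _ hzU).mdifferentiableAt (by simp))
    (hιz.mdifferentiableAt (by simp))
  have h2 : π ∘ ι =ᶠ[𝓝 z] id := by
    filter_upwards [hιz.continuousAt.eventually (hU.mem_nhds hzU)] with z' hz'
    exact hπι z' hz'
  rw [h2.mfderiv_eq, mfderiv_id] at h1
  have h3 : ∀ v, modelDeriv (𝓡∂ (2 * m + 2)) (𝓡 (2 * m + 1)) π (ι z)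
      (modelDeriv (𝓡 (2 * m + 1)) (𝓡∂ (2 * m + 2)) ι z v) = v := fun v =>
    (congrArg (fun L : EuclideanSpace ℝ (Fin (2 * m + 1)) →L[ℝ]
      EuclideanSpace ℝ (Fin (2 * m + 1)) => L v) h1).symm
  exact Function.LeftInverse.injective h3

/-- The data at a boundary point of a weak filling: the vector `R` dual to the differential of a
boundary defining function (it spans the characteristic line of the boundary) is positively
transverse to the contact structure, and the forms `Ω + s dα` are symplectic on the contact
hyperplane. -/
theorem IsWeakFilling.boundary_data (h : IsWeakFilling ι Ω α)
    (hα' : ∀ p, α'.SmoothAt p) (hια : DiffForm.pullback ι α' = α)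
    (hρ : IsBoundaryDefining (n := 2 * m + 2) ρ) (z : Z) :
    ∃ R, (∀ v, Ω.val (ι z) ![R, v] = diff m ρ (ι z) v) ∧ 0 < α'.val (ι z) ![R] ∧
      (∀ s : ℝ, 0 ≤ s → NondegenerateOn (Ω.val (ι z) + s • α'.d.val (ι z))
        {u | α'.val (ι z) ![u] = 0 ∧ diff m ρ (ι z) u = 0}) ∧
      NondegenerateOn (α'.d.val (ι z)) {u | α'.val (ι z) ![u] = 0 ∧ diff m ρ (ι z) u = 0} := by
  set p := ι z
  let D := modelDeriv (𝓡 (2 * m + 1)) (𝓡∂ (2 * m + 2)) ι z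
  have hp : p ∈ (𝓡∂ (2 * m + 2)).boundary W := h.boundary.range_eq ▸ ⟨z, rfl⟩
  obtain ⟨c, hc, hdρ⟩ := diff_boundary hρ hp
  have hτD : ∀ u, diff m ρ p (D u) = 0 := diff_comp_boundary h.boundary hρ z
  have hDinj : Function.Injective D := injective_modelDeriv_boundary h.boundary z
  let ν : EuclideanSpace ℝ (Fin (2 * m + 2)) := -EuclideanSpace.single 0 1
  have hν : diff m ρ p ν < 0 := by
    rw [hdρ]
    simpa [ν] using hc
  have hrange : ∀ v, diff m ρ p v = 0 → ∃ u, D u = v := fun v hv =>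
    range_eq_ker_of_finrank (m := 2 * m + 1) (by simp) (by simp) hDinj hτD hν.ne hv
  have hαD : ∀ u, α'.val p ![D u] = α.val z ![u] := fun u => by
    rw [← comp_one, ← hια]
    rfl
  have hAD : ∀ u v, α'.d.val p ![D u, D v] = α.d.val z ![u, v] := fun u v => by
    rw [← comp_two, ← hια, DiffForm.d_pullback h.boundary.smoothEmbedding.contMDiff.contMDiffAt
      (hα' _)]
  have hΩ : NondegenerateOn (Ω.val p) Set.univ := h.symplectic.nondegenerate p
  have hnd : ∀ s : ℝ, 0 ≤ s → NondegenerateOn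
      ((Ω.val p).compContinuousLinearMap D + s • α.d.val z) (kernel (α.val z)) := by
    intro s hs
    rcases hs.eq_or_lt with rfl | hs
    · rw [zero_smul, add_zero]
      exact h.nondegenerate z
    · exact h.weak (fun _ => s) contMDiff_const (fun _ => hs) z
  have hA : NondegenerateOn (α.d.val z) (kernel (α.val z)) := h.contact.nondegenerate z
  obtain ⟨R, hR⟩ := exists_dual_vector hΩ (diff m ρ p)
  obtain ⟨r, rfl⟩ := hrange R (by rw [← hR, alternating_self])
  have hout : IsOutward p ν := by
    have : IsManifold (𝓡∂ (2 * m + 2)) 1 W := IsManifold.of_le (m := 1) (n := ∞) (by simp)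
    have h1 := mfderiv_extChartAt_self (I := 𝓡∂ (2 * m + 2)) (x := p)
    have h2 : modelDeriv (𝓡∂ (2 * m + 2)) 𝓘(ℝ, EuclideanSpace ℝ (Fin (2 * m + 2)))
      (extChartAt (𝓡∂ (2 * m + 2)) p) p = ContinuousLinearMap.id ℝ _ := h1
    change (modelDeriv (𝓡∂ (2 * m + 2)) 𝓘(ℝ, EuclideanSpace ℝ (Fin (2 * m + 2)))
      (extChartAt (𝓡∂ (2 * m + 2)) p) p ν) 0 < 0
    rw [h2]
    simp [ν]
  have hpos := contact_pos_of_dual (m := m) (by simp) D (diff m ρ p) hτD ν hν (Ω.val p) (α.val z)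
    (α.d.val z) hnd hA (fun R w h1 h2 h3 => h.oriented z ν R w hout h1 h2 h3) r hR
  refine ⟨D r, hR, by rw [hαD]; exact hpos, fun s hs u hu huv => ?_, fun u hu huv => ?_⟩
  · obtain ⟨u, rfl⟩ := hrange u hu.2
    rw [hnd s hs u (by rw [kernel, Set.mem_ofPred_eq, ← hαD]; exact hu.1) fun v hv => ?_, map_zero]
    have := huv (D v) ⟨by rw [hαD]; exact hv, hτD v⟩
    simpa only [ContinuousAlternatingMap.add_apply, ContinuousAlternatingMap.smul_apply, comp_two,
      hAD] using this
  · obtain ⟨u, rfl⟩ := hrange u hu.2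
    rw [hA u (by rw [kernel, Set.mem_ofPred_eq, ← hαD]; exact hu.1) fun v hv => ?_, map_zero]
    rw [← hAD]
    exact huv (D v) ⟨by rw [hαD]; exact hv, hτD v⟩

end Filling

/-! ### The conformal factor -/

/-- The function `w ↦ exp (-1/w)` for `w > 0`, extended by zero, evaluated at `w = e - r` and
divided by `r²`. -/
def profile (e r : ℝ) : ℝ := expNegInvGlue (e - r) / r ^ 2

/-- Minus the partial derivative of `profile e r` with respect to `r`. -/
def profileSlope (e r : ℝ) : ℝ :=
  deriv expNegInvGlue (e - r) / r ^ 2 + 2 * expNegInvGlue (e - r) / r ^ 3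

theorem deriv_expNegInvGlue_nonneg (w : ℝ) : 0 ≤ deriv expNegInvGlue w :=
  expNegInvGlue.monotone.deriv_nonneg

theorem deriv_expNegInvGlue_of_nonpos {w : ℝ} (hw : w ≤ 0) : deriv expNegInvGlue w = 0 := by
  refine IsLocalMin.deriv_eq_zero (Filter.Eventually.of_forall fun x => ?_)
  rw [expNegInvGlue.zero_of_nonpos hw]
  exact expNegInvGlue.nonneg x

theorem profile_nonneg (e r : ℝ) : 0 ≤ profile e r :=
  div_nonneg (expNegInvGlue.nonneg _) (sq_nonneg r)

theorem profileSlope_pos {e r : ℝ} (hr : 0 < r) (h : r < e) : 0 < profileSlope e r := by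
  have h1 := deriv_expNegInvGlue_nonneg (e - r)
  have h2 := expNegInvGlue.pos_of_pos (sub_pos.2 h)
  rw [profileSlope]
  positivity

/-- The conformal factor is negligible compared to its slope near `r = 0`. -/
theorem profile_le_mul_slope {e r δ : ℝ} (hr : 0 < r) (hδ : r ≤ δ) :
    profile e r ≤ δ * profileSlope e r := by
  have h1 := deriv_expNegInvGlue_nonneg (e - r)
  have h2 := expNegInvGlue.nonneg (e - r)
  have h3 : 0 ≤ profileSlope e r := by rw [profileSlope]; positivity
  refine le_trans ?_ (mul_le_mul_of_nonneg_right hδ h3)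
  have h4 : r * profileSlope e r = deriv expNegInvGlue (e - r) / r + 2 * profile e r := by
    rw [profileSlope, profile]
    field_simp
  rw [h4]
  have h5 := profile_nonneg e r
  have h6 : 0 ≤ deriv expNegInvGlue (e - r) / r := by positivity
  linarith

/-- The differential of the conformal factor. The multiple of the differential of `f` is the product
of the slope and a number not larger than the derivative of `η`. -/
theorem fderivWithin_profile {E : Type*} [NormedAddCommGroup E] [NormedSpace ℝ E] {f r : E → ℝ}
    {s : Set E} {x : E} {η : ℝ → ℝ} (hη : DifferentiableAt ℝ η (f x))
    (hf : DifferentiableWithinAt ℝ f s x) (hr : DifferentiableWithinAt ℝ r s x) (hx : 0 < r x)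
    (hs : UniqueDiffWithinAt ℝ s x) (hlt : r x < η (f x)) :
    ∃ t : ℝ, |t| ≤ |deriv η (f x)| ∧ ∀ v,
      fderivWithin ℝ (fun y => profile (η (f y)) (r y)) s x v =
        -(profileSlope (η (f x)) (r x) * (fderivWithin ℝ r s x v - t * fderivWithin ℝ f s x v)) := by
  set w := η (f x) - r x with hw
  have hG := profileSlope_pos hx hlt
  refine ⟨deriv η (f x) * (deriv expNegInvGlue w / r x ^ 2 / profileSlope (η (f x)) (r x)), ?_, ?_⟩
  · have h1 := deriv_expNegInvGlue_nonneg w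
    have h2 := expNegInvGlue.nonneg w
    have h3 : 0 ≤ deriv expNegInvGlue w / r x ^ 2 / profileSlope (η (f x)) (r x) := by positivity
    rw [abs_mul, abs_of_nonneg h3]
    refine mul_le_of_le_one_right (abs_nonneg _) ((div_le_one hG).2 ?_)
    rw [profileSlope]
    exact le_add_of_nonneg_right (by positivity)
  · intro v
    have h1 : HasFDerivWithinAt (fun y => η (f y) - r y)
        (deriv η (f x) • fderivWithin ℝ f s x - fderivWithin ℝ r s x) s x :=
      (hη.hasDerivAt.comp_hasFDerivWithinAt x hf.hasFDerivWithinAt).sub hr.hasFDerivWithinAt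
    have h2 : HasFDerivWithinAt (fun y => expNegInvGlue (η (f y) - r y))
        (deriv expNegInvGlue w • (deriv η (f x) • fderivWithin ℝ f s x - fderivWithin ℝ r s x))
        s x := by
      have h : HasDerivAt expNegInvGlue (deriv expNegInvGlue w) (η (f x) - r x) :=
        ((expNegInvGlue.contDiff (n := ⊤)).differentiable (by simp) _).hasDerivAt
      exact h.comp_hasFDerivWithinAt x h1
    have h3 : HasFDerivWithinAt (fun y => (r y ^ 2)⁻¹)
        ((-(2 * r x) / (r x ^ 2) ^ 2) • fderivWithin ℝ r s x) s x := by
      have h : HasDerivAt (fun r : ℝ => (r ^ 2)⁻¹) (-(2 * r x) / (r x ^ 2) ^ 2) (r x) := by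
        have := (hasDerivAt_pow 2 (r x)).inv (by positivity)
        simpa using! this
      exact h.comp_hasFDerivWithinAt x hr.hasFDerivWithinAt
    have h4 : fderivWithin ℝ (fun y => profile (η (f y)) (r y)) s x = _ :=
      (h2.mul h3).fderivWithin hs
    rw [h4]
    have hG' := hG.ne'
    simp only [add_apply, smul_apply, sub_apply, smul_eq_mul]
    rw [← hw]
    have h5 : profileSlope (η (f x)) (r x) = deriv expNegInvGlue w / r x ^ 2 +
      2 * expNegInvGlue w / r x ^ 3 := rfl
    have h6 : profileSlope (η (f x)) (r x) * (fderivWithin ℝ r s x v -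
        deriv η (f x) * (deriv expNegInvGlue w / r x ^ 2 / profileSlope (η (f x)) (r x)) *
          fderivWithin ℝ f s x v) = profileSlope (η (f x)) (r x) * fderivWithin ℝ r s x v -
        deriv η (f x) * (deriv expNegInvGlue w / r x ^ 2) * fderivWithin ℝ f s x v := by
      field_simp
    rw [h6, h5]
    field_simp
    ring

/-- Where `η ∘ f ≤ r` the conformal factor vanishes to first order. -/
theorem fderivWithin_profile_of_le {E : Type*} [NormedAddCommGroup E] [NormedSpace ℝ E] {f r : E → ℝ}
    {s : Set E} {x : E} {η : ℝ → ℝ} (hle : η (f x) ≤ r x)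
    (hη : DifferentiableAt ℝ η (f x))
    (hf : DifferentiableWithinAt ℝ f s x) (hr : DifferentiableWithinAt ℝ r s x) (hx : 0 < r x)
    (hs : UniqueDiffWithinAt ℝ s x) :
    fderivWithin ℝ (fun y => profile (η (f y)) (r y)) s x = 0 := by
  set w := η (f x) - r x with hw
  have hw0 : w ≤ 0 := sub_nonpos.2 hle
  have h1 : HasFDerivWithinAt (fun y => η (f y) - r y)
      (deriv η (f x) • fderivWithin ℝ f s x - fderivWithin ℝ r s x) s x :=
    (hη.hasDerivAt.comp_hasFDerivWithinAt x hf.hasFDerivWithinAt).sub hr.hasFDerivWithinAt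
  have h2 : HasFDerivWithinAt (fun y => expNegInvGlue (η (f y) - r y))
      ((0 : ℝ) • (deriv η (f x) • fderivWithin ℝ f s x - fderivWithin ℝ r s x)) s x := by
    have h : HasDerivAt expNegInvGlue 0 (η (f x) - r x) := by
      have := ((expNegInvGlue.contDiff (n := ⊤)).differentiable (by simp) w).hasDerivAt
      rwa [deriv_expNegInvGlue_of_nonpos hw0] at this
    exact h.comp_hasFDerivWithinAt x h1
  have h3 : DifferentiableWithinAt ℝ (fun y => (r y ^ 2)⁻¹) s x :=
    (hr.pow 2).inv (pow_ne_zero 2 hx.ne')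
  have h4 : fderivWithin ℝ (fun y => profile (η (f y)) (r y)) s x = _ :=
    (h2.mul h3.hasFDerivWithinAt).fderivWithin hs
  rw [h4, expNegInvGlue.zero_of_nonpos hw0]
  simp

/-! ### Adding an exact form -/

section Exact

variable {E : Type*} [NormedAddCommGroup E] [NormedSpace ℝ E] [FiniteDimensional ℝ E]
  {H : Type*} [TopologicalSpace H] {I : ModelWithCorners ℝ E H}
  {M : Type*} [TopologicalSpace M] [ChartedSpace H M] [IsManifold I ∞ M] {k : ℕ}
  {Ω : DiffForm I M 2} {a : DiffForm I M 1} {F : M → ℝ}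

/-- The form `Ω + d(F a)`. -/
def addExact (Ω : DiffForm I M 2) (F : M → ℝ) (a : DiffForm I M 1) : DiffForm I M 2 :=
  fun p => Ω p + (DiffForm.mulFun F a).d p

theorem addExact_apply (ha : ∀ p, a.SmoothAt p) {p : M} (hF : ContMDiffAt I 𝓘(ℝ, ℝ) ∞ F p)
    (u v : E) : (addExact Ω F a).val p ![u, v] = Ω.val p ![u, v] +
      (F p * a.d.val p ![u, v] + (modelDeriv I 𝓘(ℝ, ℝ) F p u * a.val p ![v] -
        modelDeriv I 𝓘(ℝ, ℝ) F p v * a.val p ![u])) := by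
  change Ω.val p ![u, v] + (DiffForm.mulFun F a).d.val p ![u, v] = _
  have hx : extChartAt I p p ∈ Set.range I := by simp [extChartAt]
  have h1 := contDiffWithinAt_comp_extChartAt_symm (mem_extChartAt_source p) hF
  have h2 := ha p p (mem_extChartAt_source p)
  have h3 := extDerivWithin_fun_smul_oneForm (h1.differentiableWithinAt (by simp))
    (h2.differentiableWithinAt (by simp)) (I.uniqueDiffOn _ hx) u v
  have hpp := extChartAt_to_inv (I := I) p
  have h4 := fun v => fderivWithin_comp_chart_symm (f := F) (mem_extChartAt_target (I := I) p)
    (by rw [hpp]; exact hF.mdifferentiableAt (by simp)) v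
  simp only [hpp, chartFrame_self] at h4
  rw [DiffForm.inChart_self, h4, h4, hpp, ← DiffForm.d_val] at h3
  rw [DiffForm.d_val]
  exact congrArg _ h3

theorem DiffForm.d_d {Ω : DiffForm I M k} {p : M} (h : ∀ᶠ q in 𝓝 p, Ω.SmoothAt q) :
    Ω.d.d.val p = 0 := by
  have hx : extChartAt I p p ∈ Set.range I := by simp [extChartAt]
  have h2 : Filter.Tendsto (extChartAt I p).symm (𝓝[Set.range I] (extChartAt I p p)) (𝓝 p) := by
    have := (continuousAt_extChartAt_symm (I := I) p).tendsto.mono_left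
      (nhdsWithin_le_nhds (s := Set.range I))
    rwa [extChartAt_to_inv] at this
  have h3 : Ω.d.inChart p =ᶠ[𝓝[Set.range I] (extChartAt I p p)]
      extDerivWithin (Ω.inChart p) (Set.range I) := by
    filter_upwards [h2.eventually h, extChartAt_target_mem_nhdsWithin p] with y hy hyt
    exact DiffForm.inChart_d hyt hy
  rw [DiffForm.d_val, h3.extDerivWithin_eq_of_mem hx]
  exact extDerivWithin_extDerivWithin_apply (h.self_of_nhds p (mem_extChartAt_source p))
    (by rw [minSmoothness_of_isRCLikeNormedField]; exact WithTop.coe_le_coe.2 le_top)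
    I.uniqueDiffOn (I.range_subset_closure_interior hx) hx

theorem addExact_closed (hΩ : ∀ p, Ω.SmoothAt p) (hd : ∀ p, Ω.d.val p = 0)
    (ha : ∀ p, a.SmoothAt p) {p : M} (hF : ∀ᶠ q in 𝓝 p, ContMDiffAt I 𝓘(ℝ, ℝ) ∞ F q) :
    (addExact Ω F a).d.val p = 0 := by
  have hx : extChartAt I p p ∈ Set.range I := by simp [extChartAt]
  have hs : ∀ᶠ q in 𝓝 p, (DiffForm.mulFun F a).SmoothAt q :=
    hF.mono fun q hq => DiffForm.SmoothAt.mulFun hq fun _ => ha q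
  have h1 : (addExact Ω F a).inChart p = Ω.inChart p + (DiffForm.mulFun F a).d.inChart p := rfl
  rw [DiffForm.d_val, h1, extDerivWithin_add (I.uniqueDiffOn _ hx)
    ((hΩ p p (mem_extChartAt_source p)).differentiableWithinAt (by simp))
    ((DiffForm.SmoothAt.d hs p (mem_extChartAt_source p)).differentiableWithinAt
      (by simp)), ← DiffForm.d_val, ← DiffForm.d_val, hd, DiffForm.d_d hs, add_zero]

end Exact

/-! ### Nondegeneracy on the interior -/

section Radius

variable {E : Type*} [NormedAddCommGroup E] [NormedSpace ℝ E] [FiniteDimensional ℝ E]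
  {H : Type*} [TopologicalSpace H] {I : ModelWithCorners ℝ E H}
  {M : Type*} [TopologicalSpace M] [ChartedSpace H M] [IsManifold I ∞ M]
  {Ω : DiffForm I M 2} {a : DiffForm I M 1} {ρ φ : M → ℝ} {δ δ' : ℝ} {p : M}

/-- The form `Ω + s da + g a ∧ (dρ - t dφ)` is nondegenerate at `p` if `|t|` and the quotient `s / g`
are at most `δ`. -/
def TwistRadius (Ω : DiffForm I M 2) (a : DiffForm I M 1) (ρ φ : M → ℝ) (δ : ℝ) (p : M) : Prop :=
  ∀ t s g : ℝ, |t| ≤ δ → 0 ≤ s → 0 < g → s ≤ δ * g →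
    TwistNondegenerate (Ω.val p) (a.d.val p) (a.val p)
      (modelDeriv I 𝓘(ℝ, ℝ) ρ p - t • modelDeriv I 𝓘(ℝ, ℝ) φ p) s g

theorem TwistRadius.mono (h : TwistRadius Ω a ρ φ δ p) (hle : δ' ≤ δ) :
    TwistRadius Ω a ρ φ δ' p := fun t s g ht hs hg hsg =>
  h t s g (ht.trans hle) hs hg (hsg.trans (mul_le_mul_of_nonneg_right hle hg.le))

/-- Near a point with the linear algebra data of a boundary point of a weak filling, there is a
uniform twist radius. -/
theorem exists_twistRadius_near (hΩ : Ω.SmoothAt p) (ha : ∀ q, a.SmoothAt q)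
    (hρ : ContMDiff I 𝓘(ℝ, ℝ) ∞ ρ) (hφ : ContMDiff I 𝓘(ℝ, ℝ) ∞ φ)
    (hnd : NondegenerateOn (Ω.val p) Set.univ) {R ν : E}
    (hR : ∀ v, Ω.val p ![R, v] = modelDeriv I 𝓘(ℝ, ℝ) ρ p v) (haR : 0 < a.val p ![R])
    (hν : modelDeriv I 𝓘(ℝ, ℝ) ρ p ν ≠ 0)
    (hξ : ∀ s : ℝ, 0 ≤ s → NondegenerateOn (Ω.val p + s • a.d.val p)
      {u | a.val p ![u] = 0 ∧ modelDeriv I 𝓘(ℝ, ℝ) ρ p u = 0})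
    (hA : NondegenerateOn (a.d.val p) {u | a.val p ![u] = 0 ∧ modelDeriv I 𝓘(ℝ, ℝ) ρ p u = 0}) :
    ∃ δ > 0, ∀ᶠ q in 𝓝 p, TwistRadius Ω a ρ φ δ q := by
  obtain ⟨δ, hδ, hev⟩ := eventually_twistNondegenerate hnd hR haR hν hξ hA
  set y := extChartAt I p p with hy
  have hx : y ∈ Set.range I := by simp [hy, extChartAt]
  have hps := mem_extChartAt_source (I := I) p
  let dc : (M → ℝ) → E → E →L[ℝ] ℝ := fun f =>
    fderivWithin ℝ (fun y => f ((extChartAt I p).symm y)) (Set.range I)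
  have hdc : ∀ f, ContMDiff I 𝓘(ℝ, ℝ) ∞ f →
      Filter.Tendsto (dc f) (𝓝[Set.range I] y) (𝓝 (modelDeriv I 𝓘(ℝ, ℝ) f p)) := by
    intro f hf
    have h1 := contDiffWithinAt_comp_extChartAt_symm hps hf.contMDiffAt
    have h2 : ContDiffWithinAt ℝ ∞ (dc f) (Set.range I) y :=
      h1.fderivWithin_right I.uniqueDiffOn (by simp) hx
    have h3 := h2.continuousWithinAt.tendsto
    have h4 : dc f y = modelDeriv I 𝓘(ℝ, ℝ) f p := by
      ext v
      have := fderivWithin_comp_chart_symm (f := f) (mem_extChartAt_target (I := I) p)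
        (hf.mdifferentiable (by simp) _) v
      rw [chartFrame_self, extChartAt_to_inv] at this
      exact this
    rwa [h4] at h3
  have hform : ∀ {k : ℕ} (Θ : DiffForm I M k), Θ.SmoothAt p →
      Filter.Tendsto (Θ.inChart p) (𝓝[Set.range I] y) (𝓝 (Θ.val p)) := by
    intro k Θ h
    have := (h p hps).continuousWithinAt.tendsto
    rwa [DiffForm.inChart_self] at this
  have hT : Filter.Tendsto (fun x : E × ℝ => (Ω.inChart p x.1, a.d.inChart p x.1, a.inChart p x.1,
      dc ρ x.1 - x.2 • dc φ x.1)) (𝓝[Set.range I] y ×ˢ 𝓝 0)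
      (𝓝 (Ω.val p, a.d.val p, a.val p, modelDeriv I 𝓘(ℝ, ℝ) ρ p)) := by
    have h1 := Filter.tendsto_fst (f := 𝓝[Set.range I] y) (g := 𝓝 (0 : ℝ))
    have h2 := Filter.tendsto_snd (f := 𝓝[Set.range I] y) (g := 𝓝 (0 : ℝ))
    have h3 : Filter.Tendsto (fun x : E × ℝ => dc ρ x.1 - x.2 • dc φ x.1)
        (𝓝[Set.range I] y ×ˢ 𝓝 0) (𝓝 (modelDeriv I 𝓘(ℝ, ℝ) ρ p)) := by
      have := ((hdc ρ hρ).comp h1).sub (h2.smul ((hdc φ hφ).comp h1))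
      simpa using! this
    exact ((hform Ω hΩ).comp h1).prodMk_nhds (((hform a.d (DiffForm.SmoothAt.d
      (Filter.Eventually.of_forall ha))).comp h1).prodMk_nhds
      (((hform a (ha p)).comp h1).prodMk_nhds h3))
  obtain ⟨P, hP, Q, hQ, hPQ⟩ := Filter.eventually_prod_iff.1 (hT.eventually hev)
  obtain ⟨ε, hε, hεQ⟩ := Metric.eventually_nhds_iff.1 hQ
  refine ⟨min δ (ε / 2), lt_min hδ (half_pos hε), ?_⟩
  have h1 : Filter.Tendsto (extChartAt I p) (𝓝 p) (𝓝[Set.range I] y) :=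
    tendsto_nhdsWithin_iff.2 ⟨(continuousAt_extChartAt (I := I) p).tendsto,
      Filter.Eventually.of_forall fun q => by simp [extChartAt]⟩
  filter_upwards [h1.eventually hP, extChartAt_source_mem_nhds (I := I) p] with q hq hqs t s g ht hs
    hg hsg
  have h2 := hPQ hq (hεQ (y := t) (by
    rw [Real.dist_eq, sub_zero]
    exact (ht.trans (min_le_right _ _)).trans_lt (half_lt_self hε))) s g hs hg
    (hsg.trans (mul_le_mul_of_nonneg_right (min_le_left _ _) hg.le))
  have hqt := (extChartAt I p).map_source hqs
  have hqq : (extChartAt I p).symm (extChartAt I p q) = q := (extChartAt I p).left_inv hqs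
  have h3 : ∀ f, ContMDiff I 𝓘(ℝ, ℝ) ∞ f → ∀ v, dc f (extChartAt I p q) v =
      modelDeriv I 𝓘(ℝ, ℝ) f q (chartFrame I p (extChartAt I p q) v) := by
    intro f hf v
    have := fderivWithin_comp_chart_symm (f := f) hqt (hf.mdifferentiable (by simp) _) v
    rwa [hqq] at this
  simp only [DiffForm.inChart_eq, hqq] at h2
  refine TwistNondegenerate.of_comp (chartFrame_bijective hqt).2 (fun v => ?_) h2
  simp only [sub_apply, smul_apply, h3 ρ hρ, h3 φ hφ]

/-- A twist radius that is uniform on a compact set. -/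
theorem exists_twistRadius_compact (hρ : Continuous ρ) (hρ0 : ∀ p, 0 ≤ ρ p)
    (h : ∀ p, ρ p = 0 → ∃ δ > 0, ∀ᶠ q in 𝓝 p, TwistRadius Ω a ρ φ δ q) {K : Set M}
    (hK : IsCompact K) : ∃ δ > 0, ∀ q ∈ K, ρ q < δ → TwistRadius Ω a ρ φ δ q := by
  refine hK.induction_on (p := fun s => ∃ δ > 0, ∀ q ∈ s, ρ q < δ → TwistRadius Ω a ρ φ δ q)
    ⟨1, one_pos, by simp⟩ ?_ ?_ ?_
  · rintro s t hst ⟨δ, hδ, hs⟩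
    exact ⟨δ, hδ, fun q hq => hs q (hst hq)⟩
  · rintro s t ⟨δ, hδ, hs⟩ ⟨δ', hδ', ht⟩
    refine ⟨min δ δ', lt_min hδ hδ', ?_⟩
    rintro q (hq | hq) hlt
    · exact (hs q hq (hlt.trans_le (min_le_left _ _))).mono (min_le_left _ _)
    · exact (ht q hq (hlt.trans_le (min_le_right _ _))).mono (min_le_right _ _)
  · intro p _
    rcases (hρ0 p).eq_or_lt with hp | hp
    · obtain ⟨δ, hδ, hev⟩ := h p hp.symm
      exact ⟨_, nhdsWithin_le_nhds hev, δ, hδ, fun q hq _ => hq⟩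
    · refine ⟨{q | ρ p / 2 < ρ q}, nhdsWithin_le_nhds
        (hρ.continuousAt.eventually (lt_mem_nhds (half_lt_self hp))), ρ p / 2, half_pos hp, ?_⟩
      intro q hq hlt
      exact absurd hlt (not_lt.2 (le_of_lt hq))

/-- The function `profile (η ∘ φ) ρ` on the manifold. -/
def conformalFactor (η : ℝ → ℝ) (φ ρ : M → ℝ) : M → ℝ := fun p => profile (η (φ p)) (ρ p)

theorem contMDiffAt_conformalFactor {η : ℝ → ℝ} (hη : ContDiff ℝ ∞ η)
    (hρ : ContMDiff I 𝓘(ℝ, ℝ) ∞ ρ) (hφ : ContMDiff I 𝓘(ℝ, ℝ) ∞ φ) (hp : 0 < ρ p) :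
    ContMDiffAt I 𝓘(ℝ, ℝ) ∞ (conformalFactor η φ ρ) p := by
  have h1 : ContMDiff I 𝓘(ℝ, ℝ) ∞ fun p => expNegInvGlue (η (φ p) - ρ p) :=
    (expNegInvGlue.contDiff (n := ⊤)).contMDiff.comp ((hη.contMDiff.comp hφ).sub hρ)
  have h2 : ContDiffAt ℝ ∞ (fun r : ℝ => (r ^ 2)⁻¹) (ρ p) :=
    (contDiff_id.pow 2).contDiffAt.inv (pow_ne_zero 2 hp.ne')
  exact h1.contMDiffAt.mul (h2.contMDiffAt.comp p hρ.contMDiffAt)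

/-- The form `Ω + d(F a)` is nondegenerate at a point off the boundary with a large enough twist
radius. -/
theorem addExact_nondegenerate {η : ℝ → ℝ} (hη : ContDiff ℝ ∞ η)
    (hρ : ContMDiff I 𝓘(ℝ, ℝ) ∞ ρ) (hφ : ContMDiff I 𝓘(ℝ, ℝ) ∞ φ) (ha : ∀ q, a.SmoothAt q)
    (hnd : NondegenerateOn (Ω.val p) Set.univ) (hp : 0 < ρ p)
    (hηδ : η (φ p) ≤ δ) (hη'δ : |deriv η (φ p)| ≤ δ)
    (h : ρ p < δ → TwistRadius Ω a ρ φ δ p) :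
    NondegenerateOn ((addExact Ω (conformalFactor η φ ρ) a).val p) Set.univ := by
  have hF := contMDiffAt_conformalFactor hη hρ hφ hp
  set y := extChartAt I p p with hy
  have hx : y ∈ Set.range I := by simp [hy, extChartAt]
  have hpp : (extChartAt I p).symm y = p := extChartAt_to_inv p
  have hdiff : ∀ f : M → ℝ, ContMDiffAt I 𝓘(ℝ, ℝ) ∞ f p →
      DifferentiableWithinAt ℝ (fun y => f ((extChartAt I p).symm y)) (Set.range I) y ∧
      ∀ v, modelDeriv I 𝓘(ℝ, ℝ) f p v =
        fderivWithin ℝ (fun y => f ((extChartAt I p).symm y)) (Set.range I) y v := by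
    intro f hf
    refine ⟨(contDiffWithinAt_comp_extChartAt_symm (mem_extChartAt_source p) hf
      ).differentiableWithinAt (by simp), fun v => ?_⟩
    have := fderivWithin_comp_chart_symm (f := f) (mem_extChartAt_target (I := I) p)
      (by rw [hpp]; exact hf.mdifferentiableAt (by simp)) v
    rw [chartFrame_self, hpp] at this
    exact this.symm
  obtain ⟨hρd, hρv⟩ := hdiff ρ hρ.contMDiffAt
  obtain ⟨hφd, hφv⟩ := hdiff φ hφ.contMDiffAt
  obtain ⟨-, hFv⟩ := hdiff _ hF
  have hu := I.uniqueDiffOn y hx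
  have hηd : DifferentiableAt ℝ η (φ ((extChartAt I p).symm y)) :=
    hη.differentiable (by simp) _
  intro u _ hu0
  rcases lt_or_ge (ρ p) (η (φ p)) with hlt | hle
  · obtain ⟨t, ht, hdF⟩ := fderivWithin_profile (f := fun y => φ ((extChartAt I p).symm y))
      (r := fun y => ρ ((extChartAt I p).symm y)) (x := y) (η := η) hηd hφd hρd (by rw [hpp]; exact hp) hu
      (by rw [hpp]; exact hlt)
    rw [hpp] at ht hdF
    refine h (hlt.trans_le hηδ) t (profile (η (φ p)) (ρ p)) (profileSlope (η (φ p)) (ρ p))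
      (ht.trans hη'δ) (profile_nonneg _ _) (profileSlope_pos hp hlt)
      (profile_le_mul_slope hp (hlt.le.trans hηδ)) u fun v => ?_
    rw [← hu0 v trivial, addExact_apply ha hF, hFv, hFv]
    simp only [sub_apply, smul_apply, hρv, hφv, smul_eq_mul]
    simp only [conformalFactor, hdF]
    ring
  · refine hnd u trivial fun v _ => ?_
    have hdF := fderivWithin_profile_of_le (f := fun y => φ ((extChartAt I p).symm y))
      (r := fun y => ρ ((extChartAt I p).symm y)) (x := y) (η := η) (by rw [hpp]; exact hle) hηd hφd hρd
      (by rw [hpp]; exact hp) hu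
    have hF0 : conformalFactor η φ ρ p = 0 := by
      rw [conformalFactor, profile, expNegInvGlue.zero_of_nonpos (sub_nonpos.2 hle), zero_div]
    have := hu0 v trivial
    rw [addExact_apply ha hF, hFv, hFv, hF0] at this
    simp only [conformalFactor, hdF] at this
    simpa using this

end Radius

/-! ### Scattering coefficients -/

section Wedge

variable {E : Type*} [NormedAddCommGroup E] [NormedSpace ℝ E]

/-- The exterior product `θ ∧ b` of a linear form and a `1`-form. -/
def wedgeOne (θ : E →L[ℝ] ℝ) (b : E [⋀^Fin 1]→L[ℝ] ℝ) : E [⋀^Fin 2]→L[ℝ] ℝ :=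
  ContinuousAlternatingMap.alternatizeUncurryFinCLM ℝ E ℝ (θ.smulRight b)

theorem wedgeOne_apply (θ : E →L[ℝ] ℝ) (b : E [⋀^Fin 1]→L[ℝ] ℝ) (u v : E) :
    wedgeOne θ b ![u, v] = θ u * b ![v] - θ v * b ![u] := by
  have e1 : ∀ f : E [⋀^Fin 1]→L[ℝ] ℝ, f ((1 : Fin 2).removeNth ![u, v]) = f ![u] := fun f => by
    congr 1; ext i; fin_cases i; rfl
  rw [wedgeOne, ContinuousAlternatingMap.alternatizeUncurryFinCLM_apply]
  simp only [ContinuousAlternatingMap.alternatizeUncurryFin_apply]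
  rw [Fin.sum_univ_two]
  -- `erw` because the index type is `Fin (1 + 1)`
  erw [e1]
  simp
  ring

theorem contDiffWithinAt_wedgeOne [FiniteDimensional ℝ E] {X : Type*} [NormedAddCommGroup X]
    [NormedSpace ℝ X] {f : X → E [⋀^Fin 1]→L[ℝ] ℝ} {s : Set X} {x : X} (θ : E →L[ℝ] ℝ)
    (hf : ContDiffWithinAt ℝ ∞ f s x) : ContDiffWithinAt ℝ ∞ (fun x => wedgeOne θ (f x)) s x := by
  refine contDiffWithinAt_of_apply fun w => ?_
  have hw : w = ![w 0, w 1] := by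
    ext i; fin_cases i <;> rfl
  rw [hw]
  simp only [wedgeOne_apply]
  have h : ∀ v, ContDiffWithinAt ℝ ∞ (fun x => f x ![v]) s x := fun v =>
    contDiffWithinAt_apply (w := fun _ => ![v]) hf fun _ => contDiffWithinAt_const
  exact (contDiffWithinAt_const.mul (h _)).sub (contDiffWithinAt_const.mul (h _))

end Wedge

section Frame

variable {m : ℕ}

/-- The differential of the transverse coordinate of the half-space. -/
def transverseForm (m : ℕ) : EuclideanSpace ℝ (Fin (2 * m + 2)) →L[ℝ] ℝ :=
  EuclideanSpace.proj (0 : Fin (2 * m + 2))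

@[simp] theorem transverseForm_apply (v : EuclideanSpace ℝ (Fin (2 * m + 2))) :
    transverseForm m v = v 0 := rfl

/-- The scattering frame divided by the transverse coordinate `x`, that is, the frame
`x ∂ₓ, ∂_{y₁}, …, ∂_{yₙ}`. -/
def bFrame (q : EuclideanSpace ℝ (Fin (2 * m + 2))) :
    EuclideanSpace ℝ (Fin (2 * m + 2)) →L[ℝ] EuclideanSpace ℝ (Fin (2 * m + 2)) :=
  ContinuousLinearMap.id ℝ _ + (q 0 - 1) • (transverseForm m).smulRight (transverseVector m)

theorem bFrame_apply (q v : EuclideanSpace ℝ (Fin (2 * m + 2))) :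
    bFrame q v = v + ((q 0 - 1) * v 0) • transverseVector m := by
  simp [bFrame, mul_smul]

theorem scFrame_eq (q v : EuclideanSpace ℝ (Fin (2 * m + 2))) : scFrame q v = q 0 • bFrame q v := by
  rw [bFrame_apply, smul_add, smul_smul]
  simp only [scFrame, add_apply, smul_apply,
    ContinuousLinearMap.id_apply, ContinuousLinearMap.smulRight_apply, smul_smul]
  congr 2
  change (q 0 ^ 2 - q 0) * v 0 = _
  ring

theorem bFrame_zero_apply (q v : EuclideanSpace ℝ (Fin (2 * m + 2))) :
    (bFrame q v) 0 = q 0 * v 0 := by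
  rw [bFrame_apply]
  simp [transverseVector]
  ring

theorem bFrame_of_tangent (q : EuclideanSpace ℝ (Fin (2 * m + 2)))
    {v : EuclideanSpace ℝ (Fin (2 * m + 2))} (hv : v 0 = 0) : bFrame q v = v := by
  rw [bFrame_apply, hv, mul_zero, zero_smul, add_zero]

theorem bFrame_transverse {q : EuclideanSpace ℝ (Fin (2 * m + 2))} (hq : q 0 = 0) :
    bFrame q (transverseVector m) = 0 := by
  rw [bFrame_apply, hq]
  simp [transverseVector]

theorem scFrame_bijective {q : EuclideanSpace ℝ (Fin (2 * m + 2))} (hq : 0 < q 0) :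
    Function.Bijective (scFrame q) := by
  have hinj : Function.Injective (scFrame q) := by
    refine (injective_iff_map_eq_zero _).2 fun v hv => ?_
    rw [scFrame_eq, smul_eq_zero, or_iff_right hq.ne'] at hv
    have h0 : v 0 = 0 := by
      have := bFrame_zero_apply q v
      rw [hv, PiLp.zero_apply] at this
      exact (mul_eq_zero.1 this.symm).resolve_left hq.ne'
    rwa [bFrame_of_tangent q h0] at hv
  exact ⟨hinj, (LinearMap.injective_iff_surjective (f := (scFrame q).toLinearMap)).1 hinj⟩

theorem contDiff_bFrame : ContDiff ℝ ∞ (bFrame (m := m)) := by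
  have h : ContDiff ℝ ∞ fun q : EuclideanSpace ℝ (Fin (2 * m + 2)) => q 0 - 1 :=
    (transverseForm m).contDiff.sub contDiff_const
  exact contDiff_const.add (h.smul contDiff_const)

/-- The coefficient, with respect to the scattering frame, of the form `Θ + d(B / x²)`. Written in
this way it makes sense up to the boundary `x = 0`. -/
def scCoeff (Θ : EuclideanSpace ℝ (Fin (2 * m + 2)) →
      EuclideanSpace ℝ (Fin (2 * m + 2)) [⋀^Fin 2]→L[ℝ] ℝ)
    (B : EuclideanSpace ℝ (Fin (2 * m + 2)) →
      EuclideanSpace ℝ (Fin (2 * m + 2)) [⋀^Fin 1]→L[ℝ] ℝ)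
    (q : EuclideanSpace ℝ (Fin (2 * m + 2))) :
    EuclideanSpace ℝ (Fin (2 * m + 2)) [⋀^Fin 2]→L[ℝ] ℝ :=
  (q 0) ^ 2 • (Θ q).compContinuousLinearMap (bFrame q) +
    (extDerivWithin B (Set.range (𝓡∂ (2 * m + 2))) q).compContinuousLinearMap (bFrame q) -
    (2 : ℝ) • wedgeOne (transverseForm m) ((B q).compContinuousLinearMap (bFrame q))

variable {Θ : EuclideanSpace ℝ (Fin (2 * m + 2)) →
      EuclideanSpace ℝ (Fin (2 * m + 2)) [⋀^Fin 2]→L[ℝ] ℝ}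
    {B : EuclideanSpace ℝ (Fin (2 * m + 2)) →
      EuclideanSpace ℝ (Fin (2 * m + 2)) [⋀^Fin 1]→L[ℝ] ℝ}
    {q : EuclideanSpace ℝ (Fin (2 * m + 2))}

theorem scCoeff_apply (u v : EuclideanSpace ℝ (Fin (2 * m + 2))) :
    scCoeff Θ B q ![u, v] = (q 0) ^ 2 * Θ q ![bFrame q u, bFrame q v] +
      extDerivWithin B (Set.range (𝓡∂ (2 * m + 2))) q ![bFrame q u, bFrame q v] -
      2 * (u 0 * B q ![bFrame q v] - v 0 * B q ![bFrame q u]) := by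
  simp only [scCoeff, ContinuousAlternatingMap.sub_apply, ContinuousAlternatingMap.add_apply,
    ContinuousAlternatingMap.smul_apply, comp_two, wedgeOne_apply, comp_one, smul_eq_mul,
    transverseForm_apply]
  congr 2
  exact comp_two _ _ u v

theorem contDiffWithinAt_scCoeff
    (hΘ : ContDiffWithinAt ℝ ∞ Θ (Set.range (𝓡∂ (2 * m + 2))) q)
    (hB : ContDiffWithinAt ℝ ∞ B (Set.range (𝓡∂ (2 * m + 2))) q)
    (hq : q ∈ Set.range (𝓡∂ (2 * m + 2))) :
    ContDiffWithinAt ℝ ∞ (scCoeff Θ B) (Set.range (𝓡∂ (2 * m + 2))) q := by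
  have hP := (contDiff_bFrame (m := m)).contDiffWithinAt
    (s := Set.range (𝓡∂ (2 * m + 2))) (x := q)
  have h1 := contDiffWithinAt_compContinuousLinearMap hΘ hP
  have h2 := contDiffWithinAt_compContinuousLinearMap (contDiffWithinAt_extDerivWithin hB
    (𝓡∂ (2 * m + 2)).uniqueDiffOn hq) hP
  have h3 := contDiffWithinAt_wedgeOne (transverseForm m)
    (contDiffWithinAt_compContinuousLinearMap hB hP)
  have h0 : ContDiff ℝ ∞ fun q : EuclideanSpace ℝ (Fin (2 * m + 2)) => (q 0) ^ 2 :=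
    (transverseForm m).contDiff.pow 2
  exact ((h0.contDiffWithinAt.smul h1).add h2).sub ((contDiffWithinAt_const (c := (2 : ℝ))).smul h3)

theorem alternating_ext_two {V : Type*} [NormedAddCommGroup V] [NormedSpace ℝ V]
    {f g : V [⋀^Fin 2]→L[ℝ] ℝ} (h : ∀ u v, f ![u, v] = g ![u, v]) : f = g := by
  ext w
  have : w = ![w 0, w 1] := by
    ext i; fin_cases i <;> rfl
  rw [this]
  exact h _ _

/-- Off the boundary, `scCoeff Θ B` is the coefficient of `Θ + d(B / x²)`. -/
theorem scCoeff_eq (hB : DifferentiableWithinAt ℝ B (Set.range (𝓡∂ (2 * m + 2))) q)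
    (hq : q ∈ Set.range (𝓡∂ (2 * m + 2))) (hq0 : 0 < q 0) :
    scCoeff Θ B q = (Θ q + extDerivWithin
      (fun y : EuclideanSpace ℝ (Fin (2 * m + 2)) => ((y 0) ^ 2)⁻¹ • B y)
      (Set.range (𝓡∂ (2 * m + 2))) q).compContinuousLinearMap (scFrame q) := by
  have h1 : HasFDerivWithinAt (fun y : EuclideanSpace ℝ (Fin (2 * m + 2)) => ((y 0) ^ 2)⁻¹)
      ((-(2 * q 0) / (q 0 ^ 2) ^ 2) • transverseForm m) (Set.range (𝓡∂ (2 * m + 2))) q := by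
    have h : HasDerivAt (fun r : ℝ => (r ^ 2)⁻¹) (-(2 * q 0) / (q 0 ^ 2) ^ 2) (q 0) := by
      have := (hasDerivAt_pow 2 (q 0)).inv (by positivity)
      simpa using! this
    exact HasDerivAt.comp_hasFDerivWithinAt (h₂ := fun r : ℝ => (r ^ 2)⁻¹) (f := transverseForm m)
      q h (transverseForm m).hasFDerivWithinAt
  have hu := (𝓡∂ (2 * m + 2)).uniqueDiffOn q hq
  refine alternating_ext_two fun u v => ?_
  have h2 : ∀ f : EuclideanSpace ℝ (Fin (2 * m + 2)) [⋀^Fin 2]→L[ℝ] ℝ,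
      f ![scFrame q u, scFrame q v] = q 0 ^ 2 * f ![bFrame q u, bFrame q v] := by
    intro f
    rw [scFrame_eq, scFrame_eq, ← bilin_apply, ← bilin_apply]
    simp only [map_smul, LinearMap.smul_apply, smul_eq_mul]
    ring
  rw [comp_two, h2, ContinuousAlternatingMap.add_apply, extDerivWithin_fun_smul_oneForm
    h1.differentiableWithinAt hB hu, h1.fderivWithin hu, scCoeff_apply]
  simp only [smul_apply, transverseForm_apply, bFrame_zero_apply, smul_eq_mul]
  field_simp
  ring

/-- At a boundary point, the coefficient of `Θ + d(f b / x²)` is nondegenerate if `f > 0` and `b` is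
a contact form on the boundary. -/
theorem scCoeff_nondegenerate_boundary {f : EuclideanSpace ℝ (Fin (2 * m + 2)) → ℝ}
    {b : EuclideanSpace ℝ (Fin (2 * m + 2)) →
      EuclideanSpace ℝ (Fin (2 * m + 2)) [⋀^Fin 1]→L[ℝ] ℝ}
    (hf : DifferentiableWithinAt ℝ f (Set.range (𝓡∂ (2 * m + 2))) q)
    (hb : DifferentiableWithinAt ℝ b (Set.range (𝓡∂ (2 * m + 2))) q)
    (hq : q ∈ Set.range (𝓡∂ (2 * m + 2))) (hq0 : q 0 = 0) (hfq : 0 < f q)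
    {R : EuclideanSpace ℝ (Fin (2 * m + 2))} (hR0 : R 0 = 0) (hR : b q ![R] ≠ 0)
    (hnd : NondegenerateOn (extDerivWithin b (Set.range (𝓡∂ (2 * m + 2))) q)
      {u | b q ![u] = 0 ∧ u 0 = 0}) :
    NondegenerateOn (scCoeff Θ (fun y => f y • b y) q) Set.univ := by
  intro u _ hu
  have hval : ∀ v, f q * extDerivWithin b (Set.range (𝓡∂ (2 * m + 2))) q
      ![bFrame q u, bFrame q v] +
      (fderivWithin ℝ f (Set.range (𝓡∂ (2 * m + 2))) q (bFrame q u) * b q ![bFrame q v] -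
        fderivWithin ℝ f (Set.range (𝓡∂ (2 * m + 2))) q (bFrame q v) * b q ![bFrame q u]) -
      2 * (u 0 * (f q * b q ![bFrame q v]) - v 0 * (f q * b q ![bFrame q u])) = 0 := by
    intro v
    have h1 := hu v trivial
    rw [scCoeff_apply, extDerivWithin_fun_smul_oneForm hf hb ((𝓡∂ (2 * m + 2)).uniqueDiffOn q hq),
      hq0] at h1
    simpa only [ContinuousAlternatingMap.smul_apply, smul_eq_mul, ne_eq, OfNat.ofNat_ne_zero,
      not_false_eq_true, zero_pow, zero_mul, zero_add] using h1
  have hT : (transverseVector m) 0 = 1 := by simp [transverseVector]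
  have hz1 : ∀ B : EuclideanSpace ℝ (Fin (2 * m + 2)) [⋀^Fin 1]→L[ℝ] ℝ, B ![0] = 0 := fun B => by
    rw [← linForm_apply, map_zero]
  have hz2 : ∀ (B : EuclideanSpace ℝ (Fin (2 * m + 2)) [⋀^Fin 2]→L[ℝ] ℝ)
      (w : EuclideanSpace ℝ (Fin (2 * m + 2))), B ![w, 0] = 0 := fun B w => by
    rw [← bilin_apply, map_zero]
  -- the transverse vector detects the contact form
  have h1 : b q ![bFrame q u] = 0 := by
    have := hval (transverseVector m)
    rw [bFrame_transverse hq0, hz1, hz2, hT, map_zero] at this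
    have h2 : f q * b q ![bFrame q u] = 0 := by linarith
    exact (mul_eq_zero.1 h2).resolve_left hfq.ne'
  have h2 : bFrame q u = 0 := by
    refine hnd _ ⟨h1, by rw [bFrame_zero_apply, hq0, zero_mul]⟩ fun v hv => ?_
    have := hval v
    rw [bFrame_of_tangent q hv.2, hv.1, hv.2, h1] at this
    have h3 : f q * extDerivWithin b (Set.range (𝓡∂ (2 * m + 2))) q ![bFrame q u, v] = 0 := by
      linarith
    exact (mul_eq_zero.1 h3).resolve_left hfq.ne'
  have h3 : u 0 = 0 := by
    have := hval R
    rw [bFrame_of_tangent q hR0, h2, hR0, ← bilin_apply, map_zero, map_zero,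
      LinearMap.zero_apply, hz1] at this
    have h4 : u 0 * (f q * b q ![R]) = 0 := by linarith
    exact (mul_eq_zero.1 h4).resolve_right (mul_ne_zero hfq.ne' hR)
  rwa [bFrame_of_tangent q h3] at h2

theorem scCoeff_transverse (hq0 : q 0 = 0) {u : EuclideanSpace ℝ (Fin (2 * m + 2))}
    (hu : u 0 = 0) : scCoeff Θ B q ![u, transverseVector m] = 2 * B q ![u] := by
  have hT : (transverseVector m) 0 = 1 := by simp [transverseVector]
  rw [scCoeff_apply, bFrame_transverse hq0, bFrame_of_tangent q hu, hq0, hu, hT, ← bilin_apply,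
    ← bilin_apply, map_zero, map_zero, zero_mul]
  ring

end Frame

/-! ### The scattering form of a weak filling -/

theorem NondegenerateOn.comp_bijective {V U : Type*} [NormedAddCommGroup V] [NormedSpace ℝ V]
    [NormedAddCommGroup U] [NormedSpace ℝ U] {B : V [⋀^Fin 2]→L[ℝ] ℝ} {L : U →L[ℝ] V}
    (h : NondegenerateOn B Set.univ) (hL : Function.Bijective L) :
    NondegenerateOn (B.compContinuousLinearMap L) Set.univ := by
  intro u _ hu
  refine (map_eq_zero_iff L hL.1).1 (h (L u) trivial fun v _ => ?_)
  obtain ⟨v, rfl⟩ := hL.2 v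
  rw [← comp_two]
  exact hu v trivial

section Filling

variable {m : ℕ} {W : Type*} [TopologicalSpace W] [ChartedSpace (EuclideanHalfSpace (2 * m + 2)) W]
  [IsManifold (𝓡∂ (2 * m + 2)) ∞ W]
  {Z : Type*} [TopologicalSpace Z] [ChartedSpace (EuclideanSpace ℝ (Fin (2 * m + 1))) Z]
  [IsManifold (𝓡 (2 * m + 1)) ∞ Z]
  {ι : Z → W} {Ω : DiffForm (𝓡∂ (2 * m + 2)) W 2} {α : DiffForm (𝓡 (2 * m + 1)) Z 1}
  {a : DiffForm (𝓡∂ (2 * m + 2)) W 1} {ρ φ : W → ℝ} {η : ℝ → ℝ}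

/-- The scattering coefficients of the form `Ω + d(F a)`, with `F` the conformal factor: in a chart
`F = f / x²` with a function `f` that is smooth up to the boundary and positive there. -/
theorem exists_isScatteringCoeff (hΩ : Ω.IsSmooth) (ha : ∀ p, a.SmoothAt p)
    (hρ : IsBoundaryDefining (n := 2 * m + 2) ρ) (hφ : ContMDiff (𝓡∂ (2 * m + 2)) 𝓘(ℝ, ℝ) ∞ φ)
    (hη : ContDiff ℝ ∞ η) (hη0 : ∀ r, 0 < η r) (p₀ : W) :
    ∃ f : EuclideanSpace ℝ (Fin (2 * m + 2)) → ℝ,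
      (∀ y ∈ (extChartAt (𝓡∂ (2 * m + 2)) p₀).target,
        ContDiffWithinAt ℝ ∞ f (Set.range (𝓡∂ (2 * m + 2))) y) ∧
      (∀ y ∈ (extChartAt (𝓡∂ (2 * m + 2)) p₀).target, y 0 = 0 → 0 < f y) ∧
      IsScatteringCoeff (addExact Ω (conformalFactor η φ ρ) a) p₀
        (scCoeff (Ω.inChart p₀) fun y => f y • a.inChart p₀ y) := by
  obtain ⟨l, hl, hρl⟩ := hρ.in_chart p₀
  set e := extChartAt (𝓡∂ (2 * m + 2)) p₀ with he
  have hchart : ∀ {g : W → ℝ}, ContMDiff (𝓡∂ (2 * m + 2)) 𝓘(ℝ, ℝ) ∞ g → ∀ y ∈ e.target,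
      ContDiffWithinAt ℝ ∞ (fun y => g (e.symm y)) (Set.range (𝓡∂ (2 * m + 2))) y := by
    intro g hg y hy
    have := contDiffWithinAt_comp_extChartAt_symm (e.map_target hy) hg.contMDiffAt
    rwa [e.right_inv hy] at this
  let f : EuclideanSpace ℝ (Fin (2 * m + 2)) → ℝ := fun y =>
    expNegInvGlue (η (φ (e.symm y)) - ρ (e.symm y)) * (l y ^ 2)⁻¹
  have hnhds : ∀ y ∈ e.target, e.target ∈ 𝓝[Set.range (𝓡∂ (2 * m + 2))] y := fun y hy =>
    extChartAt_target_mem_nhdsWithin_of_mem hy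
  have hf : ∀ y ∈ e.target, ContDiffWithinAt ℝ ∞ f (Set.range (𝓡∂ (2 * m + 2))) y := by
    intro y hy
    have h1 := (hη.contDiffAt.comp_contDiffWithinAt y (hchart hφ y hy)).sub
      (hchart hρ.smooth y hy)
    have h2 := (expNegInvGlue.contDiff (n := ⊤)).contDiffAt.comp_contDiffWithinAt y h1
    have h3 := (hl y hy).mono_of_mem_nhdsWithin (hnhds y hy)
    exact h2.mul ((h3.pow 2).inv (pow_ne_zero 2 (hρl y hy).1.ne'))
  have ha' : ∀ y ∈ e.target, ContDiffWithinAt ℝ ∞ (a.inChart p₀) (Set.range (𝓡∂ (2 * m + 2))) y := fun y hy =>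
    DiffForm.SmoothAt.inChart hy (ha _)
  have hfa : ∀ y ∈ e.target, ContDiffWithinAt ℝ ∞ (fun y => f y • a.inChart p₀ y)
      (Set.range (𝓡∂ (2 * m + 2))) y := fun y hy => (hf y hy).smul (ha' y hy)
  refine ⟨f, hf, fun y hy hy0 => ?_, fun y hy => ?_, fun y hy hy0 => ?_⟩
  · have h1 : ρ (e.symm y) = 0 := by rw [(hρl y hy).2, hy0, zero_mul]
    have h2 := (hρl y hy).1
    have h3 : 0 < expNegInvGlue (η (φ (e.symm y)) - ρ (e.symm y)) :=
      expNegInvGlue.pos_of_pos (by rw [h1, sub_zero]; exact hη0 _)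
    positivity
  · exact (contDiffWithinAt_scCoeff (DiffForm.SmoothAt.inChart hy (hΩ.smoothAt _))
      (hfa y hy) (extChartAt_target_subset_range p₀ hy)).mono
      (extChartAt_target_subset_range p₀)
  · have hr := extChartAt_target_subset_range p₀ hy
    rw [scCoeff_eq ((hfa y hy).differentiableWithinAt (by simp)) hr hy0]
    congr 1
    have hpos : 0 < ρ (e.symm y) := by
      rw [(hρl y hy).2]
      exact mul_pos hy0 (hρl y hy).1
    have h1 : (addExact Ω (conformalFactor η φ ρ) a).inChart p₀ y = Ω.inChart p₀ y +
      (DiffForm.mulFun (conformalFactor η φ ρ) a).d.inChart p₀ y := rfl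
    rw [h1, DiffForm.inChart_d hy (DiffForm.SmoothAt.mulFun
      (contMDiffAt_conformalFactor hη hρ.smooth hφ hpos) fun _ => ha _)]
    congr 1
    refine (Filter.EventuallyEq.extDerivWithin_eq_of_mem ?_ hr).symm
    filter_upwards [hnhds y hy] with y' hy'
    rw [DiffForm.inChart_mulFun, smul_smul]
    congr 1
    change profile _ _ = _
    rw [profile, ← he, (hρl y' hy').2, mul_pow, div_eq_mul_inv, mul_inv]
    simp only [f, (hρl y' hy').2]
    ring

/-- The scattering coefficients of `Ω + d(F a)` are nondegenerate: off the boundary because the form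
is, and on the boundary because of the contact condition. -/
theorem IsWeakFilling.scCoeff_nondegenerate (h : IsWeakFilling ι Ω α)
    (ha : ∀ p, a.SmoothAt p) (hια : DiffForm.pullback ι a = α)
    (hρ : IsBoundaryDefining (n := 2 * m + 2) ρ) {F : W → ℝ}
    (hnd : ∀ p, 0 < ρ p → NondegenerateOn ((addExact Ω F a).val p) Set.univ) {p₀ : W}
    {f : EuclideanSpace ℝ (Fin (2 * m + 2)) → ℝ}
    (hf : ∀ y ∈ (extChartAt (𝓡∂ (2 * m + 2)) p₀).target,
      ContDiffWithinAt ℝ ∞ f (Set.range (𝓡∂ (2 * m + 2))) y)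
    (hf0 : ∀ y ∈ (extChartAt (𝓡∂ (2 * m + 2)) p₀).target, y 0 = 0 → 0 < f y)
    (hc : IsScatteringCoeff (addExact Ω F a) p₀
      (scCoeff (Ω.inChart p₀) fun y => f y • a.inChart p₀ y))
    {y : EuclideanSpace ℝ (Fin (2 * m + 2))}
    (hy : y ∈ (extChartAt (𝓡∂ (2 * m + 2)) p₀).target) :
    NondegenerateOn (scCoeff (Ω.inChart p₀) (fun y => f y • a.inChart p₀ y) y) Set.univ := by
  have hys := (extChartAt (𝓡∂ (2 * m + 2)) p₀).map_target hy
  have hyr := (extChartAt (𝓡∂ (2 * m + 2)) p₀).right_inv hy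
  rcases (nonneg_of_mem_target hy).eq_or_lt with hy0 | hy0
  · have hb : (extChartAt (𝓡∂ (2 * m + 2)) p₀).symm y ∈ (𝓡∂ (2 * m + 2)).boundary W := by
      rw [mem_boundary_iff hys, hyr]
      exact hy0.symm
    obtain ⟨z, hz⟩ : (extChartAt (𝓡∂ (2 * m + 2)) p₀).symm y ∈ Set.range ι := by
      rwa [h.boundary.range_eq]
    obtain ⟨R, hR, haR, -, hA⟩ := h.boundary_data ha hια hρ z
    obtain ⟨c, hc0, hdρ⟩ := hρ.exists_deriv hy hy0.symm
    rw [hz] at hR haR hA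
    obtain ⟨R', rfl⟩ := (chartFrame_bijective hy).2 R
    have hτ : ∀ v : EuclideanSpace ℝ (Fin (2 * m + 2)),
        diff m ρ ((extChartAt (𝓡∂ (2 * m + 2)) p₀).symm y) (chartFrame (𝓡∂ (2 * m + 2)) p₀ y v) = 0 ↔
          v 0 = 0 := fun v => by
      rw [hdρ, mul_eq_zero, or_iff_right hc0.ne']
    have hav : ∀ v, a.inChart p₀ y ![v] =
        a.val ((extChartAt (𝓡∂ (2 * m + 2)) p₀).symm y) ![chartFrame (𝓡∂ (2 * m + 2)) p₀ y v] :=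
      fun v => by rw [DiffForm.inChart_eq, comp_one]
    refine scCoeff_nondegenerate_boundary ((hf y hy).differentiableWithinAt (by simp))
      ((DiffForm.SmoothAt.inChart hy (ha _)).differentiableWithinAt (by simp))
      (extChartAt_target_subset_range p₀ hy) hy0.symm (hf0 y hy hy0.symm) (R := R') ?_ ?_ ?_
    · rw [← hτ, ← hR, alternating_self]
    · rw [hav]
      exact haR.ne'
    · rw [← DiffForm.inChart_d hy (ha _)]
      intro u hu huv
      refine (map_eq_zero_iff _ (chartFrame_bijective hy).1).1
        (hA _ ⟨by rw [← hav]; exact hu.1, (hτ u).2 hu.2⟩ fun v hv => ?_)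
      obtain ⟨v, rfl⟩ := (chartFrame_bijective hy).2 v
      have := huv v ⟨by rw [hav]; exact hv.1, (hτ v).1 hv.2⟩
      rwa [DiffForm.inChart_eq, comp_two] at this
  · rw [hc.eq_on_interior y hy hy0, DiffForm.inChart_eq]
    refine ((hnd _ ?_).comp_bijective (chartFrame_bijective hy)).comp_bijective
      (scFrame_bijective hy0)
    rw [hρ.pos_iff, mem_interior_iff hys, hyr]
    exact hy0

/-- The contact structure induced on the boundary by `Ω + d(F a)`. -/
theorem IsWeakFilling.contact_eq_scCoeff (h : IsWeakFilling ι Ω α)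
    (hια : DiffForm.pullback ι a = α)
    (hρ : IsBoundaryDefining (n := 2 * m + 2) ρ) (z : Z)
    {f : EuclideanSpace ℝ (Fin (2 * m + 2)) → ℝ}
    (hf0 : 0 < f (extChartAt (𝓡∂ (2 * m + 2)) (ι z) (ι z))) :
    ∃ r : ℝ, 0 < r ∧ ∀ u : TangentSpace (𝓡 (2 * m + 1)) z,
      α z ![u] = r * scCoeff (Ω.inChart (ι z)) (fun y => f y • a.inChart (ι z) y)
        (extChartAt (𝓡∂ (2 * m + 2)) (ι z) (ι z))
        ![mfderiv (𝓡∂ (2 * m + 2)) 𝓘(ℝ, EuclideanSpace ℝ (Fin (2 * m + 2)))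
            (extChartAt (𝓡∂ (2 * m + 2)) (ι z)) (ι z) (dIncl ι z u), transverseVector m] := by
  set y := extChartAt (𝓡∂ (2 * m + 2)) (ι z) (ι z) with hy
  refine ⟨1 / (2 * f y), by positivity, fun u => ?_⟩
  let D := modelDeriv (𝓡 (2 * m + 1)) (𝓡∂ (2 * m + 2)) ι z
  have hb : ι z ∈ (𝓡∂ (2 * m + 2)).boundary W := h.boundary.range_eq ▸ ⟨z, rfl⟩
  obtain ⟨c, hc0, hdρ⟩ := diff_boundary hρ hb
  have hD0 : (D u) 0 = 0 := by
    have := diff_comp_boundary h.boundary hρ z u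
    rw [hdρ] at this
    exact (mul_eq_zero.1 this).resolve_left hc0.ne'
  have hy0 : y 0 = 0 := (mem_boundary_iff (mem_extChartAt_source (ι z))).1 hb
  have hid : mfderiv (𝓡∂ (2 * m + 2)) 𝓘(ℝ, EuclideanSpace ℝ (Fin (2 * m + 2)))
      (extChartAt (𝓡∂ (2 * m + 2)) (ι z)) (ι z) (dIncl ι z u) = D u := by
    have : IsManifold (𝓡∂ (2 * m + 2)) 1 W := IsManifold.of_le (m := 1) (n := ∞) (by simp)
    have h1 : modelDeriv (𝓡∂ (2 * m + 2)) 𝓘(ℝ, EuclideanSpace ℝ (Fin (2 * m + 2)))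
      (extChartAt (𝓡∂ (2 * m + 2)) (ι z)) (ι z) = ContinuousLinearMap.id ℝ _ :=
        mfderiv_extChartAt_self (I := 𝓡∂ (2 * m + 2)) (x := ι z)
    exact congrArg (fun L : EuclideanSpace ℝ (Fin (2 * m + 2)) →L[ℝ]
      EuclideanSpace ℝ (Fin (2 * m + 2)) => L (D u)) h1
  have hα : ∀ u, α.val z ![u] = a.val (ι z) ![D u] := fun u => by
    rw [← comp_one, ← hια]
    rfl
  have hmain := scCoeff_transverse (Θ := Ω.inChart (ι z)) (B := fun y => f y • a.inChart (ι z) y)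
    hy0 hD0
  refine (hα u).trans (Eq.trans ?_ (congrArg (1 / (2 * f y) * ·) (hmain.symm.trans (congrArg (fun w =>
    scCoeff (Ω.inChart (ι z)) (fun y => f y • a.inChart (ι z) y) y ![w, transverseVector m])
    hid.symm))))
  have h2 : a.inChart (ι z) y = a.val (ι z) := DiffForm.inChart_self a (ι z)
  rw [h2]
  change _ = 1 / (2 * f y) * (2 * (f y * a.val (ι z) ![D u]))
  field_simp

end Filling

end ScatteringFilling

end

theorem proposition3p9 {m : ℕ}
    {W : Type*} [TopologicalSpace W] [T2Space W] [SecondCountableTopology W]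
    [ChartedSpace (EuclideanHalfSpace (2 * m + 2)) W] [IsManifold (𝓡∂ (2 * m + 2)) ∞ W]
    {Z : Type*} [TopologicalSpace Z]
    [ChartedSpace (EuclideanSpace ℝ (Fin (2 * m + 1))) Z] [IsManifold (𝓡 (2 * m + 1)) ∞ Z]
    (ι : Z → W) (Ω : ScatteringFilling.DiffForm (𝓡∂ (2 * m + 2)) W 2)
    (α : ScatteringFilling.DiffForm (𝓡 (2 * m + 1)) Z 1)
    (h : ScatteringFilling.IsWeakFilling ι Ω α) :
    ∃ Ω' : ScatteringFilling.DiffForm (𝓡∂ (2 * m + 2)) W 2,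
      ScatteringFilling.HasScatteringBoundary ι Ω' α := by
  open ScatteringFilling in
  have : LocallyCompactSpace W := Manifold.locallyCompact_of_finiteDimensional (𝓡∂ (2 * m + 2))
  have hΩs := h.symplectic.smooth
  have hcl : IsClosed (Set.range ι) := by
    rw [h.boundary.range_eq]
    exact ModelWithCorners.isClosed_boundary (n := ∞) (by simp)
  obtain ⟨a, ha, hια⟩ := exists_extension h.boundary.smoothEmbedding hcl h.contact.smooth
  obtain ⟨ρ, hρ⟩ := exists_isBoundaryDefining (n := 2 * m + 2) (W := W)
  obtain ⟨φ, hφ, hφK⟩ := exists_smooth_exhaustion (𝓡∂ (2 * m + 2)) W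
  have hρ0 : ∀ p, 0 ≤ ρ p := fun p => by
    rcases (𝓡∂ (2 * m + 2)).isInteriorPoint_or_isBoundaryPoint p with hp | hp
    · exact ((hρ.pos_iff p).2 hp).le
    · exact ((hρ.eq_zero_iff p).2 hp).ge
  have hnear : ∀ p, ρ p = 0 → ∃ δ > 0, ∀ᶠ q in 𝓝 p, TwistRadius Ω a ρ φ δ q := by
    intro p hp
    have hb := (hρ.eq_zero_iff p).1 hp
    obtain ⟨z, rfl⟩ : p ∈ Set.range ι := by rwa [h.boundary.range_eq]
    obtain ⟨R, hR, haR, hξ, hA⟩ := h.boundary_data ha hια hρ z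
    obtain ⟨c, hc0, hdρ⟩ := diff_boundary hρ hb
    refine exists_twistRadius_near (hΩs.smoothAt _) ha hρ.smooth hφ
      (h.symplectic.nondegenerate (ι z)) hR haR (ν := EuclideanSpace.single 0 1) ?_ hξ hA
    rw [hdρ]
    simpa using hc0.ne'
  -- a twist radius that is uniform on each sublevel set of the exhaustion
  have hδ : ∀ n : ℕ, ∃ δ > 0, ∀ q, φ q ≤ n + 1 → ρ q < δ → TwistRadius Ω a ρ φ δ q := by
    intro n
    obtain ⟨K, hK, hsub⟩ := hφK (n + 1)
    obtain ⟨δ, hδ, hKδ⟩ := exists_twistRadius_compact hρ.smooth.continuous hρ0 hnear hK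
    exact ⟨δ, hδ, fun q hq => hKδ q (hsub (by push_cast; exact hq))⟩
  choose δ hδ0 hδ using hδ
  obtain ⟨η, hη, hη0, hηδ, hη'δ⟩ := exists_small_function δ hδ0
  have hnd : ∀ p, 0 < ρ p →
      NondegenerateOn ((addExact Ω (conformalFactor η φ ρ) a).val p) Set.univ := fun p hp =>
    addExact_nondegenerate hη hρ.smooth hφ ha (h.symplectic.nondegenerate p) hp (hηδ _) (hη'δ _)
      (hδ _ p (Nat.lt_floor_add_one _).le)
  refine ⟨addExact Ω (conformalFactor η φ ρ) a, ⟨fun p hp => ?_, fun p₀ => ?_⟩, h.boundary,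
    h.contact, fun z => ?_⟩
  · have hp' := (hρ.pos_iff p).2 hp
    exact addExact_closed (fun p => hΩs.smoothAt p) h.symplectic.closed ha
      ((hρ.smooth.continuous.continuousAt.eventually (lt_mem_nhds hp')).mono fun q hq =>
        contMDiffAt_conformalFactor hη hρ.smooth hφ hq)
  · obtain ⟨f, hf, hf0, hc⟩ := exists_isScatteringCoeff hΩs ha hρ hφ hη hη0 p₀
    exact ⟨_, hc, fun y hy => h.scCoeff_nondegenerate ha hια hρ hnd hf hf0 hc hy⟩
  · obtain ⟨f, hf, hf0, hc⟩ := exists_isScatteringCoeff hΩs ha hρ hφ hη hη0 (ι z)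
    refine ⟨_, hc, h.contact_eq_scCoeff hια hρ z (hf0 _ (mem_extChartAt_target (ι z)) ?_)⟩
    exact (mem_boundary_iff (mem_extChartAt_source (ι z))).1
      (h.boundary.range_eq ▸ ⟨z, rfl⟩)
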